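/- Let \(M\) be a smooth manifold with a smooth vector field \(X\), let \(\eta\in\Omega^1(M)\) be a closed one-form with \(\eta(X)=0\), and let \(F\in\Omega^2(M)\) satisfy \(dF=\eta\wedge F\). Let \(\pi\colon P\to M\) be a smooth locally trivial fibre bundle with fibre the circle, and let \(\theta\in\Omega^1(P)\) be a one-form such that \(TP=\ker\theta\oplus\ker\pi_*\) and \[ d\theta=\pi^*\eta\wedge\theta+\pi^*F . \] Then \(\eta\) is exact: \(\eta=df\) for some \(f\in C^\infty(M)\). Moreover, let \(Y\) be the vertical vector field on \(P\) with \(\theta(Y)=1\) (it exists, is unique and is smooth). Let \(q\colon\widetilde M\to M\) be any smooth covering on which \(q^*\eta\) is exact, \(q^*\eta=df_0\) with \(f_0\in C^\infty(\widetilde M)\). Let \(\tilde\pi\colon\widetilde P\to\widetilde M\) be the pull-back of \(P\), and denote the pull-backs of \(F\), \(Y\), \(\theta\) to \(\widetilde M\) and \(\widetilde P\) by the same letters. Then there is \(f\in C^\infty(\widetilde M)\) with \(df=q^*\eta\), differing from \(f_0\) by a locally constant function (a constant if \(\widetilde M\) is connected), such that 1. \(e^{f}Y\) is a principal vector field: it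 generates an action of the circle group \(\{e^{it}\}\), \(t\in\mathbb R/2\pi\mathbb Z\), making \(\tilde\pi\) a smooth principal circle bundle; 2. \(e^{-f}\theta\) is a principal connection for this action: it is invariant and \((e^{-f}\theta)(e^fY)=1\); 3. its curvature is \(e^{-f}F\), that is \(d(e^{-f}\theta)=\tilde\pi^*(e^{-f}F)\); 4. \(\frac1{2\pi}e^{-f}F\) has integral periods: its integral over every smooth singular two-cycle with integer coefficients in \(\widetilde M\) is an integer. (Here \(e^{\pm f}\) on \(\widetilde P\) means \(e^{\pm f\circ\tilde\pi}\).) -/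

import Mathlib

open scoped Manifold ContDiff Topology
open Set

noncomputable section

section Forms

variable {E : Type*} [NormedAddCommGroup E] [NormedSpace ℝ E]
variable {E' : Type*} [NormedAddCommGroup E'] [NormedSpace ℝ E']
variable {M : Type*} [TopologicalSpace M] [ChartedSpace E M]
variable {N : Type*} [TopologicalSpace N] [ChartedSpace E' N]

/-- Differential `k`-forms (not necessarily smooth) on a manifold `M` modelled on `E`. -/
abbrev DForm (E : Type*) [NormedAddCommGroup E] [NormedSpace ℝ E]
    (M : Type*) [TopologicalSpace M] [ChartedSpace E M] (k : ℕ) : Type _ :=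
  (x : M) → (TangentSpace 𝓘(ℝ, E) x) [⋀^Fin k]→L[ℝ] ℝ

/-- The pull-back `g^*α` of a form along a map `g : N → M`. -/
def DForm.pullback (g : N → M) {k : ℕ} (α : DForm E M k) : DForm E' N k :=
  fun y => (α (g y)).compContinuousLinearMap (mfderiv 𝓘(ℝ, E') 𝓘(ℝ, E) g y)

/-- The local representative of a form in the chart around `x₀`: its pull-back along the inverse
of the chart, a form on (an open subset of) the model space `E`. -/
def DForm.inChart {k : ℕ} (α : DForm E M k) (x₀ : M) : E → E [⋀^Fin k]→L[ℝ] ℝ :=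
  fun y => (α ((extChartAt 𝓘(ℝ, E) x₀).symm y)).compContinuousLinearMap
    (mfderiv 𝓘(ℝ, E) 𝓘(ℝ, E) (extChartAt 𝓘(ℝ, E) x₀).symm y)

/-- A form is smooth when its local representatives are smooth. -/
def DForm.IsSmooth {k : ℕ} (α : DForm E M k) : Prop :=
  ∀ x₀ : M, ContDiffOn ℝ ∞ (α.inChart x₀) (extChartAt 𝓘(ℝ, E) x₀).target

/-- The exterior derivative: at `x`, take the exterior derivative of the local representative in
the chart around `x`, and pull the result back to `T_x M` by the differential of that chart. -/
def DForm.d {k : ℕ} (α : DForm E M k) : DForm E M (k + 1) :=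
  fun x => (extDeriv (α.inChart x) (extChartAt 𝓘(ℝ, E) x x)).compContinuousLinearMap
    (mfderiv 𝓘(ℝ, E) 𝓘(ℝ, E) (extChartAt 𝓘(ℝ, E) x) x)

/-- The covector at `x` defined by a one-form. -/
def DForm.covector (η : DForm E M 1) (x : M) : TangentSpace 𝓘(ℝ, E) x →L[ℝ] ℝ :=
  (ContinuousAlternatingMap.ofSubsingleton ℝ (TangentSpace 𝓘(ℝ, E) x) ℝ (0 : Fin 1)).symm (η x)

/-- The wedge product `η ∧ α` of a one-form and a `k`-form:
`(η ∧ α)(v₀, …, v_k) = ∑ i, (-1)^i η(v_i) α(v₀, …, v_{i-1}, v_{i+1}, …, v_k)`. -/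
def DForm.wedge {k : ℕ} (η : DForm E M 1) (α : DForm E M k) : DForm E M (k + 1) :=
  fun x =>
    let ηx : E →L[ℝ] ℝ := η.covector x
    let αx : E [⋀^Fin k]→L[ℝ] ℝ := α x
    (ContinuousAlternatingMap.alternatizeUncurryFin (ηx.smulRight αx) :
      E [⋀^Fin (k + 1)]→L[ℝ] ℝ)

/-- The differential `df` of a function, as a one-form. -/
def DForm.differential (E : Type*) [NormedAddCommGroup E] [NormedSpace ℝ E]
    {M : Type*} [TopologicalSpace M] [ChartedSpace E M] (f : M → ℝ) : DForm E M 1 :=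
  fun x => ContinuousAlternatingMap.ofSubsingleton ℝ (TangentSpace 𝓘(ℝ, E) x) ℝ (0 : Fin 1)
    (mfderiv 𝓘(ℝ, E) 𝓘(ℝ, ℝ) f x)

/-- A one-form is exact when it is the differential of a smooth function. -/
def DForm.IsExact (η : DForm E M 1) : Prop :=
  ∃ f : M → ℝ, ContMDiff 𝓘(ℝ, E) 𝓘(ℝ, ℝ) ∞ f ∧ DForm.differential E f = η

/-- The product `u α` of a function and a form. -/
def DForm.fsmul (u : M → ℝ) {k : ℕ} (α : DForm E M k) : DForm E M k :=
  fun x => u x • α x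

/-- Smooth vector fields. -/
def IsSmoothVectorField [IsManifold 𝓘(ℝ, E) 1 M] (Y : (x : M) → TangentSpace 𝓘(ℝ, E) x) : Prop :=
  ContMDiff 𝓘(ℝ, E) 𝓘(ℝ, E).tangent ∞ (fun x => (⟨x, Y x⟩ : TangentBundle 𝓘(ℝ, E) M))

/-- The standard triangle, with vertices `(0,0)`, `(1,0)` and `(0,1)`. -/
def stdTriangle : Set (ℝ × ℝ) := {p | 0 ≤ p.1 ∧ 0 ≤ p.2 ∧ p.1 + p.2 ≤ 1}

/-- The boundary of a singular two-simplex `σ` (a map on the standard triangle), in the free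
abelian group on paths: the edges `[v₁,v₂] - [v₀,v₂] + [v₀,v₁]`. -/
def triangleBoundary (σ : ℝ × ℝ → M) : (unitInterval → M) →₀ ℤ :=
  Finsupp.single (fun t : unitInterval => σ (1 - (t : ℝ), (t : ℝ))) 1
    - Finsupp.single (fun t : unitInterval => σ (0, (t : ℝ))) 1
    + Finsupp.single (fun t : unitInterval => σ ((t : ℝ), 0)) 1

/-- The integral of a two-form over a smooth singular two-simplex. -/
def DForm.integralTriangle (α : DForm E M 2) (σ : ℝ × ℝ → M) : ℝ :=
  ∫ p in stdTriangle,
    α (σ p) ![mfderivWithin 𝓘(ℝ, ℝ × ℝ) 𝓘(ℝ, E) σ stdTriangle p ((1, 0) : ℝ × ℝ),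
      mfderivWithin 𝓘(ℝ, ℝ × ℝ) 𝓘(ℝ, E) σ stdTriangle p ((0, 1) : ℝ × ℝ)]

/-- A two-form has integral periods when its integral over every smooth singular two-cycle
`∑ i, a i • σ i` with integer coefficients is an integer. -/
def DForm.HasIntegralPeriods (α : DForm E M 2) : Prop :=
  ∀ (k : ℕ) (a : Fin k → ℤ) (σ : Fin k → ℝ × ℝ → M),
    (∀ i, ContMDiffOn 𝓘(ℝ, ℝ × ℝ) 𝓘(ℝ, E) ∞ (σ i) stdTriangle) →
    ∑ i, a i • triangleBoundary (σ i) = 0 →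
    ∃ n : ℤ, ∑ i, (a i : ℝ) * α.integralTriangle (σ i) = n

end Forms

section Bundles

variable {E : Type*} [NormedAddCommGroup E] [NormedSpace ℝ E]
variable {E' : Type*} [NormedAddCommGroup E'] [NormedSpace ℝ E']
variable {M : Type*} [TopologicalSpace M] [ChartedSpace E M]
variable {P : Type*} [TopologicalSpace P] [ChartedSpace E' P]

/-- A local trivialisation `π⁻¹(U) ≃ U × S¹` that is a diffeomorphism. -/
def IsSmoothTrivialization (E E' : Type*) [NormedAddCommGroup E] [NormedSpace ℝ E]
    [NormedAddCommGroup E'] [NormedSpace ℝ E']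
    {M : Type*} [TopologicalSpace M] [ChartedSpace E M]
    {P : Type*} [TopologicalSpace P] [ChartedSpace E' P]
    {π : P → M} (e : Bundle.Trivialization Circle π) : Prop :=
  ContMDiffOn 𝓘(ℝ, E') (𝓘(ℝ, E).prod (𝓡 1)) ∞ e e.source ∧
  ContMDiffOn (𝓘(ℝ, E).prod (𝓡 1)) 𝓘(ℝ, E') ∞ e.toOpenPartialHomeomorph.symm e.target

/-- `π : P → M` is a smooth (locally trivial) fibre bundle with fibre the circle. -/
def IsSmoothCircleBundle (E E' : Type*) [NormedAddCommGroup E] [NormedSpace ℝ E]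
    [NormedAddCommGroup E'] [NormedSpace ℝ E']
    {M : Type*} [TopologicalSpace M] [ChartedSpace E M]
    {P : Type*} [TopologicalSpace P] [ChartedSpace E' P] (π : P → M) : Prop :=
  ContMDiff 𝓘(ℝ, E') 𝓘(ℝ, E) ∞ π ∧
  ∀ x : M, ∃ e : Bundle.Trivialization Circle π, x ∈ e.baseSet ∧ IsSmoothTrivialization E E' e

/-- The distribution `ker θ` is a complement to the vertical distribution `ker π_*`. -/
def IsTransverseToFibres (π : P → M) (θ : DForm E' P 1) : Prop :=
  ∀ p : P, IsCompl (LinearMap.ker (θ.covector p).toLinearMap)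
    (LinearMap.ker (mfderiv 𝓘(ℝ, E') 𝓘(ℝ, E) π p).toLinearMap)

/-- `Φ` is an action of the circle group on `P` making `π : P → M` a smooth principal circle
bundle: a smooth action preserving the fibres, with smooth equivariant local trivialisations. -/
structure IsPrincipalCircleAction (E E' : Type*) [NormedAddCommGroup E] [NormedSpace ℝ E]
    [NormedAddCommGroup E'] [NormedSpace ℝ E']
    {M : Type*} [TopologicalSpace M] [ChartedSpace E M]
    {P : Type*} [TopologicalSpace P] [ChartedSpace E' P]
    (π : P → M) (Φ : Circle → P → P) : Prop where
  one_act : ∀ p, Φ 1 p = p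
  mul_act : ∀ z w p, Φ (z * w) p = Φ z (Φ w p)
  smooth_act : ContMDiff ((𝓡 1).prod 𝓘(ℝ, E')) 𝓘(ℝ, E') ∞ (fun a : Circle × P => Φ a.1 a.2)
  smooth_proj : ContMDiff 𝓘(ℝ, E') 𝓘(ℝ, E) ∞ π
  proj_act : ∀ z p, π (Φ z p) = π p
  locally_trivial : ∀ x : M, ∃ e : Bundle.Trivialization Circle π,
    x ∈ e.baseSet ∧ IsSmoothTrivialization E E' e ∧
    ∀ z p, p ∈ e.source → e (Φ z p) = ((e p).1, z * (e p).2)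

/-- `Y` generates the action `Φ` of the circle `{e^{it}}`: the orbit maps `t ↦ Φ (e^{it}) p` are
the integral curves of `Y`. -/
def GeneratesCircleAction (Φ : Circle → P → P) (Y : (p : P) → TangentSpace 𝓘(ℝ, E') p) : Prop :=
  ∀ p : P, IsMIntegralCurve (I := 𝓘(ℝ, E')) (fun t : ℝ => Φ (Circle.exp t) p) Y

/-- `θ` is a principal connection one-form for the circle action `Φ` generated by `Y`. -/
structure IsPrincipalConnection (Φ : Circle → P → P) (Y : (p : P) → TangentSpace 𝓘(ℝ, E') p)
    (θ : DForm E' P 1) : Prop where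
  smooth : θ.IsSmooth
  normalized : ∀ p, θ.covector p (Y p) = 1
  invariant : ∀ z, DForm.pullback (Φ z) θ = θ

end Bundles

section Covers

/-- `q : N → M` is a smooth covering. -/
def IsSmoothCovering (E : Type*) [NormedAddCommGroup E] [NormedSpace ℝ E]
    {M : Type*} [TopologicalSpace M] [ChartedSpace E M]
    {N : Type*} [TopologicalSpace N] [ChartedSpace E N] (q : N → M) : Prop :=
  IsCoveringMap q ∧ IsLocalDiffeomorph 𝓘(ℝ, E) 𝓘(ℝ, E) ∞ q

/-- `π' : Q → N`, together with `q' : Q → P`, is the pull-back of `π : P → M` along the smooth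
covering `q : N → M`: the map `(π', q')` is a bijection of `Q` onto the fibre product `N ×_M P`,
and the smooth structure of `Q` is the one for which `q'` is a local diffeomorphism. -/
structure IsPullbackAlongCovering (E E' : Type*) [NormedAddCommGroup E] [NormedSpace ℝ E]
    [NormedAddCommGroup E'] [NormedSpace ℝ E']
    {M : Type*} [TopologicalSpace M] [ChartedSpace E M]
    {P : Type*} [TopologicalSpace P] [ChartedSpace E' P]
    {N : Type*} [TopologicalSpace N] [ChartedSpace E N]
    {Q : Type*} [TopologicalSpace Q] [ChartedSpace E' Q]
    (π : P → M) (q : N → M) (π' : Q → N) (q' : Q → P) : Prop where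
  smooth_proj : ContMDiff 𝓘(ℝ, E') 𝓘(ℝ, E) ∞ π'
  local_diffeo : IsLocalDiffeomorph 𝓘(ℝ, E') 𝓘(ℝ, E') ∞ q'
  comm : ∀ r, π (q' r) = q (π' r)
  fibre_product : ∀ (x : N) (p : P), π p = q x → ∃! r : Q, π' r = x ∧ q' r = p

end Covers

end

/-! The primitive of η is the logarithm of the length of the fibres measured by θ. Transversality
says that θ has no zero on vertical vectors, so each fibre, a circle, can be parametrised by ℝ with
θ-speed 1, smoothly in the base point (`FibreChart.exists_unitSpeed`). Let κ(y,t) be such a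
parametrisation and T(y) the signed length of the fibre over y, so that κ(y, t + T(y)) = κ(y,t).

The structure equation evaluated on a base direction v and on ∂_t gives ∂_t θ(v) = -η(v): after a
time t the horizontal coefficient of κ^*θ has changed by -t η(v)
(`FibreChart.pull_apply_horizontal`). Differentiating the periodicity relation and comparing at t =
0 and t = T yields dT = T η (`FibreChart.fderiv_period`). Two unit speed parametrisations of one
fibre differ by a translation, hence |T| is a global function on the base, and f = log(|T|/2π)
satisfies df = η (`exists_logPeriod`).

Put θ₀ = e^{-f} θ. The term -df ∧ θ₀ coming from the factor cancels η ∧ θ₀, so dθ₀ = e^{-f} π^*F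
(`d_rescaled`), and all fibres now have length 2π. Translating the fibre parameter is therefore a
well defined free circle action (`circleAction`), generated by e^f Y; the associated phase gives
equivariant trivialisations. Since dθ₀ is basic, the coefficients of θ₀ do not depend on t, which is
invariance.

Integrality is a holonomy argument. Parallel transport around a rectangle equals exp(-i ∫
curvature): this is Green's theorem where the image lies in one chart, and small rectangles are
assembled by a subdivision (`ConnectionCharts.holonomyFormula_unitSquare`). Base points are fixed in
all fibres, so that transport along each path is an element of the circle and extends to a
homomorphism on one-chains. On the boundary of a triangle it is exp(-i ∫ e^{-f}F); on a cycle it is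
1, so the total integral lies in 2πℤ (`ConnectionCharts.hasIntegralPeriods`).

These facts are collected in `exists_principal_rescaling`. For a cover, the pulled back bundle
satisfies the same hypotheses, so the result is applied to it directly; the primitive so obtained
and the given f₀ have equal differentials. -/

set_option linter.unusedSectionVars false

noncomputable section

/-! ### One-forms and their exterior derivative in an arbitrary parametrisation -/

section FormCalculus

variable {E : Type*} [NormedAddCommGroup E] [NormedSpace ℝ E]
variable {M : Type*} [TopologicalSpace M] [ChartedSpace E M]
variable {V : Type*} [NormedAddCommGroup V] [NormedSpace ℝ V]

/-- The covector field on a normed space obtained by pulling a one-form back. -/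
def DForm.pull (κ : V → M) (α : DForm E M 1) : V → (V →L[ℝ] ℝ) :=
  fun z => ContinuousLinearMap.comp (α.covector (κ z)) (mfderiv 𝓘(ℝ, V) 𝓘(ℝ, E) κ z)

theorem DForm.pull_apply (κ : V → M) (α : DForm E M 1) (z v : V) :
    α.pull κ z v = α.covector (κ z) (mfderiv 𝓘(ℝ, V) 𝓘(ℝ, E) κ z v) := rfl

/-- `extDeriv` depends only on the germ, so a one-form known only near z may be replaced by its
covector field. The normalisation carries no factor 1/2. -/
theorem extDeriv_oneForm_apply {β : V → V [⋀^Fin 1]→L[ℝ] ℝ} {a : V → (V →L[ℝ] ℝ)} {z : V}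
    (h : β =ᶠ[𝓝 z] fun y => ContinuousAlternatingMap.ofSubsingleton ℝ V ℝ (0 : Fin 1) (a y))
    (ha : DifferentiableAt ℝ a z) (v w : V) :
    extDeriv β z ![v, w] = fderiv ℝ a z v w - fderiv ℝ a z w v := by
  rw [h.extDeriv_eq]
  have hd : DifferentiableAt ℝ
      (fun y => ContinuousAlternatingMap.ofSubsingleton ℝ V ℝ (0 : Fin 1) (a y)) z :=
    ((ContinuousAlternatingMap.ofSubsingletonLIE (𝕜 := ℝ) (E := V) (F := ℝ)
      (0 : Fin 1)).toContinuousLinearEquiv.toContinuousLinearMap.differentiableAt).comp z ha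
  rw [extDeriv_apply hd]
  have key : ∀ u : V, fderiv ℝ (fun y => a y u) z = (fderiv ℝ a z).flip u := by
    intro u
    rw [fderiv_clm_apply ha (differentiableAt_const u)]
    ext; simp
  simp [Fin.sum_univ_two, Fin.removeNth, key]
  ring

theorem differentiableAt_inChart {k : ℕ} {α : DForm E M k} (hα : α.IsSmooth) {x : M} {y : E}
    (hy : y ∈ (extChartAt 𝓘(ℝ, E) x).target) : ContDiffAt ℝ ∞ (α.inChart x) y :=
  (hα x).contDiffAt ((isOpen_extChartAt_target x).mem_nhds hy)

section

variable [IsManifold 𝓘(ℝ, E) ∞ M]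

/-- Near `z`, the pull-back of a one-form is the pull-back of its chart representative. -/
theorem DForm.pull_eventuallyEq (α : DForm E M 1) {κ : V → M} {z : V}
    (hκ : ContMDiffAt 𝓘(ℝ, V) 𝓘(ℝ, E) ∞ κ z) (x : M) (hx : κ z ∈ (extChartAt 𝓘(ℝ, E) x).source) :
    (fun y => (α.inChart x (extChartAt 𝓘(ℝ, E) x (κ y))).compContinuousLinearMap
        (fderiv ℝ (fun y => extChartAt 𝓘(ℝ, E) x (κ y)) y)) =ᶠ[𝓝 z]
      fun y => ContinuousAlternatingMap.ofSubsingleton ℝ V ℝ (0 : Fin 1) (α.pull κ y) := by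
  have : IsManifold 𝓘(ℝ, E) 1 M := IsManifold.of_le (n := ∞) (by simp)
  have h1 : ∀ᶠ y in 𝓝 z, ContMDiffAt 𝓘(ℝ, V) 𝓘(ℝ, E) 1 κ y :=
    (contMDiffAt_iff_contMDiffAt_nhds (by simp)).1 (hκ.of_le (n := ∞) (m := 1) (by simp))
  have h2 : ∀ᶠ y in 𝓝 z, κ y ∈ (extChartAt 𝓘(ℝ, E) x).source :=
    hκ.continuousAt.eventually ((isOpen_extChartAt_source x).mem_nhds hx)
  filter_upwards [h1, h2.eventually_nhds] with y hy1 hy2'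
  have hy2 := hy2'.self_of_nhds
  have : IsManifold 𝓘(ℝ, E) 1 M := IsManifold.of_le (n := ∞) (by simp)
  have hym : MDifferentiableAt 𝓘(ℝ, V) 𝓘(ℝ, E) κ y := hy1.mdifferentiableAt one_ne_zero
  have hmem : extChartAt 𝓘(ℝ, E) x (κ y) ∈ (extChartAt 𝓘(ℝ, E) x).target :=
    (extChartAt 𝓘(ℝ, E) x).map_source hy2
  have hc : MDifferentiableAt 𝓘(ℝ, E) 𝓘(ℝ, E) (extChartAt 𝓘(ℝ, E) x) (κ y) :=
    mdifferentiableAt_extChartAt (by simpa using hy2)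
  have hu : MDifferentiableAt 𝓘(ℝ, V) 𝓘(ℝ, E) (fun y => extChartAt 𝓘(ℝ, E) x (κ y)) y :=
    hc.comp y hym
  have hs : MDifferentiableAt 𝓘(ℝ, E) 𝓘(ℝ, E) (extChartAt 𝓘(ℝ, E) x).symm
      (extChartAt 𝓘(ℝ, E) x (κ y)) :=
    ((contMDiffOn_extChartAt_symm (n := ∞) x).contMDiffAt
      ((isOpen_extChartAt_target x).mem_nhds hmem)).mdifferentiableAt (by simp)
  have hcomp := mfderiv_comp (f := fun y => extChartAt 𝓘(ℝ, E) x (κ y))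
    (g := (extChartAt 𝓘(ℝ, E) x).symm) y hs hu
  have heq : ((extChartAt 𝓘(ℝ, E) x).symm ∘ fun y => extChartAt 𝓘(ℝ, E) x (κ y)) =ᶠ[𝓝 y] κ := by
    filter_upwards [hy2'] with y' hy'
    exact (extChartAt 𝓘(ℝ, E) x).left_inv hy'
  rw [heq.mfderiv_eq] at hcomp
  have hp : (extChartAt 𝓘(ℝ, E) x).symm (extChartAt 𝓘(ℝ, E) x (κ y)) = κ y :=
    (extChartAt 𝓘(ℝ, E) x).left_inv hy2
  ext v
  have e1 : ∀ w : V, mfderiv 𝓘(ℝ, V) 𝓘(ℝ, E) κ y w = mfderiv 𝓘(ℝ, E) 𝓘(ℝ, E)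
      (extChartAt 𝓘(ℝ, E) x).symm (extChartAt 𝓘(ℝ, E) x (κ y))
      (fderiv ℝ (fun y => extChartAt 𝓘(ℝ, E) x (κ y)) y w) := by
    intro w
    have := DFunLike.congr_fun hcomp w
    rw [← mfderiv_eq_fderiv]
    exact this
  -- All tangent spaces are definitionally E. Once the form is read on E, an equality of base points
  -- can be substituted; the same device recurs wherever two expressions for a point meet.
  have e2 : ∀ (p q : M) (h : p = q) (w : E), (α p : E [⋀^Fin 1]→L[ℝ] ℝ) (fun _ => w) =
      (α q : E [⋀^Fin 1]→L[ℝ] ℝ) (fun _ => w) := by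
    rintro p q rfl w; rfl
  have e3 : v = fun _ => v 0 := by ext i; rw [Subsingleton.elim i 0]
  rw [e3]
  change (α _ : E [⋀^Fin 1]→L[ℝ] ℝ) _ = (α (κ y) : E [⋀^Fin 1]→L[ℝ] ℝ)
    (fun _ => mfderiv 𝓘(ℝ, V) 𝓘(ℝ, E) κ y (v 0))
  rw [e1]
  exact e2 _ _ hp _

/-- In the chart at κ z the pull-back is the smooth local representative, evaluated along a smooth
map and composed with the derivative of that map. -/
theorem DForm.contDiffAt_pull {α : DForm E M 1} (hα : α.IsSmooth) {κ : V → M} {z : V}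
    (hκ : ContMDiffAt 𝓘(ℝ, V) 𝓘(ℝ, E) ∞ κ z) : ContDiffAt ℝ ∞ (α.pull κ) z := by
  have hx := mem_extChartAt_source (I := 𝓘(ℝ, E)) (κ z)
  have h := α.pull_eventuallyEq hκ (κ z) hx
  have hu : ContDiffAt ℝ ∞ (fun y => extChartAt 𝓘(ℝ, E) (κ z) (κ y)) z :=
    contMDiffAt_iff_contDiffAt.1 (contMDiffAt_extChartAt.comp z hκ)
  have hA := (differentiableAt_inChart hα (mem_extChartAt_target (I := 𝓘(ℝ, E)) (κ z))).comp z hu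
  have hD := hu.fderiv_right (m := ∞) (by simp)
  let L := (ContinuousAlternatingMap.ofSubsingletonLIE (𝕜 := ℝ) (E := E) (F := ℝ)
    (0 : Fin 1)).symm.toContinuousLinearEquiv
  have hA' : ContDiffAt ℝ ∞ (fun y => L (α.inChart (κ z) (extChartAt 𝓘(ℝ, E) (κ z) (κ y)))) z :=
    L.contDiff.contDiffAt.comp z hA
  refine (hA'.clm_comp hD).congr_of_eventuallyEq ?_
  filter_upwards [h] with y hy
  ext w
  exact (DFunLike.congr_fun hy (fun _ => w)).symm

/-- The exterior derivative of a one-form in a parametrisation. -/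
theorem DForm.d_apply_pull {α : DForm E M 1} (hα : α.IsSmooth) {κ : V → M} {z : V}
    (hκ : ContMDiffAt 𝓘(ℝ, V) 𝓘(ℝ, E) ∞ κ z) (v w : V) :
    α.d (κ z) ![mfderiv 𝓘(ℝ, V) 𝓘(ℝ, E) κ z v, mfderiv 𝓘(ℝ, V) 𝓘(ℝ, E) κ z w] =
      fderiv ℝ (α.pull κ) z v w - fderiv ℝ (α.pull κ) z w v := by
  have hx := mem_extChartAt_source (I := 𝓘(ℝ, E)) (κ z)
  have : IsManifold 𝓘(ℝ, E) 1 M := IsManifold.of_le (n := ∞) (by simp)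
  rw [← extDeriv_oneForm_apply (α.pull_eventuallyEq hκ (κ z) hx)
    ((DForm.contDiffAt_pull hα hκ).differentiableAt (by simp)) v w]
  have hu : ContDiffAt ℝ ∞ (fun y => extChartAt 𝓘(ℝ, E) (κ z) (κ y)) z :=
    contMDiffAt_iff_contDiffAt.1 (contMDiffAt_extChartAt.comp z hκ)
  -- Naturality of the exterior derivative between vector spaces, applied to κ read in the chart at
  -- κ z, the very chart that defines `DForm.d` there.
  rw [extDeriv_pullback (f := fun y => extChartAt 𝓘(ℝ, E) (κ z) (κ y))
    ((differentiableAt_inChart hα (mem_extChartAt_target (I := 𝓘(ℝ, E))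
      (κ z))).differentiableAt (by simp)) hu
    (by rw [minSmoothness_of_isRCLikeNormedField]; exact ENat.LEInfty.out)]
  have hc : MDifferentiableAt 𝓘(ℝ, E) 𝓘(ℝ, E) (extChartAt 𝓘(ℝ, E) (κ z)) (κ z) :=
    mdifferentiableAt_extChartAt (by simp)
  have hcomp := mfderiv_comp (f := κ) (g := extChartAt 𝓘(ℝ, E) (κ z)) z hc
    (hκ.mdifferentiableAt (by simp))
  have e1 : ∀ w : V, fderiv ℝ (fun y => extChartAt 𝓘(ℝ, E) (κ z) (κ y)) z w =
      mfderiv 𝓘(ℝ, E) 𝓘(ℝ, E) (extChartAt 𝓘(ℝ, E) (κ z)) (κ z)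
        (mfderiv 𝓘(ℝ, V) 𝓘(ℝ, E) κ z w) := by
    intro w
    have := DFunLike.congr_fun hcomp w
    rw [← mfderiv_eq_fderiv]
    exact this
  change (extDeriv (α.inChart (κ z)) (extChartAt 𝓘(ℝ, E) (κ z) (κ z))) _ =
    (extDeriv (α.inChart (κ z)) (extChartAt 𝓘(ℝ, E) (κ z) (κ z))) _
  congr 1
  ext i
  fin_cases i
  · exact (e1 v).symm
  · exact (e1 w).symm

end

end FormCalculus
end

noncomputable section

/-! ### Functoriality of pull-backs, the Leibniz rule, naturality of d -/

section FormCalculus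

variable {E : Type*} [NormedAddCommGroup E] [NormedSpace ℝ E]
variable {M : Type*} [TopologicalSpace M] [ChartedSpace E M]
variable {E' : Type*} [NormedAddCommGroup E'] [NormedSpace ℝ E']
variable {N : Type*} [TopologicalSpace N] [ChartedSpace E' N]
variable {V : Type*} [NormedAddCommGroup V] [NormedSpace ℝ V]

theorem DForm.ext_two {x : M} {α β : (TangentSpace 𝓘(ℝ, E) x) [⋀^Fin 2]→L[ℝ] ℝ}
    (h : ∀ v w : TangentSpace 𝓘(ℝ, E) x, α ![v, w] = β ![v, w]) : α = β := by
  ext v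
  have : v = ![v 0, v 1] := by ext i; fin_cases i <;> rfl
  rw [this]; exact h _ _

theorem DForm.ext_one {x : M} {α β : (TangentSpace 𝓘(ℝ, E) x) [⋀^Fin 1]→L[ℝ] ℝ}
    (h : ∀ v : TangentSpace 𝓘(ℝ, E) x, α (fun _ => v) = β (fun _ => v)) : α = β := by
  ext v
  have : v = fun _ => v 0 := by ext i; rw [Subsingleton.elim i 0]
  rw [this]; exact h _

theorem DForm.wedge_apply_two (η α : DForm E M 1) (x : M) (v w : TangentSpace 𝓘(ℝ, E) x) :
    η.wedge α x ![v, w] = η.covector x v * α.covector x w - η.covector x w * α.covector x v := by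
  change (ContinuousAlternatingMap.alternatizeUncurryFin
    (ContinuousLinearMap.smulRight (η.covector x : E →L[ℝ] ℝ) (α x : E [⋀^Fin 1]→L[ℝ] ℝ)) :
      E [⋀^Fin 2]→L[ℝ] ℝ) ![v, w] = _
  rw [ContinuousAlternatingMap.alternatizeUncurryFin_apply]
  have e1 : Fin.removeNth (0 : Fin 2) (![v, w] : Fin 2 → E) = fun _ => w := by
    ext i; rw [Subsingleton.elim i 0]; rfl
  have e2 : Fin.removeNth (1 : Fin 2) (![v, w] : Fin 2 → E) = fun _ => v := by
    ext i; rw [Subsingleton.elim i 0]; rfl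
  rw [Fin.sum_univ_two, e1, e2]
  simp only [Fin.val_zero, pow_zero, one_smul, Fin.val_one, pow_one, neg_smul]
  exact (sub_eq_add_neg _ _).symm

theorem DForm.pullback_apply {k : ℕ} (g : N → M) (α : DForm E M k) (y : N)
    (v : Fin k → TangentSpace 𝓘(ℝ, E') y) :
    DForm.pullback g α y v = α (g y) (fun i => mfderiv 𝓘(ℝ, E') 𝓘(ℝ, E) g y (v i)) := rfl

theorem DForm.pullback_apply_two (g : N → M) (α : DForm E M 2) (y : N)
    (v w : TangentSpace 𝓘(ℝ, E') y) :
    DForm.pullback g α y ![v, w] =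
      α (g y) ![mfderiv 𝓘(ℝ, E') 𝓘(ℝ, E) g y v, mfderiv 𝓘(ℝ, E') 𝓘(ℝ, E) g y w] := by
  rw [DForm.pullback_apply]
  congr 1
  ext i; fin_cases i <;> rfl

theorem DForm.pullback_covector (g : N → M) (α : DForm E M 1) (y : N)
    (v : TangentSpace 𝓘(ℝ, E') y) :
    (DForm.pullback g α).covector y v =
      α.covector (g y) (mfderiv 𝓘(ℝ, E') 𝓘(ℝ, E) g y v) := rfl

theorem DForm.fsmul_covector (u : M → ℝ) (α : DForm E M 1) (x : M)
    (v : TangentSpace 𝓘(ℝ, E) x) :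
    (DForm.fsmul u α).covector x v = u x * α.covector x v := rfl

theorem DForm.differential_covector (f : M → ℝ) (x : M) (v : TangentSpace 𝓘(ℝ, E) x) :
    (DForm.differential E f).covector x v = mfderiv 𝓘(ℝ, E) 𝓘(ℝ, ℝ) f x v := rfl

theorem DForm.eq_of_covector {α β : DForm E M 1} (h : ∀ x v, α.covector x v = β.covector x v) :
    α = β := by
  funext x
  exact DForm.ext_one fun v => h x v

theorem DForm.pull_pullback (g : N → M) (α : DForm E M 1) {κ : V → N} {z : V}
    (hg : MDifferentiableAt 𝓘(ℝ, E') 𝓘(ℝ, E) g (κ z))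
    (hκ : MDifferentiableAt 𝓘(ℝ, V) 𝓘(ℝ, E') κ z) :
    (DForm.pullback g α : DForm E' N 1).pull κ z = α.pull (fun y => g (κ y)) z := by
  ext v
  rw [DForm.pull_apply, DForm.pull_apply, DForm.pullback_covector]
  have := mfderiv_comp (f := κ) (g := g) z hg hκ
  exact congrArg _ (DFunLike.congr_fun this v).symm

theorem DForm.pull_fsmul (u : M → ℝ) (α : DForm E M 1) (κ : V → M) (z : V) :
    (DForm.fsmul u α).pull κ z = u (κ z) • α.pull κ z := by
  ext v; rfl

theorem DForm.pull_congr (α : DForm E M 1) {κ κ' : V → M} {z : V} (h : κ =ᶠ[𝓝 z] κ') :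
    α.pull κ z = α.pull κ' z := by
  ext v
  rw [DForm.pull_apply, DForm.pull_apply]
  have e1 := h.mfderiv_eq (I := 𝓘(ℝ, V)) (I' := 𝓘(ℝ, E))
  have e2 : ∀ (p q : M) (h : p = q) (w : E), (α.covector p : E →L[ℝ] ℝ) w =
      (α.covector q : E →L[ℝ] ℝ) w := by
    rintro p q rfl w; rfl
  have e3 : (mfderiv 𝓘(ℝ, V) 𝓘(ℝ, E) κ z v : E) = mfderiv 𝓘(ℝ, V) 𝓘(ℝ, E) κ' z v := by
    exact congrArg (fun L : V →L[ℝ] E => L v) e1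
  exact (e2 _ _ h.self_of_nhds _).trans (congrArg (α.covector (κ' z) : E →L[ℝ] ℝ) e3)

/-- Alternating one-forms and covectors are identified by a continuous linear equivalence, so
smoothness can be tested on covector fields. -/
theorem DForm.isSmooth_iff_pull (α : DForm E M 1) :
    α.IsSmooth ↔ ∀ x : M, ContDiffOn ℝ ∞ (α.pull (extChartAt 𝓘(ℝ, E) x).symm)
      (extChartAt 𝓘(ℝ, E) x).target := by
  let L := (ContinuousAlternatingMap.ofSubsingletonLIE (𝕜 := ℝ) (E := E) (F := ℝ)
    (0 : Fin 1)).toContinuousLinearEquiv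
  refine forall_congr' fun x => ?_
  have : α.inChart x = L ∘ α.pull (extChartAt 𝓘(ℝ, E) x).symm := by
    funext y; ext v
    have : v = fun _ => v 0 := by ext i; rw [Subsingleton.elim i 0]
    rw [this]; rfl
  rw [this, L.comp_contDiffOn_iff]

variable [IsManifold 𝓘(ℝ, E) ∞ M]

theorem DForm.isSmooth_fsmul {u : M → ℝ} (hu : ContMDiff 𝓘(ℝ, E) 𝓘(ℝ, ℝ) ∞ u) {α : DForm E M 1}
    (hα : α.IsSmooth) : (DForm.fsmul u α).IsSmooth := by
  rw [DForm.isSmooth_iff_pull] at hα ⊢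
  intro x
  have h1 : ContDiffOn ℝ ∞ (fun y => u ((extChartAt 𝓘(ℝ, E) x).symm y))
      (extChartAt 𝓘(ℝ, E) x).target :=
    contMDiffOn_iff_contDiffOn.1 (hu.comp_contMDiffOn (contMDiffOn_extChartAt_symm x))
  exact h1.smul (hα x)

theorem contMDiffAt_extChartAt_symm {x : M} {y : E} (hy : y ∈ (extChartAt 𝓘(ℝ, E) x).target) :
    ContMDiffAt 𝓘(ℝ, E) 𝓘(ℝ, E) ∞ (extChartAt 𝓘(ℝ, E) x).symm y :=
  (contMDiffOn_extChartAt_symm x).contMDiffAt ((isOpen_extChartAt_target x).mem_nhds hy)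

/-- The differential of the chart provides the preimage. Forms at x may therefore be compared on
images of vectors of E only. -/
theorem exists_mfderiv_extChartAt_symm (x : M) (v : TangentSpace 𝓘(ℝ, E) x) :
    ∃ w : E, mfderiv 𝓘(ℝ, E) 𝓘(ℝ, E) (extChartAt 𝓘(ℝ, E) x).symm (extChartAt 𝓘(ℝ, E) x x) w =
      (v : E) := by
  have : IsManifold 𝓘(ℝ, E) 1 M := IsManifold.of_le (n := ∞) (by simp)
  have hc : MDifferentiableAt 𝓘(ℝ, E) 𝓘(ℝ, E) (extChartAt 𝓘(ℝ, E) x) x :=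
    mdifferentiableAt_extChartAt (by simp)
  have hs := (contMDiffAt_extChartAt_symm
    (mem_extChartAt_target (I := 𝓘(ℝ, E)) x)).mdifferentiableAt (by simp)
  have h := mfderiv_comp (f := extChartAt 𝓘(ℝ, E) x) (g := (extChartAt 𝓘(ℝ, E) x).symm) x hs hc
  have heq : ((extChartAt 𝓘(ℝ, E) x).symm ∘ extChartAt 𝓘(ℝ, E) x) =ᶠ[𝓝 x] id := by
    filter_upwards [extChartAt_source_mem_nhds (I := 𝓘(ℝ, E)) x] with y hy
    exact (extChartAt 𝓘(ℝ, E) x).left_inv hy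
  rw [heq.mfderiv_eq, mfderiv_id] at h
  exact ⟨mfderiv 𝓘(ℝ, E) 𝓘(ℝ, E) (extChartAt 𝓘(ℝ, E) x) x v, (DFunLike.congr_fun h v).symm⟩

/-- Two two-forms agree at `x` when they agree in the chart at `x`. -/
theorem DForm.eq_two_of_chart {x : M} {α β : (TangentSpace 𝓘(ℝ, E) x) [⋀^Fin 2]→L[ℝ] ℝ}
    (h : ∀ v w : E,
      (α : E [⋀^Fin 2]→L[ℝ] ℝ) ![mfderiv 𝓘(ℝ, E) 𝓘(ℝ, E) (extChartAt 𝓘(ℝ, E) x).symm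
        (extChartAt 𝓘(ℝ, E) x x) v, mfderiv 𝓘(ℝ, E) 𝓘(ℝ, E) (extChartAt 𝓘(ℝ, E) x).symm
        (extChartAt 𝓘(ℝ, E) x x) w] =
      (β : E [⋀^Fin 2]→L[ℝ] ℝ) ![mfderiv 𝓘(ℝ, E) 𝓘(ℝ, E) (extChartAt 𝓘(ℝ, E) x).symm
        (extChartAt 𝓘(ℝ, E) x x) v, mfderiv 𝓘(ℝ, E) 𝓘(ℝ, E) (extChartAt 𝓘(ℝ, E) x).symm
        (extChartAt 𝓘(ℝ, E) x x) w]) : α = β := by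
  refine DForm.ext_two fun v w => ?_
  obtain ⟨v', hv⟩ := exists_mfderiv_extChartAt_symm x v
  obtain ⟨w', hw⟩ := exists_mfderiv_extChartAt_symm x w
  have := h v' w'
  rw [hv, hw] at this
  exact this

/-- The exterior derivative in the chart at `x`, stated at `x` itself. -/
theorem DForm.d_apply_chart {α : DForm E M 1} (hα : α.IsSmooth) (x : M) (v w : E) :
    (α.d x : E [⋀^Fin 2]→L[ℝ] ℝ) ![mfderiv 𝓘(ℝ, E) 𝓘(ℝ, E) (extChartAt 𝓘(ℝ, E) x).symm
        (extChartAt 𝓘(ℝ, E) x x) v, mfderiv 𝓘(ℝ, E) 𝓘(ℝ, E) (extChartAt 𝓘(ℝ, E) x).symm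
        (extChartAt 𝓘(ℝ, E) x x) w] =
      fderiv ℝ (α.pull (extChartAt 𝓘(ℝ, E) x).symm) (extChartAt 𝓘(ℝ, E) x x) v w -
        fderiv ℝ (α.pull (extChartAt 𝓘(ℝ, E) x).symm) (extChartAt 𝓘(ℝ, E) x x) w v := by
  have h := DForm.d_apply_pull hα
    (contMDiffAt_extChartAt_symm (mem_extChartAt_target (I := 𝓘(ℝ, E)) x)) v w
  rw [← h]
  have e : ∀ (p q : M) (h : p = q) (a b : E), (α.d p : E [⋀^Fin 2]→L[ℝ] ℝ) ![a, b] =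
      (α.d q : E [⋀^Fin 2]→L[ℝ] ℝ) ![a, b] := by
    rintro p q rfl a b; rfl
  exact e _ _ (extChartAt_to_inv x).symm _ _

/-- In a chart this is the product rule for a function times a covector field, antisymmetrised. -/
theorem DForm.d_fsmul_apply {u : M → ℝ} (hu : ContMDiff 𝓘(ℝ, E) 𝓘(ℝ, ℝ) ∞ u) {α : DForm E M 1}
    (hα : α.IsSmooth) (x : M) :
    (DForm.fsmul u α).d x = ((DForm.differential E u).wedge α + DForm.fsmul u α.d) x := by
  refine DForm.eq_two_of_chart fun v w => ?_
  rw [DForm.d_apply_chart (DForm.isSmooth_fsmul hu hα)]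
  set c := (extChartAt 𝓘(ℝ, E) x).symm
  set z := extChartAt 𝓘(ℝ, E) x x
  have hz : z ∈ (extChartAt 𝓘(ℝ, E) x).target := mem_extChartAt_target (I := 𝓘(ℝ, E)) x
  have hc : ContMDiffAt 𝓘(ℝ, E) 𝓘(ℝ, E) ∞ c z := contMDiffAt_extChartAt_symm hz
  have hcz : c z = x := extChartAt_to_inv x
  have h1 : DifferentiableAt ℝ (fun y => u (c y)) z :=
    (contMDiffAt_iff_contDiffAt.1 (hu.contMDiffAt.comp z hc)).differentiableAt (by simp)
  have h2 : DifferentiableAt ℝ (α.pull c) z := (DForm.contDiffAt_pull hα hc).differentiableAt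
    (by simp)
  have h3 : (DForm.fsmul u α).pull c = fun y => u (c y) • α.pull c y :=
    funext fun y => DForm.pull_fsmul u α c y
  have hd := DForm.d_apply_chart hα x v w
  change _ = ((DForm.differential E u).wedge α x ![(_ : E), (_ : E)]) +
    u x * ((α.d x : E [⋀^Fin 2]→L[ℝ] ℝ) ![_, _])
  have hw := DForm.wedge_apply_two (DForm.differential E u) α x
    (mfderiv 𝓘(ℝ, E) 𝓘(ℝ, E) c z v) (mfderiv 𝓘(ℝ, E) 𝓘(ℝ, E) c z w)
  rw [h3, fderiv_fun_smul h1 h2, hd, hw]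
  have hchain := mfderiv_comp_of_eq (f := c) (g := u) (x := z) (y := x)
    (hu.mdifferentiableAt (by simp)) (hc.mdifferentiableAt (by simp)) hcz
  have e1 : ∀ t : E, fderiv ℝ (fun y => u (c y)) z t =
      (DForm.differential E u).covector x (mfderiv 𝓘(ℝ, E) 𝓘(ℝ, E) c z t) := by
    intro t
    rw [← mfderiv_eq_fderiv]
    refine (DFunLike.congr_fun hchain t).trans ?_
    have e : ∀ (p q : M) (h : p = q) (a : E), (mfderiv 𝓘(ℝ, E) 𝓘(ℝ, ℝ) u p : E →L[ℝ] ℝ) a =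
      (mfderiv 𝓘(ℝ, E) 𝓘(ℝ, ℝ) u q : E →L[ℝ] ℝ) a := by
      rintro p q rfl a; rfl
    exact e _ _ hcz _
  have e2 : ∀ t : E, α.pull c z t = α.covector x (mfderiv 𝓘(ℝ, E) 𝓘(ℝ, E) c z t) := by
    intro t
    have e : ∀ (p q : M) (h : p = q) (a : E), (α.covector p : E →L[ℝ] ℝ) a =
      (α.covector q : E →L[ℝ] ℝ) a := by
      rintro p q rfl a; rfl
    exact e _ _ hcz _
  simp only [add_apply, smul_apply, ContinuousLinearMap.smulRight_apply, e1, e2, hcz, smul_eq_mul]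
  ring

variable [IsManifold 𝓘(ℝ, E') ∞ N]

theorem DForm.isSmooth_pullback {g : N → M} (hg : ContMDiff 𝓘(ℝ, E') 𝓘(ℝ, E) ∞ g) {α : DForm E M 1}
    (hα : α.IsSmooth) : (DForm.pullback g α : DForm E' N 1).IsSmooth := by
  rw [DForm.isSmooth_iff_pull]
  intro x y hy
  have hc := contMDiffAt_extChartAt_symm hy
  have h1 : ContDiffAt ℝ ∞ (α.pull fun y => g ((extChartAt 𝓘(ℝ, E') x).symm y)) y :=
    DForm.contDiffAt_pull hα (hg.contMDiffAt.comp y hc)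
  refine (h1.congr_of_eventuallyEq ?_).contDiffWithinAt
  filter_upwards [(isOpen_extChartAt_target x).mem_nhds hy] with y' hy'
  exact DForm.pull_pullback g α (hg.mdifferentiableAt (by simp))
    ((contMDiffAt_extChartAt_symm hy').mdifferentiableAt (by simp))

/-- `DForm.d_apply_pull` allows any smooth parametrisation, immersive or not. Taking g composed with
an inverse chart of N computes both sides from one covector field. -/
theorem DForm.d_pullback {g : N → M} (hg : ContMDiff 𝓘(ℝ, E') 𝓘(ℝ, E) ∞ g) {α : DForm E M 1}
    (hα : α.IsSmooth) :
    (DForm.pullback g α : DForm E' N 1).d = DForm.pullback g α.d := by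
  funext x
  refine DForm.eq_two_of_chart fun v w => ?_
  rw [DForm.d_apply_chart (DForm.isSmooth_pullback hg hα)]
  set c := (extChartAt 𝓘(ℝ, E') x).symm
  set z := extChartAt 𝓘(ℝ, E') x x
  have hz : z ∈ (extChartAt 𝓘(ℝ, E') x).target := mem_extChartAt_target (I := 𝓘(ℝ, E')) x
  have hc : ContMDiffAt 𝓘(ℝ, E') 𝓘(ℝ, E') ∞ c z := contMDiffAt_extChartAt_symm hz
  have hcz : c z = x := extChartAt_to_inv x
  have h3 : (DForm.pullback g α : DForm E' N 1).pull c =ᶠ[𝓝 z] α.pull (fun y => g (c y)) := by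
    filter_upwards [(isOpen_extChartAt_target x).mem_nhds hz] with y' hy'
    exact DForm.pull_pullback g α (hg.mdifferentiableAt (by simp))
      ((contMDiffAt_extChartAt_symm hy').mdifferentiableAt (by simp))
  have hd := DForm.d_apply_pull hα (κ := fun y => g (c y)) (z := z) (hg.contMDiffAt.comp z hc) v w
  rw [h3.fderiv_eq, ← hd]
  have hchain := mfderiv_comp (f := c) (g := g) z
    (hg.mdifferentiableAt (by simp)) (hc.mdifferentiableAt (by simp))
  have e1 : ∀ t : E', (mfderiv 𝓘(ℝ, E') 𝓘(ℝ, E) (fun y => g (c y)) z t : E) =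
      mfderiv 𝓘(ℝ, E') 𝓘(ℝ, E) g (c z) (mfderiv 𝓘(ℝ, E') 𝓘(ℝ, E') c z t) :=
    fun t => DFunLike.congr_fun hchain t
  refine Eq.trans ?_ (DForm.pullback_apply_two g α.d x (mfderiv 𝓘(ℝ, E') 𝓘(ℝ, E') c z v)
    (mfderiv 𝓘(ℝ, E') 𝓘(ℝ, E') c z w)).symm
  have e : ∀ (p q : N) (h : p = q) (a b : E'),
      (α.d (g p) : E [⋀^Fin 2]→L[ℝ] ℝ) ![mfderiv 𝓘(ℝ, E') 𝓘(ℝ, E) g p a,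
        mfderiv 𝓘(ℝ, E') 𝓘(ℝ, E) g p b] =
      (α.d (g q) : E [⋀^Fin 2]→L[ℝ] ℝ) ![mfderiv 𝓘(ℝ, E') 𝓘(ℝ, E) g q a,
        mfderiv 𝓘(ℝ, E') 𝓘(ℝ, E) g q b] := by
    rintro p q rfl a b; rfl
  refine Eq.trans ?_ (e _ _ hcz _ _)
  rw [e1, e1]

end FormCalculus
end

noncomputable section

/-! ### Smooth dependence of integrals on parameters -/

section ParametricIntegral

open MeasureTheory

/-- A parametric integral over the unit interval of a smooth function is smooth. -/
theorem contDiffOn_integral_unit {G : Type*} [NormedAddCommGroup G] [NormedSpace ℝ G]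
    {g : G × ℝ → ℝ} {U : Set G} (hU : IsOpen U) (hg : ContDiffOn ℝ ∞ g (U ×ˢ univ)) :
    ContDiffOn ℝ ∞ (fun x => ∫ s in (0 : ℝ)..1, g (x, s)) U := by
  -- The integral is the value at 0 of the convolution of the indicator of (0,1] with r ↦ χ(r)
  -- g(x,-r). The cutoff is 1 on [-2,2], hence invisible to the integral, and supplies the compact
  -- support needed to differentiate the convolution.
  let χ : ContDiffBump (0 : ℝ) := ⟨2, 3, by norm_num, by norm_num⟩
  let G' : G → ℝ → ℝ := fun x r => χ r * g (x, -r)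
  let f : ℝ → ℝ := indicator (Ioc 0 1) 1
  have hf : LocallyIntegrable f volume := by
    have : IntegrableOn (1 : ℝ → ℝ) (Ioc 0 1) volume := by
      simp [integrableOn_const_iff, Pi.one_def]
    exact (this.integrable_indicator measurableSet_Ioc).locallyIntegrable
  have hG : ContDiffOn ℝ ∞ (Function.uncurry G') (U ×ˢ univ) := by
    refine (χ.contDiff.comp_contDiffOn contDiffOn_snd).mul ?_
    refine hg.comp (t := U ×ˢ univ)
      (contDiffOn_fst.prodMk contDiffOn_snd.neg) ?_
    rintro ⟨x, r⟩ ⟨hx, -⟩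
    exact ⟨hx, mem_univ _⟩
  have key := contDiffOn_convolution_right_with_param (n := ⊤) (μ := volume)
    (ContinuousLinearMap.lsmul ℝ ℝ) hU (isCompact_closedBall (0 : ℝ) 3) (g := G') (f := f)
    (fun p x _ hx => by
      have : χ x = 0 := by
        refine χ.zero_of_le_dist ?_
        simp only [Metric.mem_closedBall, not_le] at hx
        exact hx.le
      simp [G', this]) hf hG
  have h2 : ContDiffOn ℝ ∞ (fun x : G => (x, (0 : ℝ))) U := contDiffOn_id.prodMk contDiffOn_const
  refine (key.comp h2 fun x hx => ⟨hx, mem_univ _⟩).congr fun x _ => ?_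
  simp only [Function.comp_apply, convolution_def, f]
  rw [intervalIntegral.integral_of_le zero_le_one, ← integral_indicator measurableSet_Ioc]
  refine integral_congr_ae (Filter.Eventually.of_forall fun s => ?_)
  by_cases hs : s ∈ Ioc (0 : ℝ) 1
  · have : χ (0 - s) = 1 := by
      refine χ.one_of_mem_closedBall ?_
      simp only [Metric.mem_closedBall, dist_zero_right, zero_sub, norm_neg, Real.norm_eq_abs]
      rw [abs_of_pos hs.1]
      exact hs.2.trans (by norm_num)
    simp only [indicator_of_mem hs, G', this]
    simp
  · simp [indicator_of_notMem hs]

end ParametricIntegral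

/-! ### Smooth branches of the logarithm on the circle -/

section CircleLog

/-- The branch of the logarithm on the circle with values in `(t₀ - π, t₀ + π]`. -/
def circleLog (t₀ : ℝ) (z : Circle) : ℝ := t₀ + Complex.arg ((z * Circle.exp (-t₀) : Circle) : ℂ)

theorem exp_circleLog (t₀ : ℝ) (z : Circle) : Circle.exp (circleLog t₀ z) = z := by
  rw [circleLog, Circle.exp_add, Circle.exp_arg, mul_comm, mul_assoc, ← Circle.exp_add]
  simp

theorem circleLog_exp {t₀ t : ℝ} (h : t ∈ Ioo (t₀ - Real.pi) (t₀ + Real.pi)) :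
    circleLog t₀ (Circle.exp t) = t := by
  rw [circleLog, ← Circle.exp_add, Circle.arg_exp (by linarith [h.1]) (by linarith [h.2])]
  ring

/-- The circle without the point opposite to `Circle.exp t₀`, where the branch jumps. -/
def circleLogDomain (t₀ : ℝ) : Set Circle :=
  {z | ((z * Circle.exp (-t₀) : Circle) : ℂ) ∈ Complex.slitPlane}

theorem isOpen_circleLogDomain (t₀ : ℝ) : IsOpen (circleLogDomain t₀) :=
  Complex.isOpen_slitPlane.preimage (by fun_prop)

theorem exp_mem_circleLogDomain {t₀ t : ℝ} (h : t ∈ Ioo (t₀ - Real.pi) (t₀ + Real.pi)) :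
    Circle.exp t ∈ circleLogDomain t₀ := by
  rw [circleLogDomain, mem_ofPred_eq, ← Circle.exp_add, Complex.mem_slitPlane_iff_arg,
    Circle.arg_exp (by linarith [h.1]) (by linarith [h.2])]
  exact ⟨by linarith [h.2], Circle.coe_ne_zero _⟩

theorem circleLog_mem {t₀ : ℝ} {z : Circle} (h : z ∈ circleLogDomain t₀) :
    circleLog t₀ z ∈ Ioo (t₀ - Real.pi) (t₀ + Real.pi) := by
  rw [circleLogDomain, mem_ofPred_eq, Complex.mem_slitPlane_iff_arg] at h
  have h1 := Complex.neg_pi_lt_arg ((z * Circle.exp (-t₀) : Circle) : ℂ)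
  have h2 := lt_of_le_of_ne (Complex.arg_le_pi ((z * Circle.exp (-t₀) : Circle) : ℂ)) h.1
  exact ⟨by rw [circleLog]; linarith, by rw [circleLog]; linarith⟩

theorem contMDiffOn_circleLog (t₀ : ℝ) :
    ContMDiffOn (𝓡 1) 𝓘(ℝ, ℝ) ∞ (circleLog t₀) (circleLogDomain t₀) := by
  have : Fact (Module.finrank ℝ ℂ = 1 + 1) := finrank_real_complex_fact'
  have h1 : ContMDiff (𝓡 1) 𝓘(ℝ, ℂ) ∞ (fun z : Circle => ((z : ℂ))) := contMDiff_coe_sphere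
  intro z hz
  -- The argument is the imaginary part of the complex logarithm, which is smooth on the slit plane;
  -- the branch is its restriction to the circle.
  have h2 : ContDiffAt ℝ ∞ (fun w : ℂ => t₀ + (Complex.log (w * Circle.exp (-t₀))).im) (z : ℂ) := by
    have h3 : ContDiffAt ℂ ∞ (fun w : ℂ => w * Circle.exp (-t₀)) (z : ℂ) :=
      contDiffAt_id.mul contDiffAt_const
    have h5 : ContDiffAt ℝ ∞ (fun w : ℂ => Complex.log (w * Circle.exp (-t₀))) (z : ℂ) :=
      ((Complex.contDiffAt_log (by simpa [circleLogDomain] using hz)).comp (z : ℂ) h3).restrict_scalars ℝ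
    exact contDiffAt_const.add ((Complex.imCLM.contDiff (n := ∞)).contDiffAt.comp (z : ℂ) h5)
  have h4 := (contMDiffAt_iff_contDiffAt.2 h2).comp z h1.contMDiffAt
  refine (h4.congr_of_eventuallyEq ?_).contMDiffWithinAt
  refine Filter.Eventually.of_forall fun w => ?_
  simp only [circleLog, Complex.log_im, Circle.coe_mul]
  rfl

end CircleLog

/-! ### Criteria for local diffeomorphisms -/

section LocalDiffeo

variable {E : Type*} [NormedAddCommGroup E] [NormedSpace ℝ E]
variable {M : Type*} [TopologicalSpace M] [ChartedSpace E M]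
variable {E' : Type*} [NormedAddCommGroup E'] [NormedSpace ℝ E']
variable {N : Type*} [TopologicalSpace N] [ChartedSpace E' N]

theorem isLocalDiffeomorphAt_of_inverse {f : M → N} {g : N → M} {U : Set M} {V : Set N}
    (hU : IsOpen U) (hV : IsOpen V) (hf : ContMDiffOn 𝓘(ℝ, E) 𝓘(ℝ, E') ∞ f U)
    (hg : ContMDiffOn 𝓘(ℝ, E') 𝓘(ℝ, E) ∞ g V) (hfUV : MapsTo f U V) (hgVU : MapsTo g V U)
    (hl : LeftInvOn g f U) (hr : RightInvOn g f V) {x : M} (hx : x ∈ U) :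
    IsLocalDiffeomorphAt 𝓘(ℝ, E) 𝓘(ℝ, E') ∞ f x :=
  ⟨{ toFun := f, invFun := g, source := U, target := V, map_source' := hfUV, map_target' := hgVU,
     left_inv' := hl, right_inv' := hr, open_source := hU, open_target := hV,
     contMDiffOn_toFun := hf, contMDiffOn_invFun := hg }, hx, fun _ _ => rfl⟩

/-- A right inverse, continuous at `f x`, of a local diffeomorphism is a local diffeomorphism. -/
theorem IsLocalDiffeomorphAt.inverse {f : M → N} {g : N → M} {x : M}
    (hf : IsLocalDiffeomorphAt 𝓘(ℝ, E) 𝓘(ℝ, E') ∞ f x)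
    (hg : g =ᶠ[𝓝 (f x)] hf.localInverse) :
    IsLocalDiffeomorphAt 𝓘(ℝ, E') 𝓘(ℝ, E) ∞ g (f x) := by
  obtain ⟨O, hO, hOo, hxO⟩ := eventually_nhds_iff.1 hg
  have hsym : ∀ y ∈ O ∩ hf.localInverse.source, hf.localInverse y ∈ hf.localInverse.target :=
    fun y hy => hf.localInverse.map_source hy.2
  let Φ := hf.localInverse
  have hcont : ContinuousOn Φ.invFun Φ.target := Φ.contMDiffOn_invFun.continuousOn
  refine isLocalDiffeomorphAt_of_inverse (f := g) (g := Φ.invFun) (U := O ∩ Φ.source)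
    (V := Φ.target ∩ Φ.invFun ⁻¹' (O ∩ Φ.source)) (hOo.inter Φ.open_source)
    (hcont.isOpen_inter_preimage Φ.open_target (hOo.inter Φ.open_source))
    ((Φ.contMDiffOn_toFun.mono inter_subset_right).congr fun y hy => hO y hy.1)
    (Φ.contMDiffOn_invFun.mono inter_subset_left) ?_ ?_ ?_ ?_ ⟨hxO, hf.localInverse_mem_source⟩
  · intro y hy
    rw [hO y hy.1]
    refine ⟨Φ.map_source' hy.2, ?_⟩
    rw [mem_preimage]
    have : Φ.invFun (Φ.toFun y) = y := Φ.left_inv' hy.2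
    change Φ.invFun (Φ.toFun y) ∈ _
    rw [this]; exact hy
  · intro y hy; exact hy.2
  · intro y hy
    rw [hO y hy.1]
    exact Φ.left_inv' hy.2
  · intro y hy
    rw [hO _ hy.2.1]
    exact Φ.right_inv' hy.1

/-- A fibrewise change of the last variable with nowhere vanishing fibre derivative is a local
diffeomorphism. -/
theorem isLocalDiffeomorphAt_fibrewise [FiniteDimensional ℝ E] {W : Set E} (hW : IsOpen W)
    {r : E × ℝ → ℝ} (hr : ∀ y ∈ W, ∀ t, ContDiffAt ℝ ∞ r (y, t))
    (hd : ∀ y ∈ W, ∀ t, fderiv ℝ r (y, t) (0, 1) ≠ 0) {y : E} (hy : y ∈ W) (t : ℝ) :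
    IsLocalDiffeomorphAt 𝓘(ℝ, E × ℝ) 𝓘(ℝ, E × ℝ) ∞ (fun q : E × ℝ => (q.1, r q)) (y, t) := by
  have : CompleteSpace E := FiniteDimensional.complete ℝ E
  set R : E × ℝ → E × ℝ := fun q => (q.1, r q) with hR
  have hRs : ∀ q : E × ℝ, q.1 ∈ W → ContDiffAt ℝ ∞ R q := fun q hq =>
    contDiffAt_fst.prodMk (hr q.1 hq q.2)
  have hRd : ∀ q : E × ℝ, q.1 ∈ W → ∃ L : (E × ℝ) ≃L[ℝ] (E × ℝ), HasFDerivAt R (L : _ →L[ℝ] _) q := by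
    intro q hq
    have h1 : HasFDerivAt r (fderiv ℝ r q) q :=
      ((hr q.1 hq q.2).differentiableAt (by simp)).hasFDerivAt
    -- The derivative is block triangular with diagonal blocks the identity and ∂_t r, so it is
    -- invertible as soon as ∂_t r ≠ 0.
    let b : ℝˣ := Units.mk0 (fderiv ℝ r q (0, 1)) (hd q.1 hq q.2)
    refine ⟨(ContinuousLinearEquiv.refl ℝ E).skewProd
      (ContinuousLinearEquiv.unitsEquivAut ℝ b)
      ((fderiv ℝ r q).comp (ContinuousLinearMap.inl ℝ E ℝ)), ?_⟩
    refine (hasFDerivAt_fst.prodMk h1).congr_fderiv ?_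
    ext v
    · simp
    · simp
    · simp
    · simp only [b]
      simp
      exact (fderiv ℝ r q).map_zero
  obtain ⟨L, hL⟩ := hRd (y, t) hy
  let h := ContDiffAt.toOpenPartialHomeomorph R (hRs (y, t) hy) hL (by simp)
  have hcoe : (h : E × ℝ → E × ℝ) = R := ContDiffAt.toOpenPartialHomeomorph_coe _ _ _
  have hmem : (y, t) ∈ h.source := ContDiffAt.mem_toOpenPartialHomeomorph_source _ _ _
  have hO : IsOpen (h.source ∩ Prod.fst ⁻¹' W) := h.open_source.inter (hW.preimage continuous_fst)
  have hV : IsOpen (h.target ∩ h.symm ⁻¹' (Prod.fst ⁻¹' W)) :=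
    h.symm.isOpen_inter_preimage (hW.preimage continuous_fst)
  refine isLocalDiffeomorphAt_of_inverse (g := h.symm) hO hV ?_ ?_ ?_ ?_ ?_ ?_ ⟨hmem, hy⟩
  · exact contMDiffOn_iff_contDiffOn.2 fun q hq => (hRs q hq.2).contDiffWithinAt
  · refine contMDiffOn_iff_contDiffOn.2 fun q hq => ?_
    -- The inverse must be smooth on a whole open set, so invertibility of the derivative is used at
    -- every preimage, not just at the given point.
    obtain ⟨L', hL'⟩ := hRd (h.symm q) hq.2
    refine (h.contDiffAt_symm hq.1 (f₀' := L') ?_ ?_).contDiffWithinAt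
    · rw [hcoe]; exact hL'
    · rw [hcoe]; exact hRs _ hq.2
  · intro q hq
    rw [← hcoe]
    refine ⟨h.map_source hq.1, ?_⟩
    rw [mem_preimage, h.left_inv hq.1]; exact hq.2
  · intro q hq
    exact ⟨h.map_target hq.1, hq.2⟩
  · intro q hq
    rw [← hcoe]; exact h.left_inv hq.1
  · intro q hq
    rw [← hcoe]; exact h.right_inv hq.1

end LocalDiffeo
end

noncomputable section

/-! ### Fibre charts: parametrising circle fibres by the line -/

section FibreCharts

/-- A parametrisation `κ : W × ℝ → P` of the part of a circle fibration `π : P → M` over a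
neighbourhood of `x₀` (identified with an open set `W` of the model space by the chart at `x₀`):
a local diffeomorphism that is, in each fibre, a covering by `ℝ` with group of periods
`T(y) ℤ`. -/
structure FibreChart (E E' : Type*) [NormedAddCommGroup E] [NormedSpace ℝ E]
    [NormedAddCommGroup E'] [NormedSpace ℝ E']
    {M : Type*} [TopologicalSpace M] [ChartedSpace E M]
    {P : Type*} [TopologicalSpace P] [ChartedSpace E' P]
    (π : P → M) (x₀ : M) (T : E → ℝ) where
  W : Set E
  κ : E × ℝ → P
  isOpen_W : IsOpen W
  subset_target : W ⊆ (extChartAt 𝓘(ℝ, E) x₀).target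
  mem_W : extChartAt 𝓘(ℝ, E) x₀ x₀ ∈ W
  diffeo : ∀ y ∈ W, ∀ t, IsLocalDiffeomorphAt 𝓘(ℝ, E × ℝ) 𝓘(ℝ, E') ∞ κ (y, t)
  proj : ∀ y ∈ W, ∀ t, π (κ (y, t)) = (extChartAt 𝓘(ℝ, E) x₀).symm y
  surj : ∀ p, π p ∈ (extChartAt 𝓘(ℝ, E) x₀).source → extChartAt 𝓘(ℝ, E) x₀ (π p) ∈ W →
    ∃ t, κ (extChartAt 𝓘(ℝ, E) x₀ (π p), t) = p
  period : ∀ y ∈ W, ∀ t t', κ (y, t) = κ (y, t') ↔ ∃ n : ℤ, t' = t + n * T y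

variable {E : Type*} [NormedAddCommGroup E] [NormedSpace ℝ E]
variable {M : Type*} [TopologicalSpace M] [ChartedSpace E M]
variable {E' : Type*} [NormedAddCommGroup E'] [NormedSpace ℝ E']
variable {P : Type*} [TopologicalSpace P] [ChartedSpace E' P]
variable {π : P → M}

/-- The angle of the circle factor is the fibre parameter, t ↦ e^{it} being a covering with periods
2πℤ. A local inverse near (y,t) is a logarithm branch with values in (t - π, t + π). -/
theorem exists_fibreChart_of_trivialization [IsManifold 𝓘(ℝ, E) ∞ M]
    (hπ : ContMDiff 𝓘(ℝ, E') 𝓘(ℝ, E) ∞ π) {e : Bundle.Trivialization Circle π}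
    (he : IsSmoothTrivialization E E' e) {x₀ : M} (hx₀ : x₀ ∈ e.baseSet) :
    Nonempty (FibreChart E E' π x₀ fun _ => 2 * Real.pi) := by
  set c := extChartAt 𝓘(ℝ, E) x₀ with hc
  set W : Set E := c.target ∩ c.symm ⁻¹' e.baseSet with hW
  have hWo : IsOpen W := (continuousOn_extChartAt_symm x₀).isOpen_inter_preimage
    (isOpen_extChartAt_target x₀) e.open_baseSet
  set κ : E × ℝ → P := fun q => e.toOpenPartialHomeomorph.symm (c.symm q.1, Circle.exp q.2) with hκ
  have htgt : ∀ y ∈ W, ∀ z : Circle, (c.symm y, z) ∈ e.target := fun y hy z =>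
    e.mem_target.2 hy.2
  have hproj : ∀ y ∈ W, ∀ t, π (κ (y, t)) = c.symm y := fun y hy t =>
    e.proj_symm_apply (htgt y hy _)
  have heκ : ∀ y ∈ W, ∀ t, e (κ (y, t)) = (c.symm y, Circle.exp t) := fun y hy t =>
    e.apply_symm_apply (htgt y hy _)
  have hκe : ∀ p, π p ∈ c.source → c (π p) ∈ W → ∀ t, Circle.exp t = (e p).2 →
      κ (c (π p), t) = p := by
    intro p hp hpW t ht
    have hps : p ∈ e.source := by
      rw [e.mem_source]
      have := hpW.2
      rwa [mem_preimage, c.left_inv hp] at this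
    simp only [hκ, c.left_inv hp, ht]
    rw [← e.coe_fst hps]
    exact e.toOpenPartialHomeomorph.left_inv hps
  refine ⟨⟨W, κ, hWo, inter_subset_left, ⟨mem_extChartAt_target x₀, ?_⟩, ?_, hproj, ?_, ?_⟩⟩
  · rw [mem_preimage, extChartAt_to_inv]; exact hx₀
  · intro y hy t
    set U : Set (E × ℝ) := W ×ˢ Ioo (t - Real.pi) (t + Real.pi) with hU
    set V : Set P := π ⁻¹' (c.source ∩ c ⁻¹' W) ∩
      (e.source ∩ e ⁻¹' (Prod.snd ⁻¹' circleLogDomain t)) with hV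
    have hUo : IsOpen U := hWo.prod isOpen_Ioo
    have hVo : IsOpen V := by
      refine IsOpen.inter (IsOpen.preimage hπ.continuous ?_) ?_
      · exact (continuousOn_extChartAt x₀).isOpen_inter_preimage (isOpen_extChartAt_source x₀) hWo
      · exact e.toOpenPartialHomeomorph.isOpen_inter_preimage
          ((isOpen_circleLogDomain t).preimage continuous_snd)
    refine isLocalDiffeomorphAt_of_inverse (f := κ) (U := U) (V := V)
      (g := fun p => (c (π p), circleLog t (e p).2)) hUo hVo ?_ ?_ ?_ ?_ ?_ ?_
      ⟨hy, by constructor <;> linarith [Real.pi_pos]⟩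
    · have h1 : ContMDiffOn 𝓘(ℝ, E × ℝ) 𝓘(ℝ, E) ∞ (fun q : E × ℝ => c.symm q.1) U :=
        (contMDiffOn_extChartAt_symm x₀).comp
          (contMDiffOn_iff_contDiffOn.2 contDiffOn_fst) fun q hq => hq.1.1
      have h2 : ContMDiffOn 𝓘(ℝ, E × ℝ) (𝓡 1) ∞ (fun q : E × ℝ => Circle.exp q.2) U :=
        contMDiff_circleExp.comp_contMDiffOn (contMDiffOn_iff_contDiffOn.2 contDiffOn_snd)
      exact he.2.comp (h1.prodMk h2) fun q hq => htgt q.1 hq.1 _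
    · have h1 : ContMDiffOn 𝓘(ℝ, E') 𝓘(ℝ, E) ∞ (fun p => c (π p)) V :=
        (contMDiffOn_extChartAt (x := x₀)).comp hπ.contMDiffOn
          fun p hp => by simpa [c] using hp.1.1
      have h2 : ContMDiffOn 𝓘(ℝ, E') 𝓘(ℝ, ℝ) ∞ (fun p => circleLog t (e p).2) V :=
        (contMDiffOn_circleLog t).comp
          (contMDiff_snd.comp_contMDiffOn (he.1.mono fun p hp => hp.2.1)) fun p hp => hp.2.2
      exact h1.prodMk_space h2
    · rintro ⟨y', t'⟩ ⟨hy', ht'⟩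
      refine ⟨?_, ?_, ?_⟩
      · rw [mem_preimage, hproj y' hy']
        refine ⟨c.map_target hy'.1, ?_⟩
        rw [mem_preimage, c.right_inv hy'.1]; exact hy'
      · exact e.map_target (htgt y' hy' _)
      · rw [mem_preimage, heκ y' hy']
        exact exp_mem_circleLogDomain ht'
    · intro p hp
      exact ⟨hp.1.2, circleLog_mem hp.2.2⟩
    · rintro ⟨y', t'⟩ ⟨hy', ht'⟩
      simp only [hproj y' hy', heκ y' hy', c.right_inv hy'.1, circleLog_exp ht']
    · intro p hp
      exact hκe p hp.1.1 hp.1.2 _ (exp_circleLog t _)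
  · intro p hp hpW
    exact ⟨_, hκe p hp hpW _ (Circle.exp_arg _)⟩
  · intro y hy t t'
    constructor
    · intro h
      have h' := congrArg e h
      rw [heκ y hy, heκ y hy] at h'
      obtain ⟨m, hm⟩ := Circle.exp_eq_exp.1 (Prod.ext_iff.1 h').2
      exact ⟨-m, by push_cast; linarith⟩
    · rintro ⟨n, rfl⟩
      have : Circle.exp (t + n * (2 * Real.pi)) = Circle.exp t := Circle.exp_eq_exp.2 ⟨n, rfl⟩
      simp only [hκ, this]

/-- Changing the fibre parameter of a fibre chart. -/
def FibreChart.reparam {x₀ : M} {T T' : E → ℝ} (fc : FibreChart E E' π x₀ T) (r : E × ℝ → ℝ)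
    (hr : ∀ y ∈ fc.W, ∀ t,
      IsLocalDiffeomorphAt 𝓘(ℝ, E × ℝ) 𝓘(ℝ, E × ℝ) ∞ (fun q : E × ℝ => (q.1, r q)) (y, t))
    (hsurj : ∀ y ∈ fc.W, Function.Surjective fun t => r (y, t))
    (hper : ∀ y ∈ fc.W, ∀ t t', (∃ n : ℤ, r (y, t') = r (y, t) + n * T y) ↔
      ∃ n : ℤ, t' = t + n * T' y) : FibreChart E E' π x₀ T' where
  W := fc.W
  κ := fun q => fc.κ (q.1, r q)
  isOpen_W := fc.isOpen_W
  subset_target := fc.subset_target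
  mem_W := fc.mem_W
  diffeo := fun y hy t => (hr y hy t).comp 𝓘(ℝ, E') P (g := fc.κ) (fc.diffeo y hy (r (y, t)))
  proj := fun y hy t => fc.proj y hy _
  surj := fun p hp hpW => by
    obtain ⟨s, hs⟩ := fc.surj p hp hpW
    obtain ⟨t, ht⟩ := hsurj _ hpW s
    exact ⟨t, by simp only [] at ht ⊢; rw [ht, hs]⟩
  period := fun y hy t t' => (fc.period y hy _ _).trans (hper y hy t t')

end FibreCharts
end

noncomputable section

/-! ### Chain rules for pull-backs -/

section PullChain

variable {E : Type*} [NormedAddCommGroup E] [NormedSpace ℝ E]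
variable {M : Type*} [TopologicalSpace M] [ChartedSpace E M]
variable {V : Type*} [NormedAddCommGroup V] [NormedSpace ℝ V]
variable {V' : Type*} [NormedAddCommGroup V'] [NormedSpace ℝ V']

theorem mfderiv_comp_fderiv {κ : V → M} {ρ : V' → V} {z : V'}
    (hκ : MDifferentiableAt 𝓘(ℝ, V) 𝓘(ℝ, E) κ (ρ z)) (hρ : DifferentiableAt ℝ ρ z) (v : V') :
    (mfderiv 𝓘(ℝ, V') 𝓘(ℝ, E) (fun y => κ (ρ y)) z v : E) =
      mfderiv 𝓘(ℝ, V) 𝓘(ℝ, E) κ (ρ z) (fderiv ℝ ρ z v) := by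
  have h := mfderiv_comp (f := ρ) (g := κ) z hκ hρ.mdifferentiableAt
  rw [mfderiv_eq_fderiv] at h
  exact DFunLike.congr_fun h v

theorem DForm.pull_comp (α : DForm E M 1) {κ : V → M} {ρ : V' → V} {z : V'}
    (hκ : MDifferentiableAt 𝓘(ℝ, V) 𝓘(ℝ, E) κ (ρ z)) (hρ : DifferentiableAt ℝ ρ z) :
    α.pull (fun y => κ (ρ y)) z = (α.pull κ (ρ z)).comp (fderiv ℝ ρ z) := by
  ext v
  exact congrArg (α.covector (κ (ρ z)) : E →L[ℝ] ℝ) (mfderiv_comp_fderiv hκ hρ v)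

theorem DForm.covector_congr (α : DForm E M 1) {p q : M} (h : p = q) (v : E) :
    (α.covector p : E →L[ℝ] ℝ) v = (α.covector q : E →L[ℝ] ℝ) v := by
  subst h; rfl

theorem DForm.apply_two_congr (α : DForm E M 2) {p q : M} (h : p = q) {v w v' w' : E}
    (hv : v = v') (hw : w = w') :
    (α p : E [⋀^Fin 2]→L[ℝ] ℝ) ![v, w] = (α q : E [⋀^Fin 2]→L[ℝ] ℝ) ![v', w'] := by
  subst h hv hw; rfl

end PullChain

/-! ### Differential geometry in a fibre chart -/

section FibreCharts

variable {E : Type*} [NormedAddCommGroup E] [NormedSpace ℝ E]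
variable {M : Type*} [TopologicalSpace M] [ChartedSpace E M] [IsManifold 𝓘(ℝ, E) ∞ M]
variable {E' : Type*} [NormedAddCommGroup E'] [NormedSpace ℝ E']
variable {P : Type*} [TopologicalSpace P] [ChartedSpace E' P] [IsManifold 𝓘(ℝ, E') ∞ P]
variable {π : P → M} {x₀ : M} {T : E → ℝ}

namespace FibreChart

variable (fc : FibreChart E E' π x₀ T)

theorem contMDiffAt {y : E} (hy : y ∈ fc.W) (t : ℝ) :
    ContMDiffAt 𝓘(ℝ, E × ℝ) 𝓘(ℝ, E') ∞ fc.κ (y, t) :=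
  (fc.diffeo y hy t).contMDiffAt

theorem mdifferentiableAt {y : E} (hy : y ∈ fc.W) (t : ℝ) :
    MDifferentiableAt 𝓘(ℝ, E × ℝ) 𝓘(ℝ, E') fc.κ (y, t) :=
  (fc.contMDiffAt hy t).mdifferentiableAt (by simp)

theorem eventually_mem_W {y : E} (hy : y ∈ fc.W) (t : ℝ) :
    ∀ᶠ q : E × ℝ in 𝓝 (y, t), q.1 ∈ fc.W :=
  (fc.isOpen_W.preimage continuous_fst).mem_nhds hy

/-- In these coordinates π is the projection to the first factor followed by the inverse chart; in
particular the direction (0,1) is vertical. -/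
theorem mfderiv_proj (hπ : ContMDiff 𝓘(ℝ, E') 𝓘(ℝ, E) ∞ π) {y : E} (hy : y ∈ fc.W) (t : ℝ)
    (a : E × ℝ) :
    (mfderiv 𝓘(ℝ, E') 𝓘(ℝ, E) π (fc.κ (y, t)) (mfderiv 𝓘(ℝ, E × ℝ) 𝓘(ℝ, E') fc.κ (y, t) a) : E) =
      mfderiv 𝓘(ℝ, E) 𝓘(ℝ, E) (extChartAt 𝓘(ℝ, E) x₀).symm y a.1 := by
  have h1 := mfderiv_comp (f := fc.κ) (g := π) (y, t) (hπ.mdifferentiableAt (by simp))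
    (fc.mdifferentiableAt hy t)
  have heq : (π ∘ fc.κ) =ᶠ[𝓝 (y, t)] fun q => (extChartAt 𝓘(ℝ, E) x₀).symm q.1 := by
    filter_upwards [fc.eventually_mem_W hy t] with q hq
    exact fc.proj q.1 hq q.2
  have h2 := mfderiv_comp_fderiv (M := M) (κ := (extChartAt 𝓘(ℝ, E) x₀).symm) (ρ := Prod.fst)
    (z := (y, t)) ((contMDiffAt_extChartAt_symm (fc.subset_target hy)).mdifferentiableAt (by simp))
    differentiableAt_fst a
  have h3 := DFunLike.congr_fun h1 a
  refine h3.symm.trans ?_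
  refine (congrArg (fun L : (E × ℝ) →L[ℝ] E => L a)
    (heq.mfderiv_eq (I := 𝓘(ℝ, E × ℝ)) (I' := 𝓘(ℝ, E)))).trans (h2.trans ?_)
  rw [fderiv_fst]; rfl

theorem contDiffAt_pull {θ : DForm E' P 1} (hθ : θ.IsSmooth) {y : E} (hy : y ∈ fc.W) (t : ℝ) :
    ContDiffAt ℝ ∞ (θ.pull fc.κ) (y, t) :=
  DForm.contDiffAt_pull hθ (fc.contMDiffAt hy t)

theorem injective_mfderiv {y : E} (hy : y ∈ fc.W) (t : ℝ) {a : E × ℝ}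
    (ha : (mfderiv 𝓘(ℝ, E × ℝ) 𝓘(ℝ, E') fc.κ (y, t) a : E') = 0) : a = 0 := by
  have h := ((fc.diffeo y hy t).mfderivToContinuousLinearEquiv (by simp)).injective
  have h2 := (fc.diffeo y hy t).mfderivToContinuousLinearEquiv_coe (by simp)
  refine h (Eq.trans ?_ (ContinuousLinearEquiv.map_zero _).symm)
  refine Eq.trans ?_ ha
  exact congrArg (fun L : (E × ℝ) →L[ℝ] E' => L a) h2

theorem surjective_mfderiv {y : E} (hy : y ∈ fc.W) (t : ℝ) (b : E') :
    ∃ a : E × ℝ, (mfderiv 𝓘(ℝ, E × ℝ) 𝓘(ℝ, E') fc.κ (y, t) a : E') = b := by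
  obtain ⟨a, ha⟩ := ((fc.diffeo y hy t).mfderivToContinuousLinearEquiv (by simp)).surjective b
  have h2 := (fc.diffeo y hy t).mfderivToContinuousLinearEquiv_coe (by simp)
  exact ⟨a, (congrArg (fun L : (E × ℝ) →L[ℝ] E' => L a) h2).symm.trans ha⟩

/-- The image of (0,1) is vertical, and nonzero because κ is a local diffeomorphism; if θ killed it,
it would lie in both complementary subspaces. -/
theorem pull_fibre_ne_zero (hπ : ContMDiff 𝓘(ℝ, E') 𝓘(ℝ, E) ∞ π) {θ : DForm E' P 1}
    (hθπ : IsTransverseToFibres (E := E) π θ) {y : E} (hy : y ∈ fc.W) (t : ℝ) :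
    θ.pull fc.κ (y, t) (0, 1) ≠ 0 := by
  intro h0
  have h1 := fc.mfderiv_proj hπ hy t (0, 1)
  replace h1 := h1.trans (ContinuousLinearMap.map_zero
    (mfderiv 𝓘(ℝ, E) 𝓘(ℝ, E) (extChartAt 𝓘(ℝ, E) x₀).symm y : E →L[ℝ] E))
  have h2 := (hθπ (fc.κ (y, t))).disjoint.le_bot
    ⟨(LinearMap.mem_ker.2 h0 : mfderiv 𝓘(ℝ, E × ℝ) 𝓘(ℝ, E') fc.κ (y, t) (0, 1) ∈ _),
      LinearMap.mem_ker.2 h1⟩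
  have h3 := fc.injective_mfderiv hy t ((Submodule.mem_bot ℝ).1 h2)
  have := congrArg Prod.snd h3
  simp at this

/-- The structure equation `dθ = π^*η ∧ θ + π^*F` in a fibre chart. -/
theorem structure_equation (hπ : ContMDiff 𝓘(ℝ, E') 𝓘(ℝ, E) ∞ π) {η : DForm E M 1}
    {F : DForm E M 2} {θ : DForm E' P 1} (hθ : θ.IsSmooth)
    (hdθ : θ.d = (DForm.pullback π η).wedge θ + DForm.pullback π F)
    {y : E} (hy : y ∈ fc.W) (t : ℝ) (a b : E × ℝ) :
    fderiv ℝ (θ.pull fc.κ) (y, t) a b - fderiv ℝ (θ.pull fc.κ) (y, t) b a =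
      η.pull (extChartAt 𝓘(ℝ, E) x₀).symm y a.1 * θ.pull fc.κ (y, t) b -
      η.pull (extChartAt 𝓘(ℝ, E) x₀).symm y b.1 * θ.pull fc.κ (y, t) a +
      (F ((extChartAt 𝓘(ℝ, E) x₀).symm y) : E [⋀^Fin 2]→L[ℝ] ℝ)
        ![mfderiv 𝓘(ℝ, E) 𝓘(ℝ, E) (extChartAt 𝓘(ℝ, E) x₀).symm y a.1,
          mfderiv 𝓘(ℝ, E) 𝓘(ℝ, E) (extChartAt 𝓘(ℝ, E) x₀).symm y b.1] := by
  rw [← DForm.d_apply_pull hθ (fc.contMDiffAt hy t) a b, hdθ]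
  have hη : ∀ a : E × ℝ, (DForm.pullback π η).covector (fc.κ (y, t))
      (mfderiv 𝓘(ℝ, E × ℝ) 𝓘(ℝ, E') fc.κ (y, t) a) =
      η.pull (extChartAt 𝓘(ℝ, E) x₀).symm y a.1 := by
    intro a
    rw [DForm.pullback_covector, DForm.pull_apply]
    exact (DForm.covector_congr η (fc.proj y hy t) _).trans
      (congrArg (η.covector _ : E →L[ℝ] ℝ) (fc.mfderiv_proj hπ hy t a))
  change ((DForm.pullback π η).wedge θ (fc.κ (y, t))) ![_, _] +
    (DForm.pullback π F (fc.κ (y, t))) ![_, _] = _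
  rw [DForm.wedge_apply_two, DForm.pullback_apply_two, hη, hη]
  congr 1
  exact DForm.apply_two_congr F (fc.proj y hy t) (fc.mfderiv_proj hπ hy t a)
    (fc.mfderiv_proj hπ hy t b)

/-- The chart parametrises the fibres by arc length with respect to `θ`. -/
def UnitSpeed (θ : DForm E' P 1) : Prop := ∀ y ∈ fc.W, ∀ t, θ.pull fc.κ (y, t) (0, 1) = 1

end FibreChart

end FibreCharts
end

noncomputable section

/-! ### Arc length parametrisation and the variation of the period -/

section FibreCharts

variable {E : Type*} [NormedAddCommGroup E] [NormedSpace ℝ E]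
variable {M : Type*} [TopologicalSpace M] [ChartedSpace E M] [IsManifold 𝓘(ℝ, E) ∞ M]
variable {E' : Type*} [NormedAddCommGroup E'] [NormedSpace ℝ E']
variable {P : Type*} [TopologicalSpace P] [ChartedSpace E' P] [IsManifold 𝓘(ℝ, E') ∞ P]
variable {π : P → M} {x₀ : M} {T : E → ℝ}

namespace FibreChart

/-- Invariance of a pulled back form under the translation by a period. -/
theorem pull_add_period (fc : FibreChart E E' π x₀ T) (θ : DForm E' P 1) {y : E} (hy : y ∈ fc.W)
    (hT : DifferentiableAt ℝ T y) (t : ℝ) (v : E) (s : ℝ) :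
    θ.pull fc.κ (y, t + T y) (v, s + fderiv ℝ T y v) = θ.pull fc.κ (y, t) (v, s) := by
  -- A deck transformation: κ ∘ ρ = κ. Since T varies with y, its derivative contributes the term
  -- dT(v) in the fibre direction.
  let ρ : E × ℝ → E × ℝ := fun q => (q.1, q.2 + T q.1)
  have hρ : HasFDerivAt ρ ((ContinuousLinearMap.fst ℝ E ℝ).prod (ContinuousLinearMap.snd ℝ E ℝ +
      (fderiv ℝ T y).comp (ContinuousLinearMap.fst ℝ E ℝ))) (y, t) := by
    refine HasFDerivAt.prodMk hasFDerivAt_fst (hasFDerivAt_snd.add ?_)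
    exact HasFDerivAt.comp (g := T) (f := Prod.fst) (y, t) hT.hasFDerivAt hasFDerivAt_fst
  have heq : (fun q => fc.κ (ρ q)) =ᶠ[𝓝 (y, t)] fc.κ := by
    filter_upwards [fc.eventually_mem_W hy t] with q hq
    exact ((fc.period q.1 hq q.2 _).2 ⟨1, by simp⟩).symm
  have h1 := θ.pull_congr heq
  rw [DForm.pull_comp θ (κ := fc.κ) (ρ := ρ) (fc.mdifferentiableAt hy _) hρ.differentiableAt,
    hρ.fderiv] at h1
  have := DFunLike.congr_fun h1 (v, s)
  simpa [ρ] using this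

/-- Every fibre chart can be reparametrised by arc length. -/
theorem exists_unitSpeed [FiniteDimensional ℝ E]
    (fc : FibreChart E E' π x₀ fun _ => 2 * Real.pi) (hπ : ContMDiff 𝓘(ℝ, E') 𝓘(ℝ, E) ∞ π)
    {θ : DForm E' P 1} (hθ : θ.IsSmooth) (hθπ : IsTransverseToFibres (E := E) π θ) :
    ∃ (L : E → ℝ) (fc' : FibreChart E E' π x₀ L), ContDiffOn ℝ ∞ L fc'.W ∧
      (∀ y ∈ fc'.W, L y ≠ 0) ∧ fc'.UnitSpeed θ := by
  set h : E × ℝ → ℝ := fun q => θ.pull fc.κ q (0, 1) with hh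
  -- The arc length ∫₀ᵗ h(y,s) ds, rescaled to a fixed interval so that its joint smoothness follows
  -- from `contDiffOn_integral_unit`.
  set ψ : E × ℝ → ℝ := fun q => q.2 * ∫ s in (0 : ℝ)..1, h (q.1, q.2 * s) with hψ
  have hhs : ContDiffOn ℝ ∞ h (fc.W ×ˢ univ) := fun q hq =>
    ((fc.contDiffAt_pull hθ hq.1 q.2).clm_apply contDiffAt_const).contDiffWithinAt
  have hWo : IsOpen (fc.W ×ˢ (univ : Set ℝ)) := fc.isOpen_W.prod isOpen_univ
  have hψs : ContDiffOn ℝ ∞ ψ (fc.W ×ˢ univ) := by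
    refine contDiffOn_snd.mul (contDiffOn_integral_unit (G := E × ℝ)
      (g := fun q => h (q.1.1, q.1.2 * q.2)) hWo ?_)
    refine hhs.comp (t := fc.W ×ˢ univ) ?_ ?_
    · exact ((contDiff_fst.comp contDiff_fst).prodMk
        ((contDiff_snd.comp contDiff_fst).mul contDiff_snd)).contDiffOn
    · rintro ⟨⟨y, t⟩, s⟩ ⟨⟨hy, -⟩, -⟩
      exact ⟨hy, mem_univ _⟩
  have hψat : ∀ y ∈ fc.W, ∀ t, ContDiffAt ℝ ∞ ψ (y, t) := fun y hy t =>
    hψs.contDiffAt (hWo.mem_nhds ⟨hy, mem_univ _⟩)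
  have hcont : ∀ y ∈ fc.W, Continuous fun s => h (y, s) := fun y hy =>
    hhs.continuousOn.comp_continuous (by fun_prop) fun s => ⟨hy, mem_univ _⟩
  have hψint : ∀ y t, ψ (y, t) = ∫ s in (0 : ℝ)..t, h (y, s) := by
    intro y t
    simp only [hψ]
    rw [intervalIntegral.mul_integral_comp_mul_left (f := fun s => h (y, s))]
    simp
  have hder : ∀ y ∈ fc.W, ∀ t, HasDerivAt (fun t => ψ (y, t)) (h (y, t)) t := by
    intro y hy t
    simp only [hψint]
    exact ((hcont y hy).integral_hasStrictDerivAt 0 t).hasDerivAt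
  have hne : ∀ y ∈ fc.W, ∀ t, h (y, t) ≠ 0 := fun y hy t => fc.pull_fibre_ne_zero hπ hθπ hy t
  have hfder : ∀ y ∈ fc.W, ∀ t, fderiv ℝ ψ (y, t) (0, 1) = h (y, t) := by
    intro y hy t
    have h1 : HasDerivAt (fun t : ℝ => (y, t)) ((0, 1) : E × ℝ) t :=
      (hasDerivAt_const t y).prodMk (hasDerivAt_id t)
    exact (((hψat y hy t).differentiableAt (by simp)).hasFDerivAt.comp_hasDerivAt t h1).unique
      (hder y hy t)
  -- Rolle's theorem: the derivative h never vanishes. The sign of h is left open throughout.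
  have hinj : ∀ y ∈ fc.W, Function.Injective fun t => ψ (y, t) := by
    intro y hy
    have key : ∀ a b, a < b → ψ (y, a) ≠ ψ (y, b) := by
      intro a b hab heq
      obtain ⟨c, -, hc⟩ := exists_hasDerivAt_eq_zero hab
        (fun t _ => (hder y hy t).continuousAt.continuousWithinAt) heq fun t _ => hder y hy t
      exact hne y hy c hc
    intro a b hab
    rcases lt_trichotomy a b with h | h | h
    · exact absurd hab (key a b h)
    · exact h
    · exact absurd hab.symm (key b a h)
  have hperiodic : ∀ y ∈ fc.W, Function.Periodic (fun s => h (y, s)) (2 * Real.pi) := by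
    intro y hy t
    have := fc.pull_add_period θ hy (differentiableAt_const _) t 0 1
    simpa using this
  -- The signed length of the fibre, the integral of θ over one turn; it is negative when the
  -- parametrisation runs against θ.
  set L : E → ℝ := fun y => ψ (y, 2 * Real.pi) with hL
  have hquasi : ∀ y ∈ fc.W, ∀ t, ∀ n : ℤ, ψ (y, t + n * (2 * Real.pi)) = ψ (y, t) + n * L y := by
    intro y hy t n
    have hi : ∀ a b, IntervalIntegrable (fun s => h (y, s)) MeasureTheory.volume a b :=
      fun a b => (hcont y hy).intervalIntegrable a b
    have h1 := (hperiodic y hy).intervalIntegral_add_zsmul_eq n t (fun a b => hi a b)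
    have h2 := (hperiodic y hy).intervalIntegral_add_eq t 0
    simp only [hL, hψint]
    rw [← intervalIntegral.integral_add_adjacent_intervals (hi 0 t) (hi t _)]
    simp only [zsmul_eq_mul, zero_add] at h1 h2
    rw [h1, h2]
  have hL0 : ∀ y ∈ fc.W, L y ≠ 0 := by
    intro y hy h0
    have h00 : ψ (y, 0) = 0 := by simp [hψ]
    have := hinj y hy (h0.trans h00.symm)
    linarith [Real.pi_pos]
  have hsurj : ∀ y ∈ fc.W, Function.Surjective fun t => ψ (y, t) := by
    intro y hy u
    have hc : Continuous fun t => ψ (y, t) :=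
      continuous_iff_continuousAt.2 fun t => (hder y hy t).continuousAt
    have hval : ∀ n : ℤ, ψ (y, n * (2 * Real.pi)) = n * L y := by
      intro n
      have := hquasi y hy 0 n
      simpa [hψ] using this
    -- Surjectivity by the intermediate value theorem: ψ takes the values n L at the multiples of
    -- 2π, and these are unbounded in both directions.
    obtain ⟨n, hn⟩ := exists_int_gt (u / L y)
    obtain ⟨m, hm⟩ := exists_int_lt (u / L y)
    rcases lt_or_gt_of_ne (hL0 y hy) with hneg | hpos
    · refine mem_range_of_exists_le_of_exists_ge hc ⟨n * (2 * Real.pi), ?_⟩ ⟨m * (2 * Real.pi), ?_⟩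
      · rw [hval]; exact (((div_lt_iff_of_neg hneg).1 hn)).le
      · rw [hval]; exact (((lt_div_iff_of_neg hneg).1 hm)).le
    · refine mem_range_of_exists_le_of_exists_ge hc ⟨m * (2 * Real.pi), ?_⟩ ⟨n * (2 * Real.pi), ?_⟩
      · rw [hval]; exact (((lt_div_iff₀ hpos).1 hm)).le
      · rw [hval]; exact (((div_lt_iff₀ hpos).1 hn)).le
  set σ : E × ℝ → ℝ := fun q => Function.invFun (fun t => ψ (q.1, t)) q.2 with hσ
  have hσψ : ∀ y ∈ fc.W, ∀ t, σ (y, ψ (y, t)) = t := fun y hy t =>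
    Function.leftInverse_invFun (hinj y hy) t
  have hψσ : ∀ y ∈ fc.W, ∀ u, ψ (y, σ (y, u)) = u := fun y hy u =>
    Function.rightInverse_invFun (hsurj y hy) u
  have hdiff : ∀ y ∈ fc.W, ∀ u, IsLocalDiffeomorphAt 𝓘(ℝ, E × ℝ) 𝓘(ℝ, E × ℝ) ∞
      (fun q : E × ℝ => (q.1, σ q)) (y, u) := by
    intro y hy u
    have hd := isLocalDiffeomorphAt_fibrewise fc.isOpen_W hψat
      (fun y hy t => by rw [hfder y hy t]; exact hne y hy t) hy (σ (y, u))
    have hu : ((y, σ (y, u)).1, ψ (y, σ (y, u))) = (y, u) := by simp [hψσ y hy]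
    -- The pointwise inverse σ is smooth because (y,u) ↦ (y, σ(y,u)) agrees with the local inverse
    -- of (y,t) ↦ (y, ψ(y,t)): both fix y, and ψ(y,·) is injective.
    have := hd.inverse (g := fun q : E × ℝ => (q.1, σ q)) ?_
    · simpa only [hu] using this
    · have h1 := hd.localInverse_eventuallyEq_right
      simp only [hu] at h1 ⊢
      filter_upwards [h1, fc.eventually_mem_W hy u] with q hq hqW
      have hq' : ((hd.localInverse q).1, ψ (hd.localInverse q)) = q := hq
      have hq1 : (hd.localInverse q).1 = q.1 := (Prod.ext_iff.1 hq').1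
      have hq2 : ψ (hd.localInverse q) = q.2 := (Prod.ext_iff.1 hq').2
      refine Prod.ext hq1.symm ?_
      have : hd.localInverse q = (q.1, (hd.localInverse q).2) := Prod.ext hq1 rfl
      rw [this] at hq2
      have h3 := hσψ q.1 hqW (hd.localInverse q).2
      rw [hq2] at h3
      exact h3
  refine ⟨L, fc.reparam σ hdiff (fun y hy t => ⟨ψ (y, t), hσψ y hy t⟩) ?_, ?_, hL0, ?_⟩
  · intro y hy u u'
    constructor
    · rintro ⟨n, hn⟩
      refine ⟨n, ?_⟩
      have h1 := congrArg (fun t => ψ (y, t)) hn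
      simp only [hquasi y hy, hψσ y hy] at h1
      exact h1
    · rintro ⟨n, hn⟩
      refine ⟨n, hinj y hy ?_⟩
      simp only [hquasi y hy, hψσ y hy]
      exact hn
  · intro y hy
    exact ((hψat y hy (2 * Real.pi)).comp y (f := fun y => (y, 2 * Real.pi))
      (contDiffAt_id.prodMk contDiffAt_const)).contDiffWithinAt
  · intro y hy u
    have hρ : DifferentiableAt ℝ (fun q : E × ℝ => (q.1, σ q)) (y, u) :=
      ((hdiff y hy u).mdifferentiableAt (by simp)).differentiableAt
    have hσd : DifferentiableAt ℝ σ (y, u) := hρ.snd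
    have h1 : HasDerivAt (fun t : ℝ => (y, t)) ((0, 1) : E × ℝ) u :=
      (hasDerivAt_const u y).prodMk (hasDerivAt_id u)
    have h2 : HasDerivAt (fun t => σ (y, t)) (fderiv ℝ σ (y, u) (0, 1)) u :=
      hσd.hasFDerivAt.comp_hasDerivAt u h1
    have h3 := (hder y hy (σ (y, u))).comp u h2
    have h4 : ((fun t => ψ (y, t)) ∘ fun t => σ (y, t)) = id := funext fun u => hψσ y hy u
    rw [h4] at h3
    -- The new speed is h at the old parameter times ∂_u σ, which is 1 by differentiating ψ(y,
    -- σ(y,u)) = u.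
    have h5 := h3.unique (hasDerivAt_id u)
    have h6 := DForm.pull_comp θ (κ := fc.κ) (ρ := fun q : E × ℝ => (q.1, σ q)) (z := (y, u))
      (fc.mdifferentiableAt hy _) hρ
    change θ.pull (fun q => fc.κ (q.1, σ q)) (y, u) (0, 1) = 1
    rw [h6, ContinuousLinearMap.comp_apply, (hasFDerivAt_fst.prodMk hσd.hasFDerivAt).fderiv]
    have h7 : ((0 : E), fderiv ℝ σ (y, u) (0, 1)) = fderiv ℝ σ (y, u) (0, 1) • ((0, 1) : E × ℝ) := by
      simp
    simp only [ContinuousLinearMap.prod_apply, ContinuousLinearMap.coe_fst']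
    rw [h7, map_smul, smul_eq_mul, mul_comm]
    exact h5

/-- The dependence on the fibre parameter of the horizontal part of a connection form. -/
theorem pull_apply_horizontal (fc : FibreChart E E' π x₀ T)
    (hπ : ContMDiff 𝓘(ℝ, E') 𝓘(ℝ, E) ∞ π) {η : DForm E M 1}
    {F : DForm E M 2} {θ : DForm E' P 1} (hθ : θ.IsSmooth)
    (hdθ : θ.d = (DForm.pullback π η).wedge θ + DForm.pullback π F) (hfc : fc.UnitSpeed θ)
    {y : E} (hy : y ∈ fc.W) (v : E) (t : ℝ) :
    θ.pull fc.κ (y, t) (v, 0) = θ.pull fc.κ (y, 0) (v, 0) -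
      t * η.pull (extChartAt 𝓘(ℝ, E) x₀).symm y v := by
  have hd : ∀ t, DifferentiableAt ℝ (θ.pull fc.κ) (y, t) := fun t =>
    (fc.contDiffAt_pull hθ hy t).differentiableAt (by simp)
  have h1 : ∀ t, HasDerivAt (fun t => θ.pull fc.κ (y, t) (v, 0))
      (-η.pull (extChartAt 𝓘(ℝ, E) x₀).symm y v) t := by
    intro t
    have hp : HasDerivAt (fun t : ℝ => (y, t)) ((0, 1) : E × ℝ) t :=
      (hasDerivAt_const t y).prodMk (hasDerivAt_id t)
    have h2 := ((hd t).hasFDerivAt.comp_hasDerivAt t hp).clm_apply (hasDerivAt_const t ((v, 0) : E × ℝ))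
    have h3 := fc.structure_equation hπ hθ hdθ hy t (v, 0) (0, 1)
    -- Unit speed makes θ(∂_t) the constant 1 nearby, so only -∂_t θ(v) survives on the left of the
    -- structure equation; on the right the F term vanishes as ∂_t is vertical.
    have h4 : fderiv ℝ (θ.pull fc.κ) (y, t) (v, 0) (0, 1) = 0 := by
      have h5 : (fun q => θ.pull fc.κ q (0, 1)) =ᶠ[𝓝 (y, t)] fun _ => 1 := by
        filter_upwards [fc.eventually_mem_W hy t] with q hq
        exact hfc q.1 hq q.2
      have h6 := fderiv_clm_apply (hd t) (differentiableAt_const ((0, 1) : E × ℝ))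
      have h7 := (h5.fderiv_eq).symm.trans h6
      have h8 := DFunLike.congr_fun h7 (v, 0)
      simpa using h8.symm
    have hF : (F ((extChartAt 𝓘(ℝ, E) x₀).symm y) : E [⋀^Fin 2]→L[ℝ] ℝ)
        ![mfderiv 𝓘(ℝ, E) 𝓘(ℝ, E) (extChartAt 𝓘(ℝ, E) x₀).symm y v,
          mfderiv 𝓘(ℝ, E) 𝓘(ℝ, E) (extChartAt 𝓘(ℝ, E) x₀).symm y (0 : E)] = 0 := by
      refine ContinuousAlternatingMap.map_coord_zero _ (1 : Fin 2) ?_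
      exact ContinuousLinearMap.map_zero
        (mfderiv 𝓘(ℝ, E) 𝓘(ℝ, E) (extChartAt 𝓘(ℝ, E) x₀).symm y : E →L[ℝ] E)
    simp only [hF, h4, hfc y hy t, map_zero] at h3
    refine HasDerivAt.congr_deriv h2 ?_
    rw [map_zero]
    linarith
  set k := η.pull (extChartAt 𝓘(ℝ, E) x₀).symm y v with hk
  have h3 : ∀ t, HasDerivAt (fun t => θ.pull fc.κ (y, t) (v, 0) + t * k) 0 t := by
    intro t
    exact ((h1 t).fun_add ((hasDerivAt_id t).mul_const k)).congr_deriv (by ring)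
  have := is_const_of_deriv_eq_zero (fun t => (h3 t).differentiableAt) (fun t => (h3 t).deriv) t 0
  simp only [zero_mul, add_zero] at this
  linarith

/-- The derivative of the period of a unit speed chart. -/
theorem fderiv_period (fc : FibreChart E E' π x₀ T) (hT : ContDiffOn ℝ ∞ T fc.W)
    (hπ : ContMDiff 𝓘(ℝ, E') 𝓘(ℝ, E) ∞ π) {η : DForm E M 1}
    {F : DForm E M 2} {θ : DForm E' P 1} (hθ : θ.IsSmooth)
    (hdθ : θ.d = (DForm.pullback π η).wedge θ + DForm.pullback π F) (hfc : fc.UnitSpeed θ)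
    {y : E} (hy : y ∈ fc.W) (v : E) :
    fderiv ℝ T y v = T y * η.pull (extChartAt 𝓘(ℝ, E) x₀).symm y v := by
  have hTd : DifferentiableAt ℝ T y :=
    (hT.contDiffAt (fc.isOpen_W.mem_nhds hy)).differentiableAt (by simp)
  -- Between t = 0 and t = T the horizontal coefficient drops by T η(v); the extra fibre component
  -- dT(v), at unit speed, must compensate this.
  have h3 := fc.pull_add_period θ hy hTd 0 v 0
  have h4 : ((v, 0 + fderiv ℝ T y v) : E × ℝ) = (v, 0) + fderiv ℝ T y v • ((0, 1) : E × ℝ) := by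
    simp
  rw [h4, map_add, map_smul, hfc y hy, fc.pull_apply_horizontal hπ hθ hdθ hfc hy,
    smul_eq_mul] at h3
  simp only [zero_add, mul_one] at h3
  linarith

end FibreChart

end FibreCharts
end

/-! ### Uniqueness of unit speed parametrisations -/

noncomputable section

theorem eventually_eq_of_hasDerivAt_zero {g : ℝ → ℝ} {t₀ : ℝ}
    (h : ∀ᶠ t in 𝓝 t₀, HasDerivAt g 0 t) : ∀ᶠ t in 𝓝 t₀, g t = g t₀ := by
  obtain ⟨ε, hε, hb⟩ := Metric.eventually_nhds_iff_ball.1 h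
  filter_upwards [Metric.ball_mem_nhds t₀ hε] with t ht
  exact (convex_ball t₀ ε).is_const_of_fderivWithin_eq_zero
    (fun t ht => (hb t ht).differentiableAt.differentiableWithinAt)
    (fun t ht => by
      rw [fderivWithin_of_isOpen Metric.isOpen_ball ht]
      have := (hb t ht).hasFDerivAt.fderiv
      rw [this]; ext; simp) ht (Metric.mem_ball_self hε)

section FibreCharts

variable {E : Type*} [NormedAddCommGroup E] [NormedSpace ℝ E]
variable {M : Type*} [TopologicalSpace M] [ChartedSpace E M] [IsManifold 𝓘(ℝ, E) ∞ M]
variable {E' : Type*} [NormedAddCommGroup E'] [NormedSpace ℝ E']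
variable {P : Type*} [TopologicalSpace P] [ChartedSpace E' P] [IsManifold 𝓘(ℝ, E') ∞ P]
variable {π : P → M} {x₀ : M} {T : E → ℝ}

namespace FibreChart

variable (fc : FibreChart E E' π x₀ T)

/-- A local inverse of a fibre chart. -/
theorem exists_localInverse {y : E} (hy : y ∈ fc.W) (t : ℝ) :
    ∃ j : P → E × ℝ, j (fc.κ (y, t)) = (y, t) ∧ ∀ᶠ p in 𝓝 (fc.κ (y, t)),
      ContMDiffAt 𝓘(ℝ, E') 𝓘(ℝ, E × ℝ) ∞ j p ∧ (j p).1 ∈ fc.W ∧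
      (j p).1 = extChartAt 𝓘(ℝ, E) x₀ (π p) ∧ fc.κ (j p) = p := by
  have hd := fc.diffeo y hy t
  have h0 : hd.localInverse (fc.κ (y, t)) = (y, t) :=
    hd.localInverse_left_inv hd.localInverse_mem_target
  refine ⟨hd.localInverse, h0, ?_⟩
  have hc : ContinuousAt hd.localInverse (fc.κ (y, t)) := hd.localInverse_contMDiffAt.continuousAt
  have h1 : ∀ᶠ p in 𝓝 (fc.κ (y, t)), (hd.localInverse p).1 ∈ fc.W := by
    have := fc.eventually_mem_W hy t
    rw [← h0] at this
    exact hc.eventually this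
  filter_upwards [h1, hd.localInverse.open_source.mem_nhds hd.localInverse_mem_source] with p hp hps
  have hκ : fc.κ (hd.localInverse p) = p := hd.localInverse_right_inv hps
  refine ⟨hd.localInverse_contMDiffOn.contMDiffAt (hd.localInverse.open_source.mem_nhds hps),
    hp, ?_, hκ⟩
  have h2 := fc.proj _ hp (hd.localInverse p).2
  have h3 : π p = (extChartAt 𝓘(ℝ, E) x₀).symm (hd.localInverse p).1 := by
    rw [← h2]; exact congrArg π hκ.symm
  rw [h3, (extChartAt 𝓘(ℝ, E) x₀).right_inv (fc.subset_target hp)]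

/-- A curve in `P` read in a fibre chart. -/
theorem exists_curve_coordinates {r : ℝ → P} {t₀ : ℝ}
    (hr : ∀ᶠ t in 𝓝 t₀, MDifferentiableAt 𝓘(ℝ, ℝ) 𝓘(ℝ, E') r t) {y : E} (hy : y ∈ fc.W) {s : ℝ}
    (hs : fc.κ (y, s) = r t₀) (θ : DForm E' P 1) :
    ∃ τ : ℝ → ℝ, τ t₀ = s ∧ ∀ᶠ t in 𝓝 t₀,
      extChartAt 𝓘(ℝ, E) x₀ (π (r t)) ∈ fc.W ∧
      fc.κ (extChartAt 𝓘(ℝ, E) x₀ (π (r t)), τ t) = r t ∧ DifferentiableAt ℝ τ t ∧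
      DifferentiableAt ℝ (fun t => extChartAt 𝓘(ℝ, E) x₀ (π (r t))) t ∧
      θ.pull r t 1 = θ.pull fc.κ (extChartAt 𝓘(ℝ, E) x₀ (π (r t)), τ t)
        (deriv (fun t => extChartAt 𝓘(ℝ, E) x₀ (π (r t))) t, deriv τ t) := by
  obtain ⟨j, hj0, hj⟩ := fc.exists_localInverse hy s
  rw [hs] at hj0 hj
  have hc : ContinuousAt r t₀ := hr.self_of_nhds.continuousAt
  have hev := hc.eventually hj
  refine ⟨fun t => (j (r t)).2, by simp [hj0], ?_⟩
  filter_upwards [hr, hev.eventually_nhds] with t hrt hev'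
  obtain ⟨hjs, hjW, hj1, hjκ⟩ := hev'.self_of_nhds
  have hjr : DifferentiableAt ℝ (fun t => j (r t)) t :=
    mdifferentiableAt_iff_differentiableAt.1
      ((hjs.mdifferentiableAt (by simp)).comp t hrt)
  have h1 : (fun t => (j (r t)).1) =ᶠ[𝓝 t] fun t => extChartAt 𝓘(ℝ, E) x₀ (π (r t)) := by
    filter_upwards [hev'] with t' ht' using ht'.2.2.1
  have hjeq : j (r t) = (extChartAt 𝓘(ℝ, E) x₀ (π (r t)), (j (r t)).2) := Prod.ext hj1 rfl
  have hd1 : DifferentiableAt ℝ (fun t => extChartAt 𝓘(ℝ, E) x₀ (π (r t))) t :=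
    h1.differentiableAt_iff.1 hjr.fst
  refine ⟨hj1 ▸ hjW, hjeq ▸ hjκ, hjr.snd, hd1, ?_⟩
  have h2 : (fun t => fc.κ (j (r t))) =ᶠ[𝓝 t] r := by
    filter_upwards [hev'] with t' ht' using ht'.2.2.2
  have hκd : MDifferentiableAt 𝓘(ℝ, E × ℝ) 𝓘(ℝ, E') fc.κ (j (r t)) :=
    fc.mdifferentiableAt hjW (j (r t)).2
  rw [← DForm.pull_congr θ h2, DForm.pull_comp θ (κ := fc.κ) (ρ := fun t => j (r t)) hκd hjr,
    ContinuousLinearMap.comp_apply, ← hjeq]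
  congr 1
  have h3 : fderiv ℝ (fun t => j (r t)) t 1 = deriv (fun t => j (r t)) t := rfl
  rw [h3]
  have h4 := (hjr.fst.hasDerivAt.prodMk hjr.snd.hasDerivAt).deriv
  rw [show (fun t => ((j (r t)).1, (j (r t)).2)) = fun t => j (r t) from rfl] at h4
  rw [h4, h1.deriv_eq]

/-- A unit speed curve in a fibre is a translate of the unit speed parametrisation. -/
theorem exists_translate {θ : DForm E' P 1} (hfc : fc.UnitSpeed θ) {y : E} (hy : y ∈ fc.W)
    {γ : ℝ → P} (hγ : MDifferentiable 𝓘(ℝ, ℝ) 𝓘(ℝ, E') γ)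
    (hγπ : ∀ t, π (γ t) = (extChartAt 𝓘(ℝ, E) x₀).symm y) (hγθ : ∀ t, θ.pull γ t 1 = 1) :
    ∃ s, ∀ t, γ t = fc.κ (y, t + s) := by
  have hcy : ∀ t, extChartAt 𝓘(ℝ, E) x₀ (π (γ t)) = y := fun t => by
    rw [hγπ, (extChartAt 𝓘(ℝ, E) x₀).right_inv (fc.subset_target hy)]
  have hsurj : ∀ t, ∃ s, fc.κ (y, s) = γ t := by
    intro t
    obtain ⟨s, hs⟩ := fc.surj (γ t)
      (by rw [hγπ]; exact (extChartAt 𝓘(ℝ, E) x₀).map_target (fc.subset_target hy))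
      (by rw [hcy]; exact hy)
    rw [hcy] at hs
    exact ⟨s, hs⟩
  have hloc : ∀ t₀ s, fc.κ (y, s) = γ t₀ → ∀ᶠ t in 𝓝 t₀, γ t = fc.κ (y, s + (t - t₀)) := by
    intro t₀ s hs
    obtain ⟨τ, hτ0, hτ⟩ := fc.exists_curve_coordinates
      (Filter.Eventually.of_forall fun t => hγ t) hy hs θ
    have h1 : ∀ᶠ t in 𝓝 t₀, HasDerivAt (fun t => τ t - t) 0 t := by
      filter_upwards [hτ] with t ht
      obtain ⟨-, -, hd, -, hp⟩ := ht
      simp only [hcy, hγθ, deriv_const] at hp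
      have h2 : ((0, deriv τ t) : E × ℝ) = deriv τ t • ((0, 1) : E × ℝ) := by simp
      rw [h2, map_smul, hfc y hy, smul_eq_mul, mul_one] at hp
      exact (hd.hasDerivAt.sub (hasDerivAt_id t)).congr_deriv (by rw [← hp]; ring)
    filter_upwards [eventually_eq_of_hasDerivAt_zero h1, hτ] with t ht ht'
    have h3 := ht'.2.1
    rw [hcy] at h3
    rw [← h3]
    congr 2
    linarith
  obtain ⟨s, hs⟩ := hsurj 0
  refine ⟨s, ?_⟩
  -- Near t₀ both curves advance at the same rate, so their equality only asks whether a fixed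
  -- difference of parameters is a period. Hence it holds on an open and closed set of times.
  have hclopen : ∀ t₀, ∀ᶠ t in 𝓝 t₀, (γ t = fc.κ (y, t + s) ↔ γ t₀ = fc.κ (y, t₀ + s)) := by
    intro t₀
    obtain ⟨s₀, hs₀⟩ := hsurj t₀
    filter_upwards [hloc t₀ s₀ hs₀] with t ht
    rw [ht, ← hs₀, fc.period y hy, fc.period y hy]
    constructor
    · rintro ⟨n, hn⟩; exact ⟨n, by linarith⟩
    · rintro ⟨n, hn⟩; exact ⟨n, by linarith⟩
  have hA : IsClopen {t | γ t = fc.κ (y, t + s)} := by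
    constructor
    · rw [← isOpen_compl_iff, isOpen_iff_mem_nhds]
      intro t₀ ht₀
      filter_upwards [hclopen t₀] with t ht h
      exact ht₀ (ht.1 h)
    · rw [isOpen_iff_mem_nhds]
      intro t₀ ht₀
      filter_upwards [hclopen t₀] with t ht
      exact ht.2 ht₀
  have huniv := hA.eq_univ ⟨0, by simp [hs]⟩
  intro t
  have : t ∈ {t | γ t = fc.κ (y, t + s)} := huniv ▸ mem_univ t
  exact this

theorem mdifferentiable_fibre {y : E} (hy : y ∈ fc.W) (a : ℝ) :
    MDifferentiable 𝓘(ℝ, ℝ) 𝓘(ℝ, E') (fun t => fc.κ (y, t + a)) := fun t => by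
  refine MDifferentiableAt.comp (g := fc.κ) (f := fun t : ℝ => (y, t + a)) t
    (fc.mdifferentiableAt hy (t + a)) ?_
  exact DifferentiableAt.mdifferentiableAt (by fun_prop)

theorem pull_fibre {θ : DForm E' P 1} {y : E} (hy : y ∈ fc.W) (a t : ℝ) :
    θ.pull (fun t => fc.κ (y, t + a)) t 1 = θ.pull fc.κ (y, t + a) (0, 1) := by
  have h1 : HasDerivAt (fun t : ℝ => (y, t + a)) ((0, 1) : E × ℝ) t :=
    (hasDerivAt_const t y).prodMk ((hasDerivAt_id t).add_const a)
  rw [DForm.pull_comp θ (κ := fc.κ) (ρ := fun t => (y, t + a)) (fc.mdifferentiableAt hy (t + a))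
    h1.differentiableAt, ContinuousLinearMap.comp_apply]
  congr 1
  exact h1.deriv

/-- Two unit speed charts over the same point differ by a translation in the fibre. -/
theorem exists_translate_chart {x₁ : M} {T' : E → ℝ} (fc' : FibreChart E E' π x₁ T')
    {θ : DForm E' P 1} (hfc : fc.UnitSpeed θ) (hfc' : fc'.UnitSpeed θ) {y y' : E} (hy : y ∈ fc.W)
    (hy' : y' ∈ fc'.W)
    (h : (extChartAt 𝓘(ℝ, E) x₀).symm y = (extChartAt 𝓘(ℝ, E) x₁).symm y') :
    ∃ s, ∀ t, fc'.κ (y', t) = fc.κ (y, t + s) := by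
  have h1 := fc'.mdifferentiable_fibre hy' 0
  have h2 := fun t => fc'.pull_fibre (θ := θ) hy' 0 t
  simp only [add_zero] at h1 h2
  exact fc.exists_translate hfc hy h1 (fun t => by rw [fc'.proj y' hy', h])
    (fun t => by rw [h2, hfc' y' hy'])

/-- A translation preserves the group of periods, so T(y)ℤ = T'(y')ℤ, and generators of the same
infinite cyclic group agree up to sign. This makes the fibre length independent of the chart. -/
theorem abs_period_eq {x₁ : M} {T' : E → ℝ} (fc' : FibreChart E E' π x₁ T')
    {θ : DForm E' P 1} (hfc : fc.UnitSpeed θ) (hfc' : fc'.UnitSpeed θ) {y y' : E} (hy : y ∈ fc.W)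
    (hy' : y' ∈ fc'.W) (hT : T y ≠ 0)
    (h : (extChartAt 𝓘(ℝ, E) x₀).symm y = (extChartAt 𝓘(ℝ, E) x₁).symm y') :
    |T y| = |T' y'| := by
  obtain ⟨s, hs⟩ := fc.exists_translate_chart fc' hfc hfc' hy hy' h
  have key : ∀ t t' : ℝ, (∃ n : ℤ, t' = t + n * T' y') ↔ ∃ n : ℤ, t' + s = t + s + n * T y := by
    intro t t'
    rw [← fc'.period y' hy', ← fc.period y hy, hs, hs]
  obtain ⟨n, hn⟩ := (key 0 (T' y')).1 ⟨1, by simp⟩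
  obtain ⟨m, hm⟩ := (key 0 (T y)).2 ⟨1, by ring⟩
  have hn' : T' y' = n * T y := by linarith
  have hm' : T y = m * T' y' := by linarith
  have h1 : ((m * n : ℤ) : ℝ) = 1 := by
    push_cast
    refine mul_right_cancel₀ hT ?_
    rw [mul_assoc, ← hn', ← hm', one_mul]
  have h2 : m * n = 1 := by exact_mod_cast h1
  have h3 : |n| = 1 := by
    rcases Int.mul_eq_one_iff_eq_one_or_neg_one.1 h2 with ⟨-, h⟩ | ⟨-, h⟩ <;> simp [h]
  rw [hn', abs_mul]
  have : |(n : ℝ)| = 1 := by exact_mod_cast h3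
  rw [this, one_mul]

end FibreChart

end FibreCharts
end

noncomputable section

/-! ### The logarithm of the fibre length is a primitive of η -/

section FibreCharts

variable {E : Type*} [NormedAddCommGroup E] [NormedSpace ℝ E] [FiniteDimensional ℝ E]
variable {M : Type*} [TopologicalSpace M] [ChartedSpace E M] [IsManifold 𝓘(ℝ, E) ∞ M]
variable {E' : Type*} [NormedAddCommGroup E'] [NormedSpace ℝ E']
variable {P : Type*} [TopologicalSpace P] [ChartedSpace E' P] [IsManifold 𝓘(ℝ, E') ∞ P]
variable {π : P → M}

theorem mfderiv_comp_extChartAt_symm {f : M → ℝ} {x : M}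
    (hf : MDifferentiableAt 𝓘(ℝ, E) 𝓘(ℝ, ℝ) f x) (w : E) :
    fderiv ℝ (fun y => f ((extChartAt 𝓘(ℝ, E) x).symm y)) (extChartAt 𝓘(ℝ, E) x x) w =
      mfderiv 𝓘(ℝ, E) 𝓘(ℝ, ℝ) f x (mfderiv 𝓘(ℝ, E) 𝓘(ℝ, E) (extChartAt 𝓘(ℝ, E) x).symm
        (extChartAt 𝓘(ℝ, E) x x) w) := by
  have hs := (contMDiffAt_extChartAt_symm
    (mem_extChartAt_target (I := 𝓘(ℝ, E)) x)).mdifferentiableAt (by simp)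
  have h := mfderiv_comp_of_eq (f := (extChartAt 𝓘(ℝ, E) x).symm) (g := f) hf hs
    (extChartAt_to_inv x)
  rw [← mfderiv_eq_fderiv]
  refine (DFunLike.congr_fun h w).trans ?_
  have e : ∀ (p q : M) (h : p = q) (a : E), (mfderiv 𝓘(ℝ, E) 𝓘(ℝ, ℝ) f p : E →L[ℝ] ℝ) a =
      (mfderiv 𝓘(ℝ, E) 𝓘(ℝ, ℝ) f q : E →L[ℝ] ℝ) a := by
    rintro p q rfl a; rfl
  exact e _ _ (extChartAt_to_inv x) _

/-- The logarithm of the length of the fibres is a primitive of `η`. -/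
theorem exists_logPeriod (hπ : IsSmoothCircleBundle E E' π) {η : DForm E M 1}
    {F : DForm E M 2} {θ : DForm E' P 1} (hθ : θ.IsSmooth)
    (hθπ : IsTransverseToFibres (E := E) π θ)
    (hdθ : θ.d = (DForm.pullback π η).wedge θ + DForm.pullback π F) :
    ∃ f : M → ℝ, ContMDiff 𝓘(ℝ, E) 𝓘(ℝ, ℝ) ∞ f ∧ DForm.differential E f = η ∧
      ∀ x₀ : M, ∃ (T : E → ℝ) (fc : FibreChart E E' π x₀ T), fc.UnitSpeed θ ∧
        ∀ y ∈ fc.W, |T y| = 2 * Real.pi * Real.exp (f ((extChartAt 𝓘(ℝ, E) x₀).symm y)) := by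
  have hex : ∀ x₀ : M, ∃ (L : E → ℝ) (fc : FibreChart E E' π x₀ L), ContDiffOn ℝ ∞ L fc.W ∧
      (∀ y ∈ fc.W, L y ≠ 0) ∧ fc.UnitSpeed θ := by
    intro x₀
    obtain ⟨e, hx, he⟩ := hπ.2 x₀
    obtain ⟨fc⟩ := exists_fibreChart_of_trivialization hπ.1 he hx
    exact fc.exists_unitSpeed hπ.1 hθ hθπ
  choose L fc hLs hL0 hfc using hex
  -- The length is read at the centre of the chart chosen at x; the factor 2π makes the rescaled
  -- fibres have length exactly 2π.
  set f : M → ℝ := fun x => Real.log (|L x (extChartAt 𝓘(ℝ, E) x x)| / (2 * Real.pi)) with hf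
  have hpi : (0 : ℝ) < 2 * Real.pi := by positivity
  have hloc : ∀ x₀, ∀ y ∈ (fc x₀).W,
      f ((extChartAt 𝓘(ℝ, E) x₀).symm y) = Real.log (L x₀ y) - Real.log (2 * Real.pi) := by
    intro x₀ y hy
    have h1 := (fc x₀).abs_period_eq (fc ((extChartAt 𝓘(ℝ, E) x₀).symm y)) (hfc x₀) (hfc _) hy
      (fc ((extChartAt 𝓘(ℝ, E) x₀).symm y)).mem_W (hL0 x₀ y hy) (extChartAt_to_inv _).symm
    simp only [hf]
    -- `Real.log` ignores signs, so the absolute value can be dropped and log L is smooth whatever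
    -- the sign of L.
    rw [← h1, Real.log_div (abs_ne_zero.2 (hL0 x₀ y hy)) hpi.ne', Real.log_abs]
  have hlogs : ∀ x₀, ∀ y ∈ (fc x₀).W,
      ContDiffAt ℝ ∞ (fun y => Real.log (L x₀ y) - Real.log (2 * Real.pi)) y := fun x₀ y hy =>
    (((hLs x₀).contDiffAt ((fc x₀).isOpen_W.mem_nhds hy)).log (hL0 x₀ y hy)).sub contDiffAt_const
  have hfs : ContMDiff 𝓘(ℝ, E) 𝓘(ℝ, ℝ) ∞ f := by
    intro x₀
    have h1 := (contMDiffAt_iff_contDiffAt.2 (hlogs x₀ _ (fc x₀).mem_W)).comp x₀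
      (contMDiffAt_extChartAt (I := 𝓘(ℝ, E)) (x := x₀))
    refine h1.congr_of_eventuallyEq ?_
    filter_upwards [extChartAt_source_mem_nhds (I := 𝓘(ℝ, E)) x₀,
      (continuousAt_extChartAt (I := 𝓘(ℝ, E)) x₀).eventually
        ((fc x₀).isOpen_W.mem_nhds (fc x₀).mem_W)] with x hx hxW
    have := hloc x₀ _ hxW
    rw [(extChartAt 𝓘(ℝ, E) x₀).left_inv hx] at this
    exact this
  refine ⟨f, hfs, ?_, fun x₀ => ⟨L x₀, fc x₀, hfc x₀, ?_⟩⟩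
  · refine DForm.eq_of_covector fun x v => ?_
    obtain ⟨w, hw⟩ := exists_mfderiv_extChartAt_symm x v
    have hv : v = mfderiv 𝓘(ℝ, E) 𝓘(ℝ, E) (extChartAt 𝓘(ℝ, E) x).symm
      (extChartAt 𝓘(ℝ, E) x x) w := hw.symm
    rw [DForm.differential_covector, hv]
    refine (mfderiv_comp_extChartAt_symm (hfs.mdifferentiableAt (by simp)) w).symm.trans ?_
    have hmem := (fc x).mem_W
    have h1 : (fun y => f ((extChartAt 𝓘(ℝ, E) x).symm y)) =ᶠ[𝓝 (extChartAt 𝓘(ℝ, E) x x)]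
        fun y => Real.log (L x y) - Real.log (2 * Real.pi) := by
      filter_upwards [(fc x).isOpen_W.mem_nhds hmem] with y hy using hloc x y hy
    have hLd : DifferentiableAt ℝ (L x) (extChartAt 𝓘(ℝ, E) x x) :=
      ((hLs x).contDiffAt ((fc x).isOpen_W.mem_nhds hmem)).differentiableAt (by simp)
    rw [h1.fderiv_eq, fderiv_sub_const, fderiv.log hLd (hL0 x _ hmem), smul_apply,
      (fc x).fderiv_period (hLs x) hπ.1 hθ hdθ (hfc x) hmem, smul_eq_mul,
      inv_mul_cancel_left₀ (hL0 x _ hmem), DForm.pull_apply]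
    exact DForm.covector_congr η (extChartAt_to_inv x) _
  · intro y hy
    rw [hloc x₀ y hy, Real.exp_sub, Real.exp_log hpi, Real.exp_log_eq_abs (hL0 x₀ y hy)]
    field_simp

/-- Rescaling the unit speed charts so that the fibres have length `2π`. -/
theorem exists_chart_rescaled {θ : DForm E' P 1}
    {f : M → ℝ} (hf : ContMDiff 𝓘(ℝ, E) 𝓘(ℝ, ℝ) ∞ f) {x₀ : M} {T : E → ℝ}
    (fc : FibreChart E E' π x₀ T) (hfc : fc.UnitSpeed θ)
    (hT : ∀ y ∈ fc.W, |T y| = 2 * Real.pi * Real.exp (f ((extChartAt 𝓘(ℝ, E) x₀).symm y))) :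
    ∃ fc' : FibreChart E E' π x₀ fun _ => 2 * Real.pi,
      fc'.UnitSpeed (DForm.fsmul (fun p => Real.exp (-f (π p))) θ) := by
  set g : E → ℝ := fun y => f ((extChartAt 𝓘(ℝ, E) x₀).symm y) with hg
  have hgs : ∀ y ∈ fc.W, ContDiffAt ℝ ∞ g y := fun y hy =>
    contMDiffAt_iff_contDiffAt.1 (hf.contMDiffAt.comp y
      (contMDiffAt_extChartAt_symm (fc.subset_target hy)))
  -- Scaling time by e^f multiplies the θ-speed by e^f, cancelled by the factor e^{-f} of the new
  -- form, and divides the period |T| = 2π e^f by e^f.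
  set r : E × ℝ → ℝ := fun q => Real.exp (g q.1) * q.2 with hr
  have hrs : ∀ y ∈ fc.W, ∀ t, ContDiffAt ℝ ∞ r (y, t) := fun y hy t =>
    (((hgs y hy).comp (y, t) contDiffAt_fst).exp).mul contDiffAt_snd
  have hrd : ∀ y ∈ fc.W, ∀ t, fderiv ℝ r (y, t) (0, 1) = Real.exp (g y) := by
    intro y hy t
    have h1 : HasDerivAt (fun t : ℝ => (y, t)) ((0, 1) : E × ℝ) t :=
      (hasDerivAt_const t y).prodMk (hasDerivAt_id t)
    have h2 := ((hrs y hy t).differentiableAt (by simp)).hasFDerivAt.comp_hasDerivAt t h1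
    refine h2.unique ?_
    exact ((hasDerivAt_id t).const_mul (Real.exp (g y))).congr_deriv (mul_one _)
  have hrdiff := fun y (hy : y ∈ fc.W) t => isLocalDiffeomorphAt_fibrewise fc.isOpen_W hrs
    (fun y hy t => by rw [hrd y hy t]; exact (Real.exp_pos _).ne') hy t
  refine ⟨fc.reparam r hrdiff ?_ ?_, ?_⟩
  · intro y hy u
    refine ⟨Real.exp (-g y) * u, ?_⟩
    simp only [hr]
    rw [← mul_assoc, ← Real.exp_add]; simp
  · intro y hy t t'
    simp only [hr]
    have he := Real.exp_pos (g y)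
    have hTy : |T y| = 2 * Real.pi * Real.exp (g y) := hT y hy
    -- If T(y) is negative, the multiples of T(y) and of 2π e^f correspond under n ↦ -n.
    rcases abs_cases (T y) with ⟨h, -⟩ | ⟨h, -⟩
    · rw [h] at hTy
      refine exists_congr fun n => ?_
      rw [hTy]
      constructor
      · intro h1
        refine mul_left_cancel₀ he.ne' ?_
        rw [h1]; ring
      · rintro rfl; ring
    · have hTy' : T y = -(2 * Real.pi * Real.exp (g y)) := by linarith
      constructor
      · rintro ⟨n, h1⟩
        refine ⟨-n, mul_left_cancel₀ he.ne' ?_⟩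
        rw [h1, hTy']; push_cast; ring
      · rintro ⟨n, rfl⟩
        refine ⟨-n, ?_⟩
        rw [hTy']; push_cast; ring
  · intro y hy t
    have hρ : DifferentiableAt ℝ (fun q : E × ℝ => (q.1, r q)) (y, t) :=
      ((hrdiff y hy t).mdifferentiableAt (by simp)).differentiableAt
    have hrd' : DifferentiableAt ℝ r (y, t) := hρ.snd
    change (DForm.fsmul (fun p => Real.exp (-f (π p))) θ).pull (fun q => fc.κ (q.1, r q))
      (y, t) (0, 1) = 1
    rw [DForm.pull_fsmul, DForm.pull_comp θ (κ := fc.κ) (ρ := fun q : E × ℝ => (q.1, r q))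
      (z := (y, t)) (fc.mdifferentiableAt hy _) hρ, smul_apply,
      ContinuousLinearMap.comp_apply, (hasFDerivAt_fst.prodMk hrd'.hasFDerivAt).fderiv]
    have h7 : ((0 : E), Real.exp (g y)) = Real.exp (g y) • ((0, 1) : E × ℝ) := by simp
    simp only [ContinuousLinearMap.prod_apply, ContinuousLinearMap.coe_fst', hrd y hy t]
    rw [h7, map_smul, hfc y hy, fc.proj y hy]
    simp only [smul_eq_mul, mul_one, ← Real.exp_add, hg]
    simp

end FibreCharts
end

noncomputable section

/-! ### Trivialisations from charts with period 2π -/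

section FibreCharts

variable {E : Type*} [NormedAddCommGroup E] [NormedSpace ℝ E]
variable {M : Type*} [TopologicalSpace M] [ChartedSpace E M] [IsManifold 𝓘(ℝ, E) ∞ M]
variable {E' : Type*} [NormedAddCommGroup E'] [NormedSpace ℝ E']
variable {P : Type*} [TopologicalSpace P] [ChartedSpace E' P] [IsManifold 𝓘(ℝ, E') ∞ P]
variable {π : P → M} {x₀ : M} {T : E → ℝ}

/-- A smooth trivialisation from its fibre component and its inverse. -/
theorem exists_isSmoothTrivialization (hπ : ContMDiff 𝓘(ℝ, E') 𝓘(ℝ, E) ∞ π) {U : Set M}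
    (hU : IsOpen U) {φ : P → Circle} {ψ : M × Circle → P}
    (hφ : ContMDiffOn 𝓘(ℝ, E') (𝓡 1) ∞ φ (π ⁻¹' U))
    (hψ : ContMDiffOn (𝓘(ℝ, E).prod (𝓡 1)) 𝓘(ℝ, E') ∞ ψ (U ×ˢ univ))
    (hπψ : ∀ x ∈ U, ∀ z, π (ψ (x, z)) = x) (hφψ : ∀ x ∈ U, ∀ z, φ (ψ (x, z)) = z)
    (hψφ : ∀ p, π p ∈ U → ψ (π p, φ p) = p) :
    ∃ e : Bundle.Trivialization Circle π, e.baseSet = U ∧ (∀ p, e p = (π p, φ p)) ∧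
      IsSmoothTrivialization E E' e := by
  have h1 : ContMDiffOn 𝓘(ℝ, E') (𝓘(ℝ, E).prod (𝓡 1)) ∞ (fun p => (π p, φ p)) (π ⁻¹' U) :=
    hπ.contMDiffOn.prodMk hφ
  let e : Bundle.Trivialization Circle π :=
    { toFun := fun p => (π p, φ p)
      invFun := ψ
      source := π ⁻¹' U
      target := U ×ˢ univ
      map_source' := fun p hp => ⟨hp, mem_univ _⟩
      map_target' := by
        rintro ⟨x, z⟩ ⟨hx, -⟩
        change π (ψ (x, z)) ∈ U
        rw [hπψ x hx]; exact hx
      left_inv' := fun p hp => hψφ p hp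
      right_inv' := by
        rintro ⟨x, z⟩ ⟨hx, -⟩
        exact Prod.ext (hπψ x hx z) (hφψ x hx z)
      open_source := hU.preimage hπ.continuous
      open_target := hU.prod isOpen_univ
      continuousOn_toFun := h1.continuousOn
      continuousOn_invFun := hψ.continuousOn
      baseSet := U
      open_baseSet := hU
      source_eq := rfl
      target_eq := rfl
      proj_toFun := fun p _ => rfl }
  exact ⟨e, rfl, fun p => rfl, h1, hψ⟩

namespace FibreChart

/-- The open set of the base over which a fibre chart is defined. -/
def base (fc : FibreChart E E' π x₀ T) : Set M :=
  (extChartAt 𝓘(ℝ, E) x₀).source ∩ extChartAt 𝓘(ℝ, E) x₀ ⁻¹' fc.W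

theorem isOpen_base (fc : FibreChart E E' π x₀ T) : IsOpen fc.base :=
  (continuousOn_extChartAt x₀).isOpen_inter_preimage (isOpen_extChartAt_source x₀) fc.isOpen_W

theorem mem_base (fc : FibreChart E E' π x₀ T) : x₀ ∈ fc.base :=
  ⟨mem_extChartAt_source x₀, fc.mem_W⟩

theorem symm_mem_base (fc : FibreChart E E' π x₀ T) {y : E} (hy : y ∈ fc.W) :
    (extChartAt 𝓘(ℝ, E) x₀).symm y ∈ fc.base := by
  have h := fc.subset_target hy
  refine ⟨(extChartAt 𝓘(ℝ, E) x₀).map_target h, ?_⟩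
  rw [mem_preimage, (extChartAt 𝓘(ℝ, E) x₀).right_inv h]
  exact hy

theorem proj_mem_base (fc : FibreChart E E' π x₀ T) {y : E} (hy : y ∈ fc.W) (t : ℝ) :
    π (fc.κ (y, t)) ∈ fc.base := by
  rw [fc.proj y hy]; exact fc.symm_mem_base hy

theorem chart_proj (fc : FibreChart E E' π x₀ T) {y : E} (hy : y ∈ fc.W) (t : ℝ) :
    extChartAt 𝓘(ℝ, E) x₀ (π (fc.κ (y, t))) = y := by
  rw [fc.proj y hy, (extChartAt 𝓘(ℝ, E) x₀).right_inv (fc.subset_target hy)]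

theorem exists_coordinates (fc : FibreChart E E' π x₀ T) {p : P} (hp : π p ∈ fc.base) :
    ∃ y ∈ fc.W, ∃ t, fc.κ (y, t) = p ∧ (extChartAt 𝓘(ℝ, E) x₀).symm y = π p := by
  obtain ⟨t, ht⟩ := fc.surj p hp.1 hp.2
  exact ⟨_, hp.2, t, ht, (extChartAt 𝓘(ℝ, E) x₀).left_inv hp.1⟩

section TwoPi

variable (fc : FibreChart E E' π x₀ fun _ => 2 * Real.pi)

/-- The periods are exactly the kernel of `Circle.exp`, so κ(y,·) descends to an injection of the
circle. -/
theorem κ_eq_iff {y : E} (hy : y ∈ fc.W) (t t' : ℝ) :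
    fc.κ (y, t) = fc.κ (y, t') ↔ Circle.exp t = Circle.exp t' := by
  rw [fc.period y hy, Circle.exp_eq_exp]
  constructor
  · rintro ⟨n, hn⟩; exact ⟨-n, by push_cast; linarith⟩
  · rintro ⟨n, hn⟩; exact ⟨-n, by push_cast; linarith⟩

open Classical in
/-- The fibre coordinate, with values in the circle. -/
def phase (p : P) : Circle :=
  -- The chosen parameter is ambiguous up to a period, which the exponential removes over the base
  -- of the chart; elsewhere the value is irrelevant.
  Circle.exp (if h : ∃ t, fc.κ (extChartAt 𝓘(ℝ, E) x₀ (π p), t) = p then h.choose else 0)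

theorem phase_apply {y : E} (hy : y ∈ fc.W) (t : ℝ) : fc.phase (fc.κ (y, t)) = Circle.exp t := by
  have h : ∃ t', fc.κ (extChartAt 𝓘(ℝ, E) x₀ (π (fc.κ (y, t))), t') = fc.κ (y, t) :=
    ⟨t, by rw [fc.chart_proj hy]⟩
  rw [phase, dif_pos h]
  have h2 := h.choose_spec.trans (congrArg (fun y => fc.κ (y, t)) (fc.chart_proj hy t).symm)
  exact (fc.κ_eq_iff (by rw [fc.chart_proj hy]; exact hy) _ _).1 h2

theorem contMDiffAt_phase {y : E} (hy : y ∈ fc.W) (t : ℝ) :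
    ContMDiffAt 𝓘(ℝ, E') (𝓡 1) ∞ fc.phase (fc.κ (y, t)) := by
  obtain ⟨j, hj0, hj⟩ := fc.exists_localInverse hy t
  have h1 : ContMDiffAt 𝓘(ℝ, E') 𝓘(ℝ, ℝ) ∞ (fun p => (j p).2) (fc.κ (y, t)) :=
    (contMDiffAt_iff_contDiffAt.2 contDiffAt_snd).comp (fc.κ (y, t)) hj.self_of_nhds.1
  refine (contMDiff_circleExp.contMDiffAt.comp (fc.κ (y, t)) h1).congr_of_eventuallyEq ?_
  filter_upwards [hj] with p hp
  have := fc.phase_apply hp.2.1 (j p).2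
  rw [Prod.mk.eta, hp.2.2.2] at this
  exact this

/-- `Complex.arg` jumps, but by periodicity of κ it may be replaced near z by a smooth logarithm
branch without changing the map. -/
theorem contMDiffAt_exp_symm {x : M} (hx : x ∈ fc.base) (z : Circle) :
    ContMDiffAt (𝓘(ℝ, E).prod (𝓡 1)) 𝓘(ℝ, E') ∞
      (fun a : M × Circle => fc.κ (extChartAt 𝓘(ℝ, E) x₀ a.1, Complex.arg a.2)) (x, z) := by
  set u := Complex.arg z
  have hz : z ∈ circleLogDomain u := by
    rw [← Circle.exp_arg z]
    exact exp_mem_circleLogDomain ⟨by linarith [Real.pi_pos], by linarith [Real.pi_pos]⟩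
  have h1 : ContMDiffAt (𝓘(ℝ, E).prod (𝓡 1)) 𝓘(ℝ, E) ∞
      (fun a : M × Circle => extChartAt 𝓘(ℝ, E) x₀ a.1) (x, z) :=
    (contMDiffAt_extChartAt' (by simpa using hx.1)).comp (x, z) contMDiffAt_fst
  have h2 : ContMDiffAt (𝓘(ℝ, E).prod (𝓡 1)) 𝓘(ℝ, ℝ) ∞
      (fun a : M × Circle => circleLog u a.2) (x, z) :=
    ContMDiffAt.comp (g := circleLog u) (f := fun a : M × Circle => a.2) (x, z)
      ((contMDiffOn_circleLog u).contMDiffAt ((isOpen_circleLogDomain u).mem_nhds hz))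
      contMDiffAt_snd
  have h3 : ContMDiffAt (𝓘(ℝ, E).prod (𝓡 1)) 𝓘(ℝ, E') ∞
      (fun a : M × Circle => fc.κ (extChartAt 𝓘(ℝ, E) x₀ a.1, circleLog u a.2)) (x, z) :=
    ContMDiffAt.comp (g := fc.κ)
      (f := fun a : M × Circle => (extChartAt 𝓘(ℝ, E) x₀ a.1, circleLog u a.2)) (x, z)
      (fc.contMDiffAt hx.2 _) (h1.prodMk_space h2)
  refine h3.congr_of_eventuallyEq ?_
  have h4 : ∀ᶠ a : M × Circle in 𝓝 (x, z), a.1 ∈ fc.base :=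
    (fc.isOpen_base.preimage continuous_fst).mem_nhds hx
  filter_upwards [h4] with a ha
  rw [fc.κ_eq_iff ha.2, exp_circleLog, Circle.exp_arg]

theorem exists_trivialization (hπ : ContMDiff 𝓘(ℝ, E') 𝓘(ℝ, E) ∞ π) :
    ∃ e : Bundle.Trivialization Circle π, e.baseSet = fc.base ∧
      (∀ p, e p = (π p, fc.phase p)) ∧ IsSmoothTrivialization E E' e := by
  refine exists_isSmoothTrivialization hπ fc.isOpen_base (φ := fc.phase)
    (ψ := fun a => fc.κ (extChartAt 𝓘(ℝ, E) x₀ a.1, Complex.arg a.2)) ?_ ?_ ?_ ?_ ?_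
  · intro p hp
    obtain ⟨y, hy, t, rfl, -⟩ := fc.exists_coordinates hp
    exact (fc.contMDiffAt_phase hy t).contMDiffWithinAt
  · rintro ⟨x, z⟩ ⟨hx, -⟩
    exact (fc.contMDiffAt_exp_symm hx z).contMDiffWithinAt
  · intro x hx z
    rw [fc.proj _ hx.2, (extChartAt 𝓘(ℝ, E) x₀).left_inv hx.1]
  · intro x hx z
    rw [fc.phase_apply hx.2, Circle.exp_arg]
  · intro p hp
    obtain ⟨y, hy, t, rfl, -⟩ := fc.exists_coordinates hp
    rw [fc.chart_proj hy, fc.κ_eq_iff hy, Circle.exp_arg, fc.phase_apply hy]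

end TwoPi

end FibreChart

/-! ### The normalised vertical vector field -/

section Vertical

/-- The difference lies in ker θ and in the vertical space, which meet in 0. This is the uniqueness
of Y. -/
theorem eq_of_vertical {θ : DForm E' P 1} (hθπ : IsTransverseToFibres (E := E) π θ) {p : P}
    {v w : TangentSpace 𝓘(ℝ, E') p} (hv : mfderiv 𝓘(ℝ, E') 𝓘(ℝ, E) π p v = 0)
    (hw : mfderiv 𝓘(ℝ, E') 𝓘(ℝ, E) π p w = 0) (h : θ.covector p v = θ.covector p w) : v = w := by
  have h2 := (hθπ p).disjoint.le_bot (x := v - w)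
    ⟨LinearMap.mem_ker.2 ?_, LinearMap.mem_ker.2 ?_⟩
  · exact sub_eq_zero.1 ((Submodule.mem_bot ℝ).1 h2)
  · exact (map_sub (θ.covector p) v w).trans (sub_eq_zero.2 h)
  · refine (map_sub (mfderiv 𝓘(ℝ, E') 𝓘(ℝ, E) π p) v w).trans ?_
    rw [hv, hw, sub_zero]

theorem FibreChart.mfderiv_proj_fibre (fc : FibreChart E E' π x₀ T)
    (hπ : ContMDiff 𝓘(ℝ, E') 𝓘(ℝ, E) ∞ π) {y : E} (hy : y ∈ fc.W) (t : ℝ) :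
    (mfderiv 𝓘(ℝ, E') 𝓘(ℝ, E) π (fc.κ (y, t))
      (mfderiv 𝓘(ℝ, E × ℝ) 𝓘(ℝ, E') fc.κ (y, t) (0, 1)) : E) = 0 :=
  (fc.mfderiv_proj hπ hy t (0, 1)).trans (ContinuousLinearMap.map_zero
    (mfderiv 𝓘(ℝ, E) 𝓘(ℝ, E) (extChartAt 𝓘(ℝ, E) x₀).symm y : E →L[ℝ] E))

theorem FibreChart.vertical_eq (fc : FibreChart E E' π x₀ T)
    (hπ : ContMDiff 𝓘(ℝ, E') 𝓘(ℝ, E) ∞ π) {θ : DForm E' P 1}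
    (hθπ : IsTransverseToFibres (E := E) π θ) (hfc : fc.UnitSpeed θ)
    {Y : (p : P) → TangentSpace 𝓘(ℝ, E') p}
    (hY : ∀ p, mfderiv 𝓘(ℝ, E') 𝓘(ℝ, E) π p (Y p) = 0) (hθY : ∀ p, θ.covector p (Y p) = 1)
    {y : E} (hy : y ∈ fc.W) (t : ℝ) :
    Y (fc.κ (y, t)) = mfderiv 𝓘(ℝ, E × ℝ) 𝓘(ℝ, E') fc.κ (y, t) (0, 1) :=
  eq_of_vertical hθπ (hY _) (fc.mfderiv_proj_fibre hπ hy t) ((hθY _).trans (hfc y hy t).symm)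

/-- The vertical field with `θ(Y) = 1` is smooth. -/
theorem isSmoothVectorField_vertical (hπ : ContMDiff 𝓘(ℝ, E') 𝓘(ℝ, E) ∞ π) {θ : DForm E' P 1}
    (hθπ : IsTransverseToFibres (E := E) π θ) {T : M → E → ℝ}
    (ch : ∀ x₀ : M, FibreChart E E' π x₀ (T x₀)) (hch : ∀ x₀, (ch x₀).UnitSpeed θ)
    [IsManifold 𝓘(ℝ, E') 1 P] {Y : (p : P) → TangentSpace 𝓘(ℝ, E') p}
    (hY : ∀ p, mfderiv 𝓘(ℝ, E') 𝓘(ℝ, E) π p (Y p) = 0) (hθY : ∀ p, θ.covector p (Y p) = 1) :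
    IsSmoothVectorField Y := by
  intro p
  obtain ⟨x₁, hx₁⟩ : ∃ x₁, π p ∈ (ch x₁).base := ⟨_, (ch (π p)).mem_base⟩
  obtain ⟨y, hy, t, rfl, -⟩ := (ch x₁).exists_coordinates hx₁
  obtain ⟨j, hj0, hj⟩ := (ch x₁).exists_localInverse hy t
  set O : Set (E × ℝ) := (ch x₁).W ×ˢ univ with hO
  have hOo : IsOpen O := (ch x₁).isOpen_W.prod isOpen_univ
  have hκ : ContMDiffOn 𝓘(ℝ, E × ℝ) 𝓘(ℝ, E') ∞ (ch x₁).κ O := fun q hq =>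
    ((ch x₁).contMDiffAt hq.1 q.2).contMDiffWithinAt
  -- Near p the field is a composite of smooth maps: a local inverse of κ, the constant field ∂_t,
  -- and the tangent map of κ.
  have h1 := hκ.contMDiffOn_tangentMapWithin (m := ∞) (by simp) hOo.uniqueMDiffOn
  have h2 : ContMDiff 𝓘(ℝ, E × ℝ) 𝓘(ℝ, E × ℝ).tangent ∞
      (fun q : E × ℝ => (⟨q, ((0, 1) : E × ℝ)⟩ : TangentBundle 𝓘(ℝ, E × ℝ) (E × ℝ))) :=
    contMDiff_vectorSpace_iff_contDiff.2 contDiff_const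
  have h3 : ContMDiffAt 𝓘(ℝ, E') 𝓘(ℝ, E × ℝ).tangent ∞
      (fun p => (⟨j p, ((0, 1) : E × ℝ)⟩ : TangentBundle 𝓘(ℝ, E × ℝ) (E × ℝ)))
      ((ch x₁).κ (y, t)) := ContMDiffAt.comp _ h2.contMDiffAt hj.self_of_nhds.1
  have h4 := ContMDiffAt.comp_of_eq (y := (⟨(y, t), ((0, 1) : E × ℝ)⟩ :
      TangentBundle 𝓘(ℝ, E × ℝ) (E × ℝ)))
    (h1.contMDiffAt (hOo.preimage (FiberBundle.continuous_proj _ _) |>.mem_nhds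
      ⟨hy, mem_univ _⟩)) h3 (by rw [hj0])
  refine h4.congr_of_eventuallyEq ?_
  filter_upwards [hj] with p hp
  obtain ⟨-, hjW, -, hjκ⟩ := hp
  have h5 := (ch x₁).vertical_eq hπ hθπ (hch x₁) hY hθY hjW (j p).2
  have e : ∀ q : P, q = p → (⟨p, Y p⟩ : TangentBundle 𝓘(ℝ, E') P) = ⟨q, Y q⟩ := by
    rintro q rfl; rfl
  refine (e _ hjκ).trans ?_
  change _ = (⟨(ch x₁).κ (j p), mfderivWithin 𝓘(ℝ, E × ℝ) 𝓘(ℝ, E') (ch x₁).κ O (j p) (0, 1)⟩ :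
    TangentBundle 𝓘(ℝ, E') P)
  rw [mfderivWithin_of_isOpen hOo ⟨hjW, mem_univ _⟩]
  exact congrArg _ h5

theorem exists_vertical (hπ : ContMDiff 𝓘(ℝ, E') 𝓘(ℝ, E) ∞ π) {θ : DForm E' P 1} {T : M → E → ℝ}
    (ch : ∀ x₀ : M, FibreChart E E' π x₀ (T x₀)) (hch : ∀ x₀, (ch x₀).UnitSpeed θ) :
    ∃ Y : (p : P) → TangentSpace 𝓘(ℝ, E') p,
      (∀ p, mfderiv 𝓘(ℝ, E') 𝓘(ℝ, E) π p (Y p) = 0) ∧ (∀ p, θ.covector p (Y p) = 1) := by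
  have h : ∀ p : P, ∃ v : TangentSpace 𝓘(ℝ, E') p,
      mfderiv 𝓘(ℝ, E') 𝓘(ℝ, E) π p v = 0 ∧ θ.covector p v = 1 := by
    intro p
    obtain ⟨x₁, hx₁⟩ : ∃ x₁, π p ∈ (ch x₁).base := ⟨_, (ch (π p)).mem_base⟩
    obtain ⟨y, hy, t, rfl, -⟩ := (ch x₁).exists_coordinates hx₁
    exact ⟨_, (ch x₁).mfderiv_proj_fibre hπ hy t, hch x₁ y hy t⟩
  choose Y hY using h
  exact ⟨Y, fun p => (hY p).1, fun p => (hY p).2⟩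

end Vertical

end FibreCharts
end

noncomputable section

/-! ### The circle action and the invariance of the connection -/

section Action

variable {E : Type*} [NormedAddCommGroup E] [NormedSpace ℝ E]
variable {M : Type*} [TopologicalSpace M] [ChartedSpace E M] [IsManifold 𝓘(ℝ, E) ∞ M]
variable {E' : Type*} [NormedAddCommGroup E'] [NormedSpace ℝ E']
variable {P : Type*} [TopologicalSpace P] [ChartedSpace E' P] [IsManifold 𝓘(ℝ, E') ∞ P]
variable {π : P → M} {x₀ : M}

/-- The rotation of the fibres defined by a family of fibre charts with fibres of length `2π`. -/
def circleAction (ch : ∀ x₀ : M, FibreChart E E' π x₀ fun _ => 2 * Real.pi) (z : Circle) (p : P) :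
    P :=
  (ch (π p)).κ (extChartAt 𝓘(ℝ, E) (π p) (π p),
    ((ch (π p)).surj p (mem_extChartAt_source _) (ch (π p)).mem_W).choose + Complex.arg z)

variable (ch : ∀ x₀ : M, FibreChart E E' π x₀ fun _ => 2 * Real.pi) {θ : DForm E' P 1}

/-- Unit speed charts over the same point differ by a translation, which commutes with adding u.
Hence the chart and the parameter chosen in the definition do not matter, and in every chart the
action is t ↦ t + u. -/
theorem circleAction_apply (hch : ∀ x₀, (ch x₀).UnitSpeed θ)
    (fc : FibreChart E E' π x₀ fun _ => 2 * Real.pi) (hfc : fc.UnitSpeed θ) {y : E} (hy : y ∈ fc.W)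
    (t u : ℝ) : circleAction ch (Circle.exp u) (fc.κ (y, t)) = fc.κ (y, t + u) := by
  set p := fc.κ (y, t) with hp
  have hs := ((ch (π p)).surj p (mem_extChartAt_source _) (ch (π p)).mem_W).choose_spec
  set s := ((ch (π p)).surj p (mem_extChartAt_source _) (ch (π p)).mem_W).choose with hsdef
  obtain ⟨s', hs'⟩ := fc.exists_translate_chart (ch (π p)) hfc (hch _) hy (ch (π p)).mem_W
    (by rw [extChartAt_to_inv, hp, fc.proj y hy])
  change (ch (π p)).κ (_, s + Complex.arg (Circle.exp u)) = _
  rw [hs', fc.κ_eq_iff hy]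
  rw [hs', hp, fc.κ_eq_iff hy] at hs
  rw [show s + Complex.arg (Circle.exp u) + s' = (s + s') + Complex.arg (Circle.exp u) by ring,
    Circle.exp_add, hs, Circle.exp_arg, Circle.exp_add]

theorem exists_exp_eq (z : Circle) : ∃ u, Circle.exp u = z := ⟨_, Circle.exp_arg z⟩

theorem exists_chart_coordinates {T : M → E → ℝ} (ch : ∀ x₀ : M, FibreChart E E' π x₀ (T x₀))
    (p : P) : ∃ x₁, ∃ y ∈ (ch x₁).W, ∃ t, (ch x₁).κ (y, t) = p := by
  obtain ⟨y, hy, t, h, -⟩ := (ch (π p)).exists_coordinates (ch (π p)).mem_base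
  exact ⟨_, y, hy, t, h⟩

/-- In a chart the axioms become addition of real parameters. Smoothness in the group variable uses
a logarithm branch near z, and the phase of a chart turns translation into multiplication, giving
equivariant trivialisations. -/
theorem isPrincipalCircleAction_circleAction (hπ : ContMDiff 𝓘(ℝ, E') 𝓘(ℝ, E) ∞ π)
    (hch : ∀ x₀, (ch x₀).UnitSpeed θ) : IsPrincipalCircleAction E E' π (circleAction ch) := by
  have key : ∀ x₁ {y : E}, y ∈ (ch x₁).W → ∀ t u, circleAction ch (Circle.exp u)
      ((ch x₁).κ (y, t)) = (ch x₁).κ (y, t + u) := fun x₁ _ hy =>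
    circleAction_apply ch hch (ch x₁) (hch x₁) hy
  refine ⟨?_, ?_, ?_, hπ, ?_, ?_⟩
  · intro p
    obtain ⟨x₁, y, hy, t, rfl⟩ := exists_chart_coordinates ch p
    rw [← Circle.exp_zero, key x₁ hy, add_zero]
  · intro z w p
    obtain ⟨x₁, y, hy, t, rfl⟩ := exists_chart_coordinates ch p
    obtain ⟨u, rfl⟩ := exists_exp_eq z
    obtain ⟨v, rfl⟩ := exists_exp_eq w
    rw [← Circle.exp_add, key x₁ hy, key x₁ hy, key x₁ hy]
    congr 2; ring
  · rintro ⟨z, p⟩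
    obtain ⟨x₁, y, hy, t, rfl⟩ := exists_chart_coordinates ch p
    set fc := ch x₁ with hfc
    obtain ⟨j, hj0, hj⟩ := fc.exists_localInverse hy t
    set u := Complex.arg z with hu
    have hz : z ∈ circleLogDomain u := by
      rw [← Circle.exp_arg z]
      exact exp_mem_circleLogDomain ⟨by linarith [Real.pi_pos], by linarith [Real.pi_pos]⟩
    have h1 : ContMDiffAt ((𝓡 1).prod 𝓘(ℝ, E')) 𝓘(ℝ, E × ℝ) ∞ (fun a : Circle × P => j a.2)
        (z, fc.κ (y, t)) :=
      ContMDiffAt.comp (g := j) (f := fun a : Circle × P => a.2) (z, fc.κ (y, t))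
        hj.self_of_nhds.1 contMDiffAt_snd
    have h2 : ContMDiffAt ((𝓡 1).prod 𝓘(ℝ, E')) 𝓘(ℝ, ℝ) ∞ (fun a : Circle × P => circleLog u a.1)
        (z, fc.κ (y, t)) :=
      ContMDiffAt.comp (g := circleLog u) (f := fun a : Circle × P => a.1) (z, fc.κ (y, t))
        ((contMDiffOn_circleLog u).contMDiffAt ((isOpen_circleLogDomain u).mem_nhds hz))
        contMDiffAt_fst
    have h3 : ContMDiffAt ((𝓡 1).prod 𝓘(ℝ, E')) 𝓘(ℝ, E × ℝ) ∞
        (fun a : Circle × P => ((j a.2).1, (j a.2).2 + circleLog u a.1)) (z, fc.κ (y, t)) := by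
      have h4 : ContMDiff 𝓘(ℝ, (E × ℝ) × ℝ) 𝓘(ℝ, E × ℝ) ∞
          (fun a : (E × ℝ) × ℝ => (a.1.1, a.1.2 + a.2)) := by
        apply ContDiff.contMDiff
        fun_prop
      exact ContMDiffAt.comp (z, fc.κ (y, t)) h4.contMDiffAt (h1.prodMk_space h2)
    have h5 : ContMDiffAt ((𝓡 1).prod 𝓘(ℝ, E')) 𝓘(ℝ, E') ∞
        (fun a : Circle × P => fc.κ ((j a.2).1, (j a.2).2 + circleLog u a.1)) (z, fc.κ (y, t)) :=
      ContMDiffAt.comp (g := fc.κ)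
        (f := fun a : Circle × P => ((j a.2).1, (j a.2).2 + circleLog u a.1)) (z, fc.κ (y, t))
        (fc.contMDiffAt hj.self_of_nhds.2.1 _) h3
    refine h5.congr_of_eventuallyEq ?_
    have h6 : ∀ᶠ a : Circle × P in 𝓝 (z, fc.κ (y, t)), fc.κ (j a.2) = a.2 ∧ (j a.2).1 ∈ fc.W :=
      (Continuous.tendsto (continuous_snd (X := Circle) (Y := P)) (z, fc.κ (y, t))).eventually
        (p := fun p => fc.κ (j p) = p ∧ (j p).1 ∈ fc.W) (hj.mono fun p hp => ⟨hp.2.2.2, hp.2.1⟩)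
    filter_upwards [h6] with a ha
    conv_lhs => rw [← ha.1, ← exp_circleLog u a.1]
    exact key x₁ ha.2 _ _
  · intro z p
    obtain ⟨x₁, y, hy, t, rfl⟩ := exists_chart_coordinates ch p
    obtain ⟨u, rfl⟩ := exists_exp_eq z
    rw [key x₁ hy, (ch x₁).proj y hy, (ch x₁).proj y hy]
  · intro x
    obtain ⟨e, he, hep, hes⟩ := (ch x).exists_trivialization hπ
    refine ⟨e, he ▸ (ch x).mem_base, hes, ?_⟩
    intro z p hp
    rw [e.mem_source, he] at hp
    obtain ⟨y, hy, t, rfl, -⟩ := (ch x).exists_coordinates hp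
    obtain ⟨u, rfl⟩ := exists_exp_eq z
    rw [hep, hep, key x hy, (ch x).proj y hy, (ch x).phase_apply hy, (ch x).phase_apply hy,
      (ch x).proj y hy, Circle.exp_add, mul_comm]

/-- Orbits are the curves t ↦ κ(y, t + s), whose velocity is the vertical vector with θ-value 1,
that is Y. -/
theorem generatesCircleAction_circleAction (hπ : ContMDiff 𝓘(ℝ, E') 𝓘(ℝ, E) ∞ π)
    (hθπ : IsTransverseToFibres (E := E) π θ) (hch : ∀ x₀, (ch x₀).UnitSpeed θ)
    {Y : (p : P) → TangentSpace 𝓘(ℝ, E') p}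
    (hY : ∀ p, mfderiv 𝓘(ℝ, E') 𝓘(ℝ, E) π p (Y p) = 0) (hθY : ∀ p, θ.covector p (Y p) = 1) :
    GeneratesCircleAction (circleAction ch) Y := by
  intro p
  obtain ⟨x₁, y, hy, s, rfl⟩ := exists_chart_coordinates ch p
  have h1 : (fun t : ℝ => circleAction ch (Circle.exp t) ((ch x₁).κ (y, s))) =
      fun t => (ch x₁).κ (y, t + s) := by
    funext t
    rw [circleAction_apply ch hch (ch x₁) (hch x₁) hy, add_comm]
  rw [h1]
  intro t
  have h2 := ((ch x₁).mdifferentiable_fibre hy s t).hasMFDerivAt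
  refine h2.congr_mfderiv ?_
  have h3 : HasDerivAt (fun t : ℝ => (y, t + s)) ((0, 1) : E × ℝ) t :=
    (hasDerivAt_const t y).prodMk ((hasDerivAt_id t).add_const s)
  have h4 := mfderiv_comp_fderiv (κ := (ch x₁).κ) (ρ := fun t : ℝ => (y, t + s)) (z := t)
    ((ch x₁).mdifferentiableAt hy _) h3.differentiableAt 1
  have h5 : fderiv ℝ (fun t : ℝ => (y, t + s)) t 1 = ((0, 1) : E × ℝ) := h3.deriv
  rw [h5] at h4
  have h6 := h4.trans ((ch x₁).vertical_eq hπ hθπ (hch x₁) hY hθY hy (t + s)).symm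
  refine ContinuousLinearMap.ext_ring (M₁ := E') ?_
  refine h6.trans ?_
  exact (one_smul ℝ (Y ((ch x₁).κ (y, t + s)) : E')).symm

theorem DForm.zero_wedge (θ : DForm E' P 1) : (0 : DForm E' P 1).wedge θ = 0 := by
  funext p
  refine DForm.ext_two fun v w => ?_
  rw [DForm.wedge_apply_two]
  have h : ∀ v, (0 : DForm E' P 1).covector p v = 0 := fun v => rfl
  rw [h, h, zero_mul, zero_mul, sub_zero]
  rfl

/-- The horizontal part of a connection form with basic curvature does not depend on the fibre
parameter. -/
theorem FibreChart.pull_apply_connection {T : E → ℝ} (fc : FibreChart E E' π x₀ T)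
    (hπ : ContMDiff 𝓘(ℝ, E') 𝓘(ℝ, E) ∞ π) {F : DForm E M 2} (hθ : θ.IsSmooth)
    (hdθ : θ.d = DForm.pullback π F) (hfc : fc.UnitSpeed θ) {y : E} (hy : y ∈ fc.W) (t : ℝ)
    (a : E × ℝ) : θ.pull fc.κ (y, t) a = θ.pull fc.κ (y, 0) (a.1, 0) + a.2 := by
  -- Basic curvature is the structure equation with η = 0, in which the drift -t η(v) disappears.
  have h0 : θ.d = (DForm.pullback π (0 : DForm E M 1)).wedge θ + DForm.pullback π F := by
    have : (DForm.pullback π (0 : DForm E M 1) : DForm E' P 1) = 0 := rfl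
    rw [this, DForm.zero_wedge, zero_add, hdθ]
  have h1 := fc.pull_apply_horizontal hπ hθ h0 hfc hy a.1 t
  have h2 : (0 : DForm E M 1).pull (extChartAt 𝓘(ℝ, E) x₀).symm y a.1 = 0 := rfl
  rw [h2, mul_zero, sub_zero] at h1
  have h3 : a = (a.1, 0) + a.2 • ((0, 1) : E × ℝ) := by ext <;> simp
  rw [← h1]
  conv_lhs => rw [h3, map_add, map_smul, hfc y hy, smul_eq_mul, mul_one]

/-- In a chart θ is dt plus a part independent of t, and rotations are translations of t, with
identity derivative. -/
theorem isPrincipalConnection_circleAction (hπ : ContMDiff 𝓘(ℝ, E') 𝓘(ℝ, E) ∞ π)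
    (hch : ∀ x₀, (ch x₀).UnitSpeed θ) {F : DForm E M 2} (hθ : θ.IsSmooth)
    (hdθ : θ.d = DForm.pullback π F)
    {Y : (p : P) → TangentSpace 𝓘(ℝ, E') p} (hθY : ∀ p, θ.covector p (Y p) = 1) :
    IsPrincipalConnection (circleAction ch) Y θ := by
  refine ⟨hθ, hθY, ?_⟩
  intro z
  have hsm := (isPrincipalCircleAction_circleAction ch hπ hch).smooth_act
  have hz : ContMDiff 𝓘(ℝ, E') 𝓘(ℝ, E') ∞ (circleAction ch z) :=
    hsm.comp (f := fun p : P => (z, p)) (contMDiff_const.prodMk contMDiff_id)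
  refine DForm.eq_of_covector fun p v => ?_
  obtain ⟨x₁, y, hy, t, rfl⟩ := exists_chart_coordinates ch p
  obtain ⟨u, rfl⟩ := exists_exp_eq z
  obtain ⟨a, rfl⟩ := (ch x₁).surjective_mfderiv hy t v
  have h1 := DForm.pull_pullback (circleAction ch (Circle.exp u)) θ (κ := (ch x₁).κ) (z := (y, t))
    (hz.mdifferentiableAt (by simp)) ((ch x₁).mdifferentiableAt hy t)
  refine (DFunLike.congr_fun h1 a).trans ?_
  have h2 : (fun q => circleAction ch (Circle.exp u) ((ch x₁).κ q)) =ᶠ[𝓝 (y, t)]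
      fun q => (ch x₁).κ (q.1, q.2 + u) := by
    filter_upwards [(ch x₁).eventually_mem_W hy t] with q hq
    exact circleAction_apply ch hch (ch x₁) (hch x₁) hq q.2 u
  have h3 : HasFDerivAt (fun q : E × ℝ => (q.1, q.2 + u)) (ContinuousLinearMap.id ℝ (E × ℝ))
      (y, t) := by
    have h := (hasFDerivAt_id (𝕜 := ℝ) (y, t)).add_const ((0, u) : E × ℝ)
    have e : (fun q : E × ℝ => (q.1, q.2 + u)) = fun q => id q + (0, u) := by
      funext q; ext <;> simp
    rwa [e]
  rw [DForm.pull_congr θ h2, DForm.pull_comp θ (κ := (ch x₁).κ)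
    (ρ := fun q : E × ℝ => (q.1, q.2 + u)) ((ch x₁).mdifferentiableAt hy _) h3.differentiableAt,
    h3.fderiv, ContinuousLinearMap.comp_apply, ContinuousLinearMap.id_apply,
    (ch x₁).pull_apply_connection hπ hθ hdθ (hch x₁) hy]
  exact ((ch x₁).pull_apply_connection hπ hθ hdθ (hch x₁) hy t a).symm

end Action

/-! ### Rescaling the connection form -/

section Rescaling

variable {E : Type*} [NormedAddCommGroup E] [NormedSpace ℝ E]
variable {M : Type*} [TopologicalSpace M] [ChartedSpace E M] [IsManifold 𝓘(ℝ, E) ∞ M]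
variable {E' : Type*} [NormedAddCommGroup E'] [NormedSpace ℝ E']
variable {P : Type*} [TopologicalSpace P] [ChartedSpace E' P] [IsManifold 𝓘(ℝ, E') ∞ P]
variable {π : P → M}

theorem IsTransverseToFibres.fsmul {θ : DForm E' P 1} (hθπ : IsTransverseToFibres (E := E) π θ)
    {u : P → ℝ} (hu : ∀ p, u p ≠ 0) : IsTransverseToFibres (E := E) π (DForm.fsmul u θ) := by
  intro p
  have h : LinearMap.ker ((DForm.fsmul u θ).covector p).toLinearMap =
      LinearMap.ker (θ.covector p).toLinearMap := by
    ext v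
    refine (LinearMap.mem_ker.trans ?_).trans LinearMap.mem_ker.symm
    change u p * θ.covector p v = 0 ↔ θ.covector p v = 0
    simp [hu p]
  rw [h]
  exact hθπ p

/-- The curvature of the rescaled connection form. -/
theorem d_rescaled (hπ : ContMDiff 𝓘(ℝ, E') 𝓘(ℝ, E) ∞ π) {f : M → ℝ}
    (hf : ContMDiff 𝓘(ℝ, E) 𝓘(ℝ, ℝ) ∞ f) {F : DForm E M 2} {θ : DForm E' P 1} (hθ : θ.IsSmooth)
    (hdθ : θ.d = (DForm.pullback π (DForm.differential E f)).wedge θ + DForm.pullback π F) :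
    (DForm.fsmul (fun p => Real.exp (-f (π p))) θ).d =
      DForm.pullback π (DForm.fsmul (fun x => Real.exp (-f x)) F) := by
  have hu : ContMDiff 𝓘(ℝ, E') 𝓘(ℝ, ℝ) ∞ (fun p => Real.exp (-f (π p))) :=
    (Real.contDiff_exp.comp contDiff_neg).contMDiff.comp (hf.comp hπ)
  funext p
  rw [DForm.d_fsmul_apply hu hθ, hdθ]
  refine DForm.ext_two fun v w => ?_
  -- The derivative of e^{-f} is -e^{-f} df, so its wedge with θ cancels the term e^{-f} df ∧ θ of
  -- the structure equation.
  have h1 : ∀ v : TangentSpace 𝓘(ℝ, E') p,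
      (DForm.differential E' (fun p => Real.exp (-f (π p)))).covector p v =
      -(Real.exp (-f (π p)) * (DForm.pullback π (DForm.differential E f)).covector p v) := by
    intro v
    have h2 : HasMFDerivAt 𝓘(ℝ, E') 𝓘(ℝ, ℝ) (f ∘ π) p _ :=
      (hf.mdifferentiableAt (by simp)).hasMFDerivAt.comp p
        (hπ.mdifferentiableAt (by simp)).hasMFDerivAt
    have h3 : HasDerivAt (fun s => Real.exp (-s)) (Real.exp (-f (π p)) * (-1)) (f (π p)) :=
      (hasDerivAt_id (f (π p))).neg.exp
    have h4 := HasMFDerivAt.comp (g := fun s => Real.exp (-s)) (f := f ∘ π) p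
      h3.hasFDerivAt.hasMFDerivAt h2
    have h5 := DFunLike.congr_fun h4.mfderiv v
    refine h5.trans ?_
    have h6 : ∀ a b : ℝ, a • (b * -1) = -(b * a) := fun a b => by rw [smul_eq_mul]; ring
    exact h6 (mfderiv 𝓘(ℝ, E) 𝓘(ℝ, ℝ) f (π p) (mfderiv 𝓘(ℝ, E') 𝓘(ℝ, E) π p v)) _
  change ((DForm.differential E' (fun p => Real.exp (-f (π p)))).wedge θ p) ![v, w] +
    Real.exp (-f (π p)) * (((DForm.pullback π (DForm.differential E f)).wedge θ p) ![v, w] +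
      (DForm.pullback π F p) ![v, w]) = _
  rw [DForm.wedge_apply_two, DForm.wedge_apply_two, h1, h1]
  change _ = Real.exp (-f (π p)) * (DForm.pullback π F p) ![v, w]
  ring

end Rescaling
end

noncomputable section

/-! ### Horizontal lifts of curves -/

section Transport

variable {E : Type*} [NormedAddCommGroup E] [NormedSpace ℝ E]
variable {M : Type*} [TopologicalSpace M] [ChartedSpace E M] [IsManifold 𝓘(ℝ, E) ∞ M]
variable {E' : Type*} [NormedAddCommGroup E'] [NormedSpace ℝ E']
variable {P : Type*} [TopologicalSpace P] [ChartedSpace E' P] [IsManifold 𝓘(ℝ, E') ∞ P]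

/-- A principal circle bundle with connection, described by fibre charts. -/
structure ConnectionCharts (π : P → M) (θ : DForm E' P 1) (F : DForm E M 2) where
  ch : ∀ x₀ : M, FibreChart E E' π x₀ fun _ => 2 * Real.pi
  unitSpeed : ∀ x₀, (ch x₀).UnitSpeed θ
  smooth_proj : ContMDiff 𝓘(ℝ, E') 𝓘(ℝ, E) ∞ π
  smooth_form : θ.IsSmooth
  curvature : θ.d = DForm.pullback π F

namespace ConnectionCharts

variable {π : P → M} {θ : DForm E' P 1} {F : DForm E M 2} (C : ConnectionCharts π θ F)

/-- The rotation of the fibres. -/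
def act (z : Circle) (p : P) : P := circleAction C.ch z p

theorem act_κ {x₁ : M} {y : E} (hy : y ∈ (C.ch x₁).W) (t u : ℝ) :
    C.act (Circle.exp u) ((C.ch x₁).κ (y, t)) = (C.ch x₁).κ (y, t + u) :=
  circleAction_apply C.ch C.unitSpeed (C.ch x₁) (C.unitSpeed x₁) hy t u

theorem isPrincipal : IsPrincipalCircleAction E E' π C.act :=
  isPrincipalCircleAction_circleAction C.ch C.smooth_proj C.unitSpeed

theorem act_injective {z w : Circle} {p : P} (h : C.act z p = C.act w p) : z = w := by
  obtain ⟨x₁, y, hy, t, rfl⟩ := exists_chart_coordinates C.ch p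
  obtain ⟨u, rfl⟩ := exists_exp_eq z
  obtain ⟨v, rfl⟩ := exists_exp_eq w
  rw [C.act_κ hy, C.act_κ hy, (C.ch x₁).κ_eq_iff hy, Circle.exp_add, Circle.exp_add] at h
  exact mul_left_cancel h

theorem exists_act_eq {p p' : P} (h : π p = π p') : ∃ z, p' = C.act z p := by
  obtain ⟨x₁, y, hy, t, rfl⟩ := exists_chart_coordinates C.ch p
  have hb : π p' ∈ (C.ch x₁).base := h ▸ (C.ch x₁).proj_mem_base hy t
  obtain ⟨t', ht'⟩ := (C.ch x₁).surj p' hb.1 hb.2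
  rw [← h, (C.ch x₁).chart_proj hy] at ht'
  refine ⟨Circle.exp (t' - t), ?_⟩
  rw [C.act_κ hy, ← ht', add_sub_cancel]

theorem surjective_proj (C : ConnectionCharts π θ F) : Function.Surjective π := fun x =>
  ⟨_, ((C.ch x).proj _ (C.ch x).mem_W 0).trans (extChartAt_to_inv x)⟩

/-- Rotation by e^{ig} adds g to the fibre coordinate. The form is dt plus a part independent of t,
so only the derivative of g is gained. -/
theorem pull_rotate {k : ℝ → P} {g : ℝ → ℝ} {t₀ : ℝ}
    (hk : ∀ᶠ t in 𝓝 t₀, MDifferentiableAt 𝓘(ℝ, ℝ) 𝓘(ℝ, E') k t) (hg : DifferentiableAt ℝ g t₀) :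
    MDifferentiableAt 𝓘(ℝ, ℝ) 𝓘(ℝ, E') (fun t => C.act (Circle.exp (g t)) (k t)) t₀ ∧
      θ.pull (fun t => C.act (Circle.exp (g t)) (k t)) t₀ 1 = θ.pull k t₀ 1 + deriv g t₀ := by
  obtain ⟨x₁, y, hy, s, hs⟩ := exists_chart_coordinates C.ch (k t₀)
  obtain ⟨τ, hτ0, hτ⟩ := (C.ch x₁).exists_curve_coordinates hk hy hs θ
  set fc := C.ch x₁ with hfc
  have h1 : (fun t => C.act (Circle.exp (g t)) (k t)) =ᶠ[𝓝 t₀]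
      fun t => fc.κ (extChartAt 𝓘(ℝ, E) x₁ (π (k t)), τ t + g t) := by
    filter_upwards [hτ] with t ht
    rw [← C.act_κ ht.1]
    exact congrArg (C.act _) ht.2.1.symm
  obtain ⟨hW, -, hτd, hcd, hp⟩ := hτ.self_of_nhds
  have hρ : HasDerivAt (fun t => (extChartAt 𝓘(ℝ, E) x₁ (π (k t)), τ t + g t))
      (deriv (fun t => extChartAt 𝓘(ℝ, E) x₁ (π (k t))) t₀, deriv τ t₀ + deriv g t₀) t₀ :=
    hcd.hasDerivAt.prodMk (hτd.hasDerivAt.fun_add hg.hasDerivAt)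
  have hκ := fc.mdifferentiableAt hW (τ t₀ + g t₀)
  refine ⟨?_, ?_⟩
  · refine MDifferentiableAt.congr_of_eventuallyEq ?_ h1
    exact MDifferentiableAt.comp (g := fc.κ)
      (f := fun t => (extChartAt 𝓘(ℝ, E) x₁ (π (k t)), τ t + g t)) t₀ hκ
      hρ.differentiableAt.mdifferentiableAt
  · have h2 : fderiv ℝ (fun t => (extChartAt 𝓘(ℝ, E) x₁ (π (k t)), τ t + g t)) t₀ 1 = _ := hρ.deriv
    rw [DForm.pull_congr θ h1, DForm.pull_comp θ (κ := fc.κ)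
      (ρ := fun t => (extChartAt 𝓘(ℝ, E) x₁ (π (k t)), τ t + g t)) hκ hρ.differentiableAt,
      ContinuousLinearMap.comp_apply, h2, hp,
      fc.pull_apply_connection C.smooth_proj C.smooth_form C.curvature (C.unitSpeed x₁) hW
        (τ t₀ + g t₀),
      fc.pull_apply_connection C.smooth_proj C.smooth_form C.curvature (C.unitSpeed x₁) hW
        (τ t₀)]
    ring

/-- The phase is the difference of the fibre coordinates of the two curves in a common chart. -/
theorem exists_phase {k r : ℝ → P} {t₀ : ℝ}
    (hk : ∀ᶠ t in 𝓝 t₀, MDifferentiableAt 𝓘(ℝ, ℝ) 𝓘(ℝ, E') k t)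
    (hr : ∀ᶠ t in 𝓝 t₀, MDifferentiableAt 𝓘(ℝ, ℝ) 𝓘(ℝ, E') r t)
    (h : ∀ᶠ t in 𝓝 t₀, π (k t) = π (r t)) :
    ∃ g : ℝ → ℝ, ∀ᶠ t in 𝓝 t₀, DifferentiableAt ℝ g t ∧ r t = C.act (Circle.exp (g t)) (k t) := by
  obtain ⟨x₁, y, hy, s, hs⟩ := exists_chart_coordinates C.ch (k t₀)
  have h0 : π (r t₀) = π (k t₀) := h.self_of_nhds.symm
  have hb : π (r t₀) ∈ (C.ch x₁).base := by
    rw [h0, ← hs]; exact (C.ch x₁).proj_mem_base hy s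
  obtain ⟨s', hs'⟩ := (C.ch x₁).surj (r t₀) hb.1 hb.2
  rw [h0, ← hs, (C.ch x₁).chart_proj hy] at hs'
  obtain ⟨τ, -, hτ⟩ := (C.ch x₁).exists_curve_coordinates hk hy hs θ
  obtain ⟨τ', -, hτ'⟩ := (C.ch x₁).exists_curve_coordinates hr hy hs' θ
  refine ⟨fun t => τ' t - τ t, ?_⟩
  filter_upwards [hτ, hτ', h] with t ht ht' hπt
  refine ⟨ht'.2.2.1.sub ht.2.2.1, ?_⟩
  have h1 := ht'.2.1
  rw [← hπt] at h1
  rw [← h1, ← ht.2.1, C.act_κ ht.1, ht.2.1, add_sub_cancel]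

/-- `r` is, near `t`, a horizontal lift of the curve `u`. -/
def Hor (_ : ConnectionCharts π θ F) (u : ℝ → M) (r : ℝ → P) (t : ℝ) : Prop :=
  ∀ᶠ s in 𝓝 t, π (r s) = u s ∧ MDifferentiableAt 𝓘(ℝ, ℝ) 𝓘(ℝ, E') r s ∧ θ.pull r s 1 = 0

variable {C} {u : ℝ → M}

theorem Hor.congr {r r' : ℝ → P} {t : ℝ} (h : C.Hor u r t) (hr : r =ᶠ[𝓝 t] r') :
    C.Hor u r' t := by
  filter_upwards [h, hr.eventuallyEq_nhds] with s hs hrs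
  refine ⟨?_, hs.2.1.congr_of_eventuallyEq hrs.symm, ?_⟩
  · rw [← hrs.eq_of_nhds]; exact hs.1
  · rw [← DForm.pull_congr θ hrs]; exact hs.2.2

theorem Hor.act {r : ℝ → P} {t : ℝ} (h : C.Hor u r t) (z : Circle) :
    C.Hor u (fun s => C.act z (r s)) t := by
  obtain ⟨a, rfl⟩ := exists_exp_eq z
  filter_upwards [h.eventually_nhds] with s hs
  have h1 := C.pull_rotate (g := fun _ => a) (hs.mono fun _ h => h.2.1) (differentiableAt_const a)
  refine ⟨(C.isPrincipal.proj_act _ _).trans hs.self_of_nhds.1, h1.1, ?_⟩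
  rw [h1.2, hs.self_of_nhds.2.2, deriv_const, add_zero]

/-- By `pull_rotate` the relative phase g of two lifts satisfies 0 = 0 + g'. -/
theorem Hor.eventually_eq_act {r r' : ℝ → P} {t₀ : ℝ} (h : C.Hor u r t₀) (h' : C.Hor u r' t₀) :
    ∃ w, ∀ᶠ t in 𝓝 t₀, r' t = C.act w (r t) := by
  obtain ⟨g, hg⟩ := C.exists_phase (h.mono fun _ h => h.2.1) (h'.mono fun _ h => h.2.1)
    (by filter_upwards [h, h'] with t ht ht'; rw [ht.1, ht'.1])
  have h0 : ∀ᶠ t in 𝓝 t₀, HasDerivAt g 0 t := by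
    filter_upwards [h.eventually_nhds, h', hg.eventually_nhds] with t ht ht' hgt
    have h1 := C.pull_rotate (ht.mono fun _ h => h.2.1) hgt.self_of_nhds.1
    have h2 : r' =ᶠ[𝓝 t] fun t => C.act (Circle.exp (g t)) (r t) := hgt.mono fun _ h => h.2
    rw [← DForm.pull_congr θ h2, ht'.2.2, ht.self_of_nhds.2.2, zero_add] at h1
    exact hgt.self_of_nhds.1.hasDerivAt.congr_deriv h1.2.symm
  refine ⟨Circle.exp (g t₀), ?_⟩
  filter_upwards [eventually_eq_of_hasDerivAt_zero h0, hg] with t ht hgt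
  rw [hgt.2, ht]

/-- Two horizontal lifts differ by a constant rotation. -/
theorem Hor.eq_act {r r' : ℝ → P} {a b : ℝ} (h : ∀ t ∈ Icc a b, C.Hor u r t)
    (h' : ∀ t ∈ Icc a b, C.Hor u r' t) {z : Circle} (h0 : r' a = C.act z (r a)) :
    ∀ t ∈ Icc a b, r' t = C.act z (r t) := by
  intro t ht
  have hab : a ≤ b := ht.1.trans ht.2
  -- Near each time the lifts differ by one rotation w, so the equality holds there exactly when w =
  -- z; its truth value is constant on the connected interval.
  have : IsLocallyConstant fun s : Icc a b => r' s = C.act z (r s) := by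
    rw [IsLocallyConstant.iff_eventually_eq]
    rintro ⟨t₀, ht₀⟩
    obtain ⟨w, hw⟩ := (h t₀ ht₀).eventually_eq_act (h' t₀ ht₀)
    have hw' := (Continuous.tendsto continuous_subtype_val (⟨t₀, ht₀⟩ : Icc a b)).eventually hw
    filter_upwards [hw'] with s hs
    simp only [hs, hw.self_of_nhds, eq_iff_iff]
    constructor
    · intro e; rw [C.act_injective e]
    · intro e; rw [C.act_injective e]
  have hpc : PreconnectedSpace (Icc a b) := Subtype.preconnectedSpace isPreconnected_Icc
  have e := this.apply_eq_of_preconnectedSpace ⟨t, ht⟩ ⟨a, left_mem_Icc.2 hab⟩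
  exact e.mpr h0

/-- Both curves are lifts on a full neighbourhood of b, so equality at b forces equality near b and
the concatenation has no corner there. -/
theorem Hor.glue {r ρ : ℝ → P} {a b c : ℝ} (hab : a ≤ b) (hbc : b ≤ c)
    (h : ∀ t ∈ Icc a b, C.Hor u r t) (h' : ∀ t ∈ Icc b c, C.Hor u ρ t) (hb : r b = ρ b) :
    ∃ q : ℝ → P, (∀ t ∈ Icc a c, C.Hor u q t) ∧ q a = r a ∧ q c = ρ c := by
  obtain ⟨w, hw⟩ := (h b (right_mem_Icc.2 hab)).eventually_eq_act (h' b (left_mem_Icc.2 hbc))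
  have hw1 : w = 1 := by
    have h1 := hw.self_of_nhds
    rw [← hb] at h1
    conv_lhs at h1 => rw [← C.isPrincipal.one_act (r b)]
    exact (C.act_injective h1).symm
  subst hw1
  refine ⟨fun t => if t ≤ b then r t else ρ t, ?_, by simp [hab], ?_⟩
  · intro t ht
    rcases lt_trichotomy t b with htb | rfl | htb
    · refine (h t ⟨ht.1, htb.le⟩).congr ?_
      filter_upwards [gt_mem_nhds htb] with s hs
      rw [if_pos (le_of_lt hs)]
    · refine (h t ⟨ht.1, le_rfl⟩).congr ?_
      filter_upwards [hw] with s hs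
      split_ifs
      · rfl
      · rw [hs, C.isPrincipal.one_act]
    · refine (h' t ⟨htb.le, ht.2⟩).congr ?_
      filter_upwards [lt_mem_nhds htb] with s hs
      rw [if_neg (not_le.2 hs)]
  · rcases hbc.eq_or_lt with rfl | hlt
    · simp [hb]
    · simp [not_le.2 hlt]

/-- The rotation of a section of `P` over the curve `u` that makes it horizontal. -/
theorem exists_hor_of_section {k : ℝ → P} {a₀ a b b₀ : ℝ} (ha : a₀ < a) (hab : a ≤ b)
    (hb : b < b₀) (hk : ContMDiffOn 𝓘(ℝ, ℝ) 𝓘(ℝ, E') ∞ k (Ioo a₀ b₀))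
    (hu : ∀ t ∈ Ioo a₀ b₀, π (k t) = u t) :
    ∃ r : ℝ → P, (∀ t ∈ Icc a b, C.Hor u r t) ∧ r a = k a ∧
      r b = C.act (Circle.exp (-∫ s in a..b, θ.pull k s 1)) (k b) := by
  -- The phase is the primitive of -θ(k'), the solution of the horizontality equation θ(k') + g' =
  -- 0.
  set g : ℝ → ℝ := fun t => -∫ s in a..t, θ.pull k s 1 with hg
  have hcont : ContinuousOn (fun s => θ.pull k s 1) (Ioo a₀ b₀) := fun s hs =>
    ((DForm.contDiffAt_pull C.smooth_form (hk.contMDiffAt (isOpen_Ioo.mem_nhds hs))).continuousAt.clm_apply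
      continuousAt_const).continuousWithinAt
  have hgd : ∀ t ∈ Ioo a₀ b₀, HasDerivAt g (-θ.pull k t 1) t := by
    intro t ht
    refine HasDerivAt.neg ?_
    refine intervalIntegral.integral_hasDerivAt_right ?_ ?_ ?_
    · refine (hcont.mono ?_).intervalIntegrable
      exact OrdConnected.uIcc_subset ordConnected_Ioo ⟨ha, hab.trans_lt hb⟩ ht
    · exact hcont.stronglyMeasurableAtFilter isOpen_Ioo t ht
    · exact hcont.continuousAt (isOpen_Ioo.mem_nhds ht)
  refine ⟨fun t => C.act (Circle.exp (g t)) (k t), ?_, ?_, rfl⟩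
  · intro t ht
    filter_upwards [isOpen_Ioo.mem_nhds (⟨ha.trans_le ht.1, ht.2.trans_lt hb⟩ : t ∈ Ioo a₀ b₀)]
      with s hs
    have h1 := C.pull_rotate (k := k) (t₀ := s) (by
      filter_upwards [isOpen_Ioo.mem_nhds hs] with s' hs'
      exact (hk.contMDiffAt (isOpen_Ioo.mem_nhds hs')).mdifferentiableAt (by simp))
      (hgd s hs).differentiableAt
    refine ⟨(C.isPrincipal.proj_act _ _).trans (hu s hs), h1.1, ?_⟩
    rw [h1.2, (hgd s hs).deriv, add_neg_cancel]
  · simp [hg, C.isPrincipal.one_act]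

end ConnectionCharts

end Transport
end

noncomputable section

theorem exists_Ioo_subset_of_Icc_subset {O : Set ℝ} (hO : IsOpen O) {a b : ℝ} (hab : a ≤ b)
    (h : Icc a b ⊆ O) : ∃ a₀ b₀, a₀ < a ∧ b < b₀ ∧ Ioo a₀ b₀ ⊆ O := by
  obtain ⟨l, u, hlu, h1⟩ := mem_nhds_iff_exists_Ioo_subset.1
    (hO.mem_nhds (h (left_mem_Icc.2 hab)))
  obtain ⟨l', u', hlu', h2⟩ := mem_nhds_iff_exists_Ioo_subset.1
    (hO.mem_nhds (h (right_mem_Icc.2 hab)))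
  refine ⟨l, u', hlu.1, hlu'.2, fun t ht => ?_⟩
  rcases lt_or_ge t a with h3 | h3
  · exact h1 ⟨ht.1, h3.trans hlu.2⟩
  · rcases le_or_gt t b with h4 | h4
    · exact h ⟨h3, h4⟩
    · exact h2 ⟨hlu'.1.trans h4, ht.2⟩

/-! ### Parallel transport and the holonomy of rectangles -/

section Transport

variable {E : Type*} [NormedAddCommGroup E] [NormedSpace ℝ E]
variable {M : Type*} [TopologicalSpace M] [ChartedSpace E M] [IsManifold 𝓘(ℝ, E) ∞ M]
variable {E' : Type*} [NormedAddCommGroup E'] [NormedSpace ℝ E']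
variable {P : Type*} [TopologicalSpace P] [ChartedSpace E' P] [IsManifold 𝓘(ℝ, E') ∞ P]

namespace ConnectionCharts

variable {π : P → M} {θ : DForm E' P 1} {F : DForm E M 2} (C : ConnectionCharts π θ F)

/-- A (discontinuous) section of the bundle. -/
def basePoint (x : M) : P := Function.surjInv C.surjective_proj x

theorem proj_basePoint (x : M) : π (C.basePoint x) = x := Function.surjInv_eq _ x

/-- The parallel transport along `u` from `u a` to `u b` is `z`, with respect to the base points
of the fibres. -/
def IsTransport (u : ℝ → M) (a b : ℝ) (z : Circle) : Prop :=
  ∃ r : ℝ → P, (∀ t ∈ Icc a b, C.Hor u r t) ∧ r a = C.basePoint (u a) ∧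
    r b = C.act z (C.basePoint (u b))

variable {C} {u : ℝ → M}

theorem IsTransport.unique {a b : ℝ} (hab : a ≤ b) {z w : Circle} (hz : C.IsTransport u a b z)
    (hw : C.IsTransport u a b w) : z = w := by
  obtain ⟨r, hr, hra, hrb⟩ := hz
  obtain ⟨q, hq, hqa, hqb⟩ := hw
  have h := Hor.eq_act hr hq (z := 1) (by rw [C.isPrincipal.one_act, hra, hqa]) b
    (right_mem_Icc.2 hab)
  rw [C.isPrincipal.one_act, hrb, hqb] at h
  exact (C.act_injective h).symm

/-- The second lift starts at the base point over u b; rotated by z it starts where the first one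
ends, and the two can be glued. -/
theorem IsTransport.trans {a b c : ℝ} (hab : a ≤ b) (hbc : b ≤ c) {z w : Circle}
    (hz : C.IsTransport u a b z) (hw : C.IsTransport u b c w) : C.IsTransport u a c (z * w) := by
  obtain ⟨r, hr, hra, hrb⟩ := hz
  obtain ⟨q, hq, hqb, hqc⟩ := hw
  obtain ⟨p, hp, hpa, hpc⟩ := Hor.glue hab hbc hr (fun t ht => (hq t ht).act z)
    (by rw [hrb, hqb])
  refine ⟨p, hp, hpa.trans hra, hpc.trans ?_⟩
  rw [hqc, ← C.isPrincipal.mul_act]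

/-- A smooth section gives transport as the exponential of a line integral; za and zb convert from
the section to the base points, which need not vary continuously. -/
theorem isTransport_of_section {O : Set ℝ} (hO : IsOpen O) {a b : ℝ} (hab : a ≤ b)
    (hOab : Icc a b ⊆ O) {k : ℝ → P} (hk : ContMDiffOn 𝓘(ℝ, ℝ) 𝓘(ℝ, E') ∞ k O)
    (hu : ∀ t ∈ O, π (k t) = u t) {za zb : Circle} (ha : k a = C.act za (C.basePoint (u a)))
    (hb : k b = C.act zb (C.basePoint (u b))) :
    C.IsTransport u a b (za⁻¹ * Circle.exp (-∫ s in a..b, θ.pull k s 1) * zb) := by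
  obtain ⟨a₀, b₀, ha₀, hb₀, hsub⟩ := exists_Ioo_subset_of_Icc_subset hO hab hOab
  obtain ⟨r, hr, hra, hrb⟩ := C.exists_hor_of_section ha₀ hab hb₀ (hk.mono hsub)
    (fun t ht => hu t (hsub ht))
  refine ⟨fun t => C.act za⁻¹ (r t), fun t ht => (hr t ht).act _, ?_, ?_⟩
  · change C.act za⁻¹ (r a) = _
    rw [hra, ha, ← C.isPrincipal.mul_act, inv_mul_cancel, C.isPrincipal.one_act]
  · change C.act za⁻¹ (r b) = _
    rw [hrb, hb, ← C.isPrincipal.mul_act, ← C.isPrincipal.mul_act, mul_assoc]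

theorem isTransport_const {a b : ℝ} (hab : a ≤ b) {x : M} (hu : ∀ t, u t = x) :
    C.IsTransport u a b 1 := by
  have h := isTransport_of_section (C := C) (u := u) isOpen_univ hab (subset_univ _)
    (k := fun _ => C.basePoint x) contMDiffOn_const
    (fun t _ => by rw [hu, C.proj_basePoint]) (za := 1) (zb := 1)
    (by rw [hu, C.isPrincipal.one_act]) (by rw [hu, C.isPrincipal.one_act])
  have h0 : ∀ s, θ.pull (fun _ : ℝ => C.basePoint x) s 1 = 0 := by
    intro s
    rw [DForm.pull_apply, mfderiv_const]
    exact map_zero _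
  simpa [h0] using h

variable (C)

/-- The pull-back of the curvature by a map of the plane, as a density. -/
def density (_ : ConnectionCharts π θ F) (H : ℝ × ℝ → M) (z : ℝ × ℝ) : ℝ :=
  (F (H z) : E [⋀^Fin 2]→L[ℝ] ℝ)
    ![mfderiv 𝓘(ℝ, ℝ × ℝ) 𝓘(ℝ, E) H z ((1, 0) : ℝ × ℝ),
      mfderiv 𝓘(ℝ, ℝ × ℝ) 𝓘(ℝ, E) H z ((0, 1) : ℝ × ℝ)]

variable {H : ℝ × ℝ → M}

/-- A local lift of a map of the plane. -/
theorem exists_planeLift (hH : ContMDiff 𝓘(ℝ, ℝ × ℝ) 𝓘(ℝ, E) ∞ H) (x₁ : M) :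
    ∃ K : ℝ × ℝ → P, ContMDiffOn 𝓘(ℝ, ℝ × ℝ) 𝓘(ℝ, E') ∞ K (H ⁻¹' (C.ch x₁).base) ∧
      ∀ z ∈ H ⁻¹' (C.ch x₁).base, π (K z) = H z := by
  refine ⟨fun z => (C.ch x₁).κ (extChartAt 𝓘(ℝ, E) x₁ (H z), 0), ?_, ?_⟩
  · intro z hz
    refine ContMDiffAt.contMDiffWithinAt ?_
    refine ContMDiffAt.comp (g := (C.ch x₁).κ)
      (f := fun z => (extChartAt 𝓘(ℝ, E) x₁ (H z), (0 : ℝ))) z ((C.ch x₁).contMDiffAt hz.2 0) ?_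
    have h1 : ContMDiffAt 𝓘(ℝ, ℝ × ℝ) 𝓘(ℝ, E) ∞ (fun z => extChartAt 𝓘(ℝ, E) x₁ (H z)) z :=
      ContMDiffAt.comp z (contMDiffAt_extChartAt' (by simpa using hz.1)) hH.contMDiffAt
    exact h1.prodMk_space contMDiffAt_const
  · intro z hz
    rw [(C.ch x₁).proj _ hz.2, (extChartAt 𝓘(ℝ, E) x₁).left_inv hz.1]

/-- For a lift K of H one has H^*F = K^*π^*F = K^*dθ = d(K^*θ). -/
theorem density_eq {V : Set (ℝ × ℝ)} (hV : IsOpen V)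
    {K : ℝ × ℝ → P} (hK : ContMDiffOn 𝓘(ℝ, ℝ × ℝ) 𝓘(ℝ, E') ∞ K V) (hKH : ∀ z ∈ V, π (K z) = H z)
    {z : ℝ × ℝ} (hz : z ∈ V) : C.density H z =
      fderiv ℝ (θ.pull K) z (1, 0) (0, 1) - fderiv ℝ (θ.pull K) z (0, 1) (1, 0) := by
  have hKz := hK.contMDiffAt (hV.mem_nhds hz)
  rw [← DForm.d_apply_pull C.smooth_form hKz, C.curvature, DForm.pullback_apply_two]
  have heq : (π ∘ K) =ᶠ[𝓝 z] H := by
    filter_upwards [hV.mem_nhds hz] with w hw using hKH w hw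
  have h1 := mfderiv_comp (f := K) (g := π) z (C.smooth_proj.mdifferentiableAt (by simp))
    (hKz.mdifferentiableAt (by simp))
  have h2 := heq.mfderiv_eq (I := 𝓘(ℝ, ℝ × ℝ)) (I' := 𝓘(ℝ, E))
  have h3 : ∀ v : ℝ × ℝ, (mfderiv 𝓘(ℝ, E') 𝓘(ℝ, E) π (K z)
      (mfderiv 𝓘(ℝ, ℝ × ℝ) 𝓘(ℝ, E') K z v) : E) = mfderiv 𝓘(ℝ, ℝ × ℝ) 𝓘(ℝ, E) H z v := by
    intro v
    refine (DFunLike.congr_fun h1 v).symm.trans ?_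
    exact congrArg (fun L : (ℝ × ℝ) →L[ℝ] E => L v) h2
  exact (DForm.apply_two_congr F (hKH z hz) (h3 _) (h3 _)).symm

/-- `ConnectionCharts` carries no regularity of F; continuity comes from writing the density locally
as the exterior derivative of the smooth form K^*θ. -/
theorem continuous_density (hH : ContMDiff 𝓘(ℝ, ℝ × ℝ) 𝓘(ℝ, E) ∞ H) :
    Continuous (C.density H) := by
  rw [continuous_iff_continuousAt]
  intro z
  obtain ⟨K, hK, hKH⟩ := C.exists_planeLift hH (H z)
  have hV : IsOpen (H ⁻¹' (C.ch (H z)).base) := (C.ch (H z)).isOpen_base.preimage hH.continuous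
  have hz : z ∈ H ⁻¹' (C.ch (H z)).base := (C.ch (H z)).mem_base
  have h1 : ContDiffAt ℝ ∞ (θ.pull K) z :=
    DForm.contDiffAt_pull C.smooth_form (hK.contMDiffAt (hV.mem_nhds hz))
  have h2 : ContinuousAt (fderiv ℝ (θ.pull K)) z :=
    (h1.fderiv_right (m := ∞) (by simp)).continuousAt
  have h3 : ContinuousAt (fun z => fderiv ℝ (θ.pull K) z (1, 0) (0, 1) -
      fderiv ℝ (θ.pull K) z (0, 1) (1, 0)) z :=
    ((h2.clm_apply continuousAt_const).clm_apply continuousAt_const).sub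
      ((h2.clm_apply continuousAt_const).clm_apply continuousAt_const)
  refine h3.congr ?_
  filter_upwards [hV.mem_nhds hz] with w hw using (C.density_eq hV hK hKH hw).symm

/-- The parallel transport around a rectangle is given by the integral of the curvature. -/
def HolonomyFormula (H : ℝ × ℝ → M) (a a' b b' : ℝ) : Prop :=
  ∃ zB zR zL zT : Circle, C.IsTransport (fun t => H (t, b)) a a' zB ∧
    C.IsTransport (fun t => H (a', t)) b b' zR ∧ C.IsTransport (fun t => H (a, t)) b b' zL ∧
    C.IsTransport (fun t => H (t, b')) a a' zT ∧
    zB * zR = Circle.exp (-∫ x in a..a', ∫ y in b..b', C.density H (x, y)) * zL * zT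

/-- Over one chart a lift K of H exists, the four transports are exponentials of line integrals of
K^*θ, and the claim is Green's theorem. -/
theorem holonomyFormula_of_subset (hH : ContMDiff 𝓘(ℝ, ℝ × ℝ) 𝓘(ℝ, E) ∞ H) {a a' b b' : ℝ}
    (ha : a ≤ a') (hb : b ≤ b') {x₁ : M} (hsub : Icc a a' ×ˢ Icc b b' ⊆ H ⁻¹' (C.ch x₁).base) :
    C.HolonomyFormula H a a' b b' := by
  obtain ⟨K, hK, hKH⟩ := C.exists_planeLift hH x₁
  set V := H ⁻¹' (C.ch x₁).base with hVdef
  have hV : IsOpen V := (C.ch x₁).isOpen_base.preimage hH.continuous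
  have hphase : ∀ z, ∃ w, z ∈ V → K z = C.act w (C.basePoint (H z)) := by
    intro z
    by_cases hz : z ∈ V
    · obtain ⟨w, hw⟩ := C.exists_act_eq (p := C.basePoint (H z)) (p' := K z)
        (by rw [C.proj_basePoint, hKH z hz])
      exact ⟨w, fun _ => hw⟩
    · exact ⟨1, fun h => absurd h hz⟩
  choose ζ hζ using hphase
  set B := θ.pull K with hB
  have hBs : ContDiffOn ℝ ∞ B V := fun z hz =>
    (DForm.contDiffAt_pull C.smooth_form (hK.contMDiffAt (hV.mem_nhds hz))).contDiffWithinAt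
  have hhor : ∀ y ∈ Icc b b', C.IsTransport (fun t => H (t, y)) a a'
      ((ζ (a, y))⁻¹ * Circle.exp (-∫ s in a..a', B (s, y) (1, 0)) * ζ (a', y)) := by
    intro y hy
    have hO : IsOpen ((fun t : ℝ => (t, y)) ⁻¹' V) := hV.preimage (by fun_prop)
    have hsubO : Icc a a' ⊆ (fun t : ℝ => (t, y)) ⁻¹' V := fun t ht => hsub ⟨ht, hy⟩
    have h1 := isTransport_of_section (C := C) (u := fun t => H (t, y)) hO ha hsubO
      (k := fun t => K (t, y))
      (hK.comp (f := fun t : ℝ => (t, y)) (ContDiff.contMDiff (by fun_prop)).contMDiffOn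
        fun t ht => ht)
      (fun t ht => hKH _ ht) (hζ (a, y) (hsub ⟨left_mem_Icc.2 ha, hy⟩))
      (hζ (a', y) (hsub ⟨right_mem_Icc.2 ha, hy⟩))
    convert h1 using 5
    refine intervalIntegral.integral_congr fun s hs => ?_
    rw [uIcc_of_le ha] at hs
    have h2 : HasDerivAt (fun t : ℝ => (t, y)) ((1, 0) : ℝ × ℝ) s :=
      (hasDerivAt_id s).prodMk (hasDerivAt_const s y)
    have h3 : fderiv ℝ (fun t : ℝ => (t, y)) s 1 = ((1, 0) : ℝ × ℝ) := h2.deriv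
    have h4 := DForm.pull_comp θ (κ := K) (ρ := fun t : ℝ => (t, y)) (z := s)
      ((hK.contMDiffAt (hV.mem_nhds (hsubO hs))).mdifferentiableAt (by simp)) h2.differentiableAt
    simp only [h4, ContinuousLinearMap.comp_apply, h3, hB]
  have hver : ∀ x ∈ Icc a a', C.IsTransport (fun t => H (x, t)) b b'
      ((ζ (x, b))⁻¹ * Circle.exp (-∫ s in b..b', B (x, s) (0, 1)) * ζ (x, b')) := by
    intro x hx
    have hO : IsOpen ((fun t : ℝ => (x, t)) ⁻¹' V) := hV.preimage (by fun_prop)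
    have hsubO : Icc b b' ⊆ (fun t : ℝ => (x, t)) ⁻¹' V := fun t ht => hsub ⟨hx, ht⟩
    have h1 := isTransport_of_section (C := C) (u := fun t => H (x, t)) hO hb hsubO
      (k := fun t => K (x, t))
      (hK.comp (f := fun t : ℝ => (x, t)) (ContDiff.contMDiff (by fun_prop)).contMDiffOn
        fun t ht => ht)
      (fun t ht => hKH _ ht) (hζ (x, b) (hsub ⟨hx, left_mem_Icc.2 hb⟩))
      (hζ (x, b') (hsub ⟨hx, right_mem_Icc.2 hb⟩))
    convert h1 using 5
    refine intervalIntegral.integral_congr fun s hs => ?_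
    rw [uIcc_of_le hb] at hs
    have h2 : HasDerivAt (fun t : ℝ => (x, t)) ((0, 1) : ℝ × ℝ) s :=
      (hasDerivAt_const s x).prodMk (hasDerivAt_id s)
    have h3 : fderiv ℝ (fun t : ℝ => (x, t)) s 1 = ((0, 1) : ℝ × ℝ) := h2.deriv
    have h4 := DForm.pull_comp θ (κ := K) (ρ := fun t : ℝ => (x, t)) (z := s)
      ((hK.contMDiffAt (hV.mem_nhds (hsubO hs))).mdifferentiableAt (by simp)) h2.differentiableAt
    simp only [h4, ContinuousLinearMap.comp_apply, h3, hB]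
  refine ⟨_, _, _, _, hhor b (left_mem_Icc.2 hb), hver a' (right_mem_Icc.2 ha),
    hver a (left_mem_Icc.2 ha), hhor b' (right_mem_Icc.2 hb), ?_⟩
  have hBd : ∀ z ∈ V, HasFDerivAt B (fderiv ℝ B z) z := fun z hz =>
    ((hBs.contDiffAt (hV.mem_nhds hz)).differentiableAt (by simp)).hasFDerivAt
  have hrect : uIcc a a' ×ˢ uIcc b b' ⊆ V := by rwa [uIcc_of_le ha, uIcc_of_le hb]
  have hIoo : ∀ z ∈ Ioo (min a a') (max a a') ×ˢ Ioo (min b b') (max b b'), z ∈ V := by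
    rintro z ⟨hz1, hz2⟩
    rw [min_eq_left ha, max_eq_right ha] at hz1
    rw [min_eq_left hb, max_eq_right hb] at hz2
    exact hsub ⟨Ioo_subset_Icc_self hz1, Ioo_subset_Icc_self hz2⟩
  have hf : ∀ v : ℝ × ℝ, ∀ z ∈ V, HasFDerivAt (fun z => B z v)
      ((ContinuousLinearMap.apply ℝ ℝ v).comp (fderiv ℝ B z)) z := fun v z hz =>
    (ContinuousLinearMap.apply ℝ ℝ v).hasFDerivAt.comp z (hBd z hz)
  have hdens : ∀ z ∈ V, C.density H z = ((ContinuousLinearMap.apply ℝ ℝ ((0, 1) : ℝ × ℝ)).comp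
      (fderiv ℝ B z)) (1, 0) + (-((ContinuousLinearMap.apply ℝ ℝ ((1, 0) : ℝ × ℝ)).comp
      (fderiv ℝ B z))) (0, 1) := by
    intro z hz
    rw [C.density_eq hV hK hKH hz]
    rfl
  -- Green's theorem in divergence form: with B = K^*θ, the field (B(0,1), -B(1,0)) has the
  -- curvature density as divergence.
  have hstokes := MeasureTheory.integral2_divergence_prod_of_hasFDerivAt
    (fun z => B z (0, 1)) (fun z => -B z (1, 0))
    (fun z => (ContinuousLinearMap.apply ℝ ℝ ((0, 1) : ℝ × ℝ)).comp (fderiv ℝ B z))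
    (fun z => -((ContinuousLinearMap.apply ℝ ℝ ((1, 0) : ℝ × ℝ)).comp (fderiv ℝ B z)))
    a b a' b' (fun z hz => (hf _ z (hrect hz)).continuousAt.continuousWithinAt)
    (fun z hz => (hf _ z (hrect hz)).neg.continuousAt.continuousWithinAt)
    (fun z hz => hf _ z (hIoo z hz)) (fun z hz => (hf _ z (hIoo z hz)).neg) ?_
  · have hint : (∫ x in a..a', ∫ y in b..b', C.density H (x, y)) =
        ∫ x in a..a', ∫ y in b..b', ((ContinuousLinearMap.apply ℝ ℝ ((0, 1) : ℝ × ℝ)).comp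
      (fderiv ℝ B (x, y))) (1, 0) + (-((ContinuousLinearMap.apply ℝ ℝ ((1, 0) : ℝ × ℝ)).comp
      (fderiv ℝ B (x, y)))) (0, 1) := by
      refine intervalIntegral.integral_congr fun x hx => ?_
      refine intervalIntegral.integral_congr fun y hy => ?_
      exact hdens (x, y) (hrect ⟨hx, hy⟩)
    rw [hint, hstokes]
    simp only [intervalIntegral.integral_neg]
    -- Here x, y, z, w are the phases of the lift at the four corners, counterclockwise. The
    -- intermediate corners y and w cancel, one on each side.
    have e : ∀ (p q r s : ℝ) (x y z w : Circle),
        x⁻¹ * Circle.exp (-p) * y * (y⁻¹ * Circle.exp (-q) * z) =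
        Circle.exp (-(-r - -p + q - s)) * (x⁻¹ * Circle.exp (-s) * w) *
        (w⁻¹ * Circle.exp (-r) * z) := by
      intro p q r s x y z w
      have h1 : Circle.exp (-(-r - -p + q - s)) * Circle.exp (-s) * Circle.exp (-r) =
          Circle.exp (-p) * Circle.exp (-q) := by
        simp only [← Circle.exp_add]; congr 1; ring
      calc _ = x⁻¹ * z * (Circle.exp (-p) * Circle.exp (-q)) * (y * y⁻¹) := by
            simp only [mul_comm, mul_left_comm, mul_assoc]
        _ = x⁻¹ * z * (Circle.exp (-(-r - -p + q - s)) * Circle.exp (-s) * Circle.exp (-r)) *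
            (w * w⁻¹) := by rw [h1, mul_inv_cancel, mul_inv_cancel]
        _ = _ := by simp only [mul_comm, mul_left_comm, mul_assoc]
    exact e _ _ _ _ _ _ _ _
  · have h1 : ContinuousOn (C.density H) (uIcc a a' ×ˢ uIcc b b') :=
      (C.continuous_density hH).continuousOn
    refine ((h1.congr fun z hz => (hdens z (hrect hz)).symm).integrableOn_compact ?_)
    exact isCompact_uIcc.prod isCompact_uIcc

variable {C}

/-- By uniqueness the transport along the common side is the same in both formulas and drops out,
while the integrals add. -/
theorem HolonomyFormula.trans_left (hH : ContMDiff 𝓘(ℝ, ℝ × ℝ) 𝓘(ℝ, E) ∞ H) {a a' a'' b b' : ℝ}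
    (ha : a ≤ a') (ha' : a' ≤ a'') (hb : b ≤ b') (h : C.HolonomyFormula H a a' b b')
    (h' : C.HolonomyFormula H a' a'' b b') : C.HolonomyFormula H a a'' b b' := by
  obtain ⟨zB, zR, zL, zT, hB, hR, hL, hT, hz⟩ := h
  obtain ⟨wB, wR, wL, wT, hB', hR', hL', hT', hw⟩ := h'
  obtain rfl := hR.unique hb hL'
  refine ⟨_, _, _, _, hB.trans ha ha' hB', hR', hL, hT.trans ha ha' hT', ?_⟩
  have hc : Continuous fun x => ∫ y in b..b', C.density H (x, y) :=
    intervalIntegral.continuous_parametric_intervalIntegral_of_continuous'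
      (f := fun x y => C.density H (x, y)) (C.continuous_density hH) b b'
  rw [← intervalIntegral.integral_add_adjacent_intervals (hc.intervalIntegrable a a')
    (hc.intervalIntegrable a' a''), neg_add, Circle.exp_add, mul_assoc, hw]
  rw [show zB * (Circle.exp (-∫ x in a'..a'', ∫ y in b..b', C.density H (x, y)) * zR * wT) =
    zB * zR * (Circle.exp (-∫ x in a'..a'', ∫ y in b..b', C.density H (x, y)) * wT) by
      simp only [mul_comm, mul_left_comm, mul_assoc], hz]
  simp only [mul_comm, mul_left_comm, mul_assoc]

theorem HolonomyFormula.trans_right (hH : ContMDiff 𝓘(ℝ, ℝ × ℝ) 𝓘(ℝ, E) ∞ H) {a a' b b' b'' : ℝ}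
    (ha : a ≤ a') (hb : b ≤ b') (hb' : b' ≤ b'') (h : C.HolonomyFormula H a a' b b')
    (h' : C.HolonomyFormula H a a' b' b'') : C.HolonomyFormula H a a' b b'' := by
  obtain ⟨zB, zR, zL, zT, hB, hR, hL, hT, hz⟩ := h
  obtain ⟨wB, wR, wL, wT, hB', hR', hL', hT', hw⟩ := h'
  obtain rfl := hT.unique ha hB'
  refine ⟨_, _, _, _, hB, hR.trans hb hb' hR', hL.trans hb hb' hL', hT', ?_⟩
  have hd := C.continuous_density hH
  have hadd : ∀ x, ∫ y in b..b'', C.density H (x, y) =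
      (∫ y in b..b', C.density H (x, y)) + ∫ y in b'..b'', C.density H (x, y) := fun x =>
    (intervalIntegral.integral_add_adjacent_intervals
      ((hd.comp (by fun_prop)).intervalIntegrable b b')
      ((hd.comp (by fun_prop)).intervalIntegrable b' b'')).symm
  have hc : ∀ b b', Continuous fun x => ∫ y in b..b', C.density H (x, y) := fun b b' =>
    intervalIntegral.continuous_parametric_intervalIntegral_of_continuous'
      (f := fun x y => C.density H (x, y)) hd b b'
  simp only [hadd]
  rw [intervalIntegral.integral_add ((hc _ _).intervalIntegrable _ _)
    ((hc _ _).intervalIntegrable _ _), neg_add, Circle.exp_add, ← mul_assoc, hz,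
    mul_assoc (Circle.exp (-∫ x in a..a', ∫ y in b..b', C.density H (x, y)) * zL) zT wR, hw]
  simp only [mul_comm, mul_left_comm, mul_assoc]

variable (C)

/-- By compactness a fine grid has every cell mapped into a single chart; cells are joined into
rows, and rows into the square. -/
theorem holonomyFormula_unitSquare (hH : ContMDiff 𝓘(ℝ, ℝ × ℝ) 𝓘(ℝ, E) ∞ H) :
    C.HolonomyFormula H 0 1 0 1 := by
  have hcont : Continuous fun z : unitInterval × unitInterval => H ((z.1 : ℝ), (z.2 : ℝ)) :=
    hH.continuous.comp (by fun_prop)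
  obtain ⟨t, ht0, hmono, ⟨m, hm⟩, hcov⟩ :=
    exists_monotone_Icc_subset_open_cover_unitInterval_prod_self
    (c := fun x : M => (fun z : unitInterval × unitInterval => H ((z.1 : ℝ), (z.2 : ℝ))) ⁻¹'
      (C.ch x).base)
    (fun x => (C.ch x).isOpen_base.preimage hcont)
    (fun z _ => mem_iUnion.2 ⟨H ((z.1 : ℝ), (z.2 : ℝ)), (C.ch _).mem_base⟩)
  have hle : ∀ {i j : ℕ}, i ≤ j → (t i : ℝ) ≤ t j := fun h => hmono h
  have hcell : ∀ i j : ℕ, C.HolonomyFormula H (t i) (t (i + 1)) (t j) (t (j + 1)) := by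
    intro i j
    obtain ⟨x, hx⟩ := hcov i j
    refine C.holonomyFormula_of_subset hH (hle i.le_succ) (hle j.le_succ) (x₁ := x) ?_
    rintro ⟨p, q⟩ ⟨hp, hq⟩
    have hp' : p ∈ Icc (0 : ℝ) 1 := ⟨(t i).2.1.trans hp.1, hp.2.trans (t (i + 1)).2.2⟩
    have hq' : q ∈ Icc (0 : ℝ) 1 := ⟨(t j).2.1.trans hq.1, hq.2.trans (t (j + 1)).2.2⟩
    exact hx (show ((⟨p, hp'⟩, ⟨q, hq'⟩) : unitInterval × unitInterval) ∈ _ from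
      ⟨⟨hp.1, hp.2⟩, ⟨hq.1, hq.2⟩⟩)
  have hrow : ∀ j i : ℕ, C.HolonomyFormula H (t 0) (t (i + 1)) (t j) (t (j + 1)) := by
    intro j i
    induction i with
    | zero => exact hcell 0 j
    | succ i ih =>
      exact ih.trans_left hH (hle (Nat.zero_le _)) (hle (i + 1).le_succ)
        (hle j.le_succ) (hcell (i + 1) j)
  have hall : ∀ j : ℕ, C.HolonomyFormula H (t 0) (t (m + 1)) (t 0) (t (j + 1)) := by
    intro j
    induction j with
    | zero => exact hrow 0 m
    | succ j ih =>
      exact ih.trans_right hH (hle (Nat.zero_le _)) (hle (Nat.zero_le _))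
        (hle (j + 1).le_succ) (hrow (j + 1) m)
  have h := hall m
  -- The subdivision is constantly 1 from index m on, so the index m + 1 reached by the induction is
  -- also the right end.
  rw [ht0, hm (m + 1) m.le_succ] at h
  exact h

end ConnectionCharts

end Transport
end

noncomputable section

/-! ### Parametrising the triangle by the square -/

section Triangle

/-- A smooth reparametrisation of the unit interval, stationary at its ends. -/
def smoothStep (t : ℝ) : ℝ := (1 - Real.cos (Real.pi * t)) / 2

theorem contDiff_smoothStep : ContDiff ℝ ∞ smoothStep := by
  unfold smoothStep
  fun_prop

theorem smoothStep_mem (t : ℝ) : smoothStep t ∈ Icc (0 : ℝ) 1 := by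
  unfold smoothStep
  constructor <;> linarith [Real.neg_one_le_cos (Real.pi * t), Real.cos_le_one (Real.pi * t)]

@[simp] theorem smoothStep_zero : smoothStep 0 = 0 := by simp [smoothStep]

@[simp] theorem smoothStep_one : smoothStep 1 = 1 := by simp [smoothStep]

theorem hasDerivAt_smoothStep (t : ℝ) :
    HasDerivAt smoothStep (Real.pi * Real.sin (Real.pi * t) / 2) t := by
  have h := (((hasDerivAt_id t).const_mul Real.pi).cos.const_sub 1).div_const 2
  refine h.congr_deriv ?_
  simp; ring

theorem smoothStep_deriv_pos {t : ℝ} (ht : t ∈ Ioo (0 : ℝ) 1) :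
    0 < Real.pi * Real.sin (Real.pi * t) / 2 := by
  have h : 0 < Real.sin (Real.pi * t) := Real.sin_pos_of_pos_of_lt_pi
    (mul_pos Real.pi_pos ht.1) (by nlinarith [Real.pi_pos, ht.2])
  positivity

theorem strictMonoOn_smoothStep : StrictMonoOn smoothStep (Icc 0 1) := by
  refine strictMonoOn_of_deriv_pos (convex_Icc 0 1) contDiff_smoothStep.continuous.continuousOn ?_
  intro t ht
  rw [interior_Icc] at ht
  rw [(hasDerivAt_smoothStep t).deriv]
  exact smoothStep_deriv_pos ht

theorem smoothStep_mem_Ioo {t : ℝ} (ht : t ∈ Ioo (0 : ℝ) 1) : smoothStep t ∈ Ioo (0 : ℝ) 1 := by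
  have h0 := strictMonoOn_smoothStep (left_mem_Icc.2 zero_le_one) (Ioo_subset_Icc_self ht) ht.1
  have h1 := strictMonoOn_smoothStep (Ioo_subset_Icc_self ht) (right_mem_Icc.2 zero_le_one) ht.2
  rw [smoothStep_zero] at h0
  rw [smoothStep_one] at h1
  exact ⟨h0, h1⟩

theorem exists_smoothStep_eq {s : ℝ} (hs : s ∈ Ioo (0 : ℝ) 1) :
    ∃ t ∈ Ioo (0 : ℝ) 1, smoothStep t = s := by
  have h := intermediate_value_Ioo zero_le_one
    (contDiff_smoothStep.continuous.continuousOn (s := Icc (0 : ℝ) 1))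
  rw [smoothStep_zero, smoothStep_one] at h
  exact h hs

/-- A smooth parametrisation of the standard triangle by the unit square. -/
def triangleMap (z : ℝ × ℝ) : ℝ × ℝ :=
  (smoothStep z.1 * (1 - smoothStep z.2), smoothStep z.1 * smoothStep z.2)

theorem contDiff_triangleMap : ContDiff ℝ ∞ triangleMap := by
  have h1 : ContDiff ℝ ∞ fun z : ℝ × ℝ => smoothStep z.1 := contDiff_smoothStep.comp contDiff_fst
  have h2 : ContDiff ℝ ∞ fun z : ℝ × ℝ => smoothStep z.2 := contDiff_smoothStep.comp contDiff_snd
  exact (h1.mul (contDiff_const.sub h2)).prodMk (h1.mul h2)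

/-- This holds on the whole plane, so a simplex smooth only on the closed triangle becomes, after
composition, a smooth map of the plane. -/
theorem triangleMap_mem (z : ℝ × ℝ) : triangleMap z ∈ stdTriangle := by
  obtain ⟨h1, h2⟩ := smoothStep_mem z.1
  obtain ⟨h3, h4⟩ := smoothStep_mem z.2
  refine ⟨mul_nonneg h1 (by linarith), mul_nonneg h1 h3, ?_⟩
  simp only [triangleMap]
  linarith

theorem interior_stdTriangle :
    interior stdTriangle = {p : ℝ × ℝ | 0 < p.1 ∧ 0 < p.2 ∧ p.1 + p.2 < 1} := by
  have h1 : stdTriangle = Prod.fst ⁻¹' Ici (0 : ℝ) ∩ (Prod.snd ⁻¹' Ici (0 : ℝ) ∩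
      (ContinuousLinearMap.fst ℝ ℝ ℝ + ContinuousLinearMap.snd ℝ ℝ ℝ) ⁻¹' Iic (1 : ℝ)) := rfl
  have h2 : IsOpenMap (ContinuousLinearMap.fst ℝ ℝ ℝ + ContinuousLinearMap.snd ℝ ℝ ℝ) :=
    ContinuousLinearMap.isOpenMap _ fun y => ⟨(y, 0), by simp⟩
  rw [h1, interior_inter, interior_inter,
    ← isOpenMap_fst.preimage_interior_eq_interior_preimage continuous_fst,
    ← isOpenMap_snd.preimage_interior_eq_interior_preimage continuous_snd,
    ← h2.preimage_interior_eq_interior_preimage (ContinuousLinearMap.continuous _),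
    interior_Ici, interior_Iic]
  rfl

theorem convex_stdTriangle : Convex ℝ stdTriangle := by
  rintro ⟨a, b⟩ ⟨ha, hb, hab⟩ ⟨c, d⟩ ⟨hc, hd, hcd⟩ s t hs ht hst
  simp only [stdTriangle, mem_ofPred_eq, Prod.fst_add, Prod.smul_fst, Prod.snd_add, Prod.smul_snd,
    smul_eq_mul] at *
  refine ⟨by positivity, by positivity, ?_⟩
  nlinarith

theorem triangleMap_image :
    triangleMap '' (Ioo (0 : ℝ) 1 ×ˢ Ioo (0 : ℝ) 1) = interior stdTriangle := by
  rw [interior_stdTriangle]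
  ext ⟨p, q⟩
  constructor
  · rintro ⟨⟨x, y⟩, ⟨hx, hy⟩, h⟩
    obtain ⟨h1, h2⟩ := smoothStep_mem_Ioo hx
    obtain ⟨h3, h4⟩ := smoothStep_mem_Ioo hy
    rw [← h]
    refine ⟨mul_pos h1 (by linarith), mul_pos h1 h3, ?_⟩
    simp only [triangleMap]
    linarith
  · rintro ⟨hp, hq, hpq⟩
    simp only at hp hq hpq
    -- The coordinates of `triangleMap` sum to the first step value, and their ratio determines the
    -- second.
    obtain ⟨x, hx, hxs⟩ := exists_smoothStep_eq (s := p + q) ⟨by linarith, hpq⟩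
    obtain ⟨y, hy, hys⟩ := exists_smoothStep_eq (s := q / (p + q))
      ⟨by positivity, by rw [div_lt_one (by linarith)]; linarith⟩
    refine ⟨(x, y), ⟨hx, hy⟩, ?_⟩
    have h0 : p + q ≠ 0 := by linarith
    simp only [triangleMap, hxs, hys]
    ext
    · simp only; field_simp; ring
    · simp only; field_simp

theorem injOn_triangleMap : InjOn triangleMap (Ioo (0 : ℝ) 1 ×ˢ Ioo (0 : ℝ) 1) := by
  rintro ⟨x, y⟩ ⟨hx, hy⟩ ⟨x', y'⟩ ⟨hx', hy'⟩ h
  have h1 := (Prod.ext_iff.1 h).1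
  have h2 := (Prod.ext_iff.1 h).2
  simp only [triangleMap] at h1 h2 hx hy hx' hy'
  have h3 : smoothStep x = smoothStep x' := by linarith
  have h4 : smoothStep y = smoothStep y' := by
    rw [h3] at h2
    exact mul_left_cancel₀ (smoothStep_mem_Ioo hx').1.ne' h2
  have hinj := strictMonoOn_smoothStep.injOn
  exact Prod.ext (hinj (Ioo_subset_Icc_self hx) (Ioo_subset_Icc_self hx') h3)
    (hinj (Ioo_subset_Icc_self hy) (Ioo_subset_Icc_self hy') h4)

theorem det_eq_of_basis (L : ℝ × ℝ →L[ℝ] ℝ × ℝ) :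
    L.det = (L (1, 0)).1 * (L (0, 1)).2 - (L (0, 1)).1 * (L (1, 0)).2 := by
  rw [ContinuousLinearMap.det, ← LinearMap.det_toMatrix (Module.Basis.finTwoProd ℝ),
    Matrix.det_fin_two]
  simp [LinearMap.toMatrix_apply]

/-- With s = `smoothStep` the determinant is s'(x) s'(y) s(x). Positivity means that orientation,
hence the sign of the integral, is kept. -/
theorem det_fderiv_triangleMap_pos {z : ℝ × ℝ} (hz : z ∈ Ioo (0 : ℝ) 1 ×ˢ Ioo (0 : ℝ) 1) :
    0 < (fderiv ℝ triangleMap z).det := by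
  obtain ⟨x, y⟩ := z
  obtain ⟨hx, hy⟩ := hz
  have hd : HasFDerivAt triangleMap (fderiv ℝ triangleMap (x, y)) (x, y) :=
    (contDiff_triangleMap.differentiable (by simp) _).hasFDerivAt
  have h1 : HasDerivAt (fun t : ℝ => (t, y)) ((1, 0) : ℝ × ℝ) x :=
    (hasDerivAt_id x).prodMk (hasDerivAt_const x y)
  have h2 : HasDerivAt (fun t : ℝ => (x, t)) ((0, 1) : ℝ × ℝ) y :=
    (hasDerivAt_const y x).prodMk (hasDerivAt_id y)
  have e1 := (hd.comp_hasDerivAt x h1).unique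
    (((hasDerivAt_smoothStep x).mul_const (1 - smoothStep y)).prodMk
      ((hasDerivAt_smoothStep x).mul_const (smoothStep y)))
  have e2 := (hd.comp_hasDerivAt y h2).unique
    ((((hasDerivAt_smoothStep y).const_sub 1).const_mul (smoothStep x)).prodMk
      ((hasDerivAt_smoothStep y).const_mul (smoothStep x)))
  rw [det_eq_of_basis, e1, e2]
  have h3 := smoothStep_deriv_pos hx
  have h4 := smoothStep_deriv_pos hy
  have h5 := (smoothStep_mem_Ioo hx).1
  have := mul_pos (mul_pos h3 h4) h5
  simp only
  ring_nf at this ⊢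
  exact this

/-- Change of variables on the open square; the boundary of the triangle is null because the
triangle is convex. -/
theorem integral_stdTriangle (g : ℝ × ℝ → ℝ) :
    ∫ p in stdTriangle, g p = ∫ z in Ioo (0 : ℝ) 1 ×ˢ Ioo (0 : ℝ) 1,
      (fderiv ℝ triangleMap z).det * g (triangleMap z) := by
  have h1 : (stdTriangle : Set (ℝ × ℝ)) =ᵐ[MeasureTheory.volume] interior stdTriangle :=
    (interior_ae_eq_of_null_frontier (convex_stdTriangle.addHaar_frontier _)).symm
  have hm : MeasurableSet (Ioo (0 : ℝ) 1 ×ˢ Ioo (0 : ℝ) 1) := measurableSet_Ioo.prod measurableSet_Ioo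
  rw [MeasureTheory.setIntegral_congr_set h1, ← triangleMap_image,
    MeasureTheory.integral_image_eq_integral_abs_det_fderiv_smul MeasureTheory.volume hm
      (fun z _ => (contDiff_triangleMap.differentiable (by simp) z).hasFDerivAt.hasFDerivWithinAt)
      injOn_triangleMap]
  refine MeasureTheory.setIntegral_congr_fun hm fun z hz => ?_
  simp only [abs_of_pos (det_fderiv_triangleMap_pos hz), smul_eq_mul]

theorem ContinuousAlternatingMap.apply_linearMap_two {E : Type*} [NormedAddCommGroup E]
    [NormedSpace ℝ E] (α : E [⋀^Fin 2]→L[ℝ] ℝ) (D : ℝ × ℝ →L[ℝ] E) (L : ℝ × ℝ →L[ℝ] ℝ × ℝ) :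
    α ![D (L (1, 0)), D (L (0, 1))] = L.det * α ![D (1, 0), D (0, 1)] := by
  have hlin : ∀ p : ℝ × ℝ, D p = p.1 • D (1, 0) + p.2 • D (0, 1) := by
    intro p
    rw [← map_smul, ← map_smul, ← map_add]
    congr 1; ext <;> simp
  have hself : ∀ v, α ![v, v] = 0 := fun v =>
    α.map_eq_zero_of_eq ![v, v] (i := 0) (j := 1) rfl (by simp)
  have hswap : ∀ v w, α ![v, w] = -α ![w, v] := by
    intro v w
    have h := α.map_swap ![w, v] (i := 0) (j := 1) (by simp)
    refine Eq.trans (congrArg α ?_) h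
    ext i; fin_cases i <;> rfl
  have hleft : ∀ (a b : ℝ) (v v' w : E), α ![a • v + b • v', w] = a * α ![v, w] + b * α ![v', w] := by
    intro a b v v' w
    have h1 := α.vecCons_add ![w] (a • v) (b • v')
    have h2 := α.vecCons_smul ![w] a v
    have h3 := α.vecCons_smul ![w] b v'
    rw [h1, h2, h3]; rfl
  have hright : ∀ (a b : ℝ) (v v' w : E), α ![w, a • v + b • v'] = a * α ![w, v] + b * α ![w, v'] := by
    intro a b v v' w
    rw [hswap, hleft, hswap v, hswap v']; ring
  rw [hlin (L (1, 0)), hlin (L (0, 1)), hleft, hright, hright, hself, hself,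
    hswap (D (0, 1)) (D (1, 0)), det_eq_of_basis]
  ring

end Triangle

/-! ### Holonomy of chains and integrality of periods -/

section Periods

variable {E : Type*} [NormedAddCommGroup E] [NormedSpace ℝ E]
variable {M : Type*} [TopologicalSpace M] [ChartedSpace E M] [IsManifold 𝓘(ℝ, E) ∞ M]
variable {E' : Type*} [NormedAddCommGroup E'] [NormedSpace ℝ E']
variable {P : Type*} [TopologicalSpace P] [ChartedSpace E' P] [IsManifold 𝓘(ℝ, E') ∞ P]

namespace ConnectionCharts

variable {π : P → M} {θ : DForm E' P 1} {F : DForm E M 2} (C : ConnectionCharts π θ F)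

/-- The Jacobian from the change of variables is the determinant by which a two-form on the plane is
multiplied under the linear map. In the interior the derivative within the triangle is the full
derivative. -/
theorem integralTriangle_eq {σ : ℝ × ℝ → M}
    (hσ : ContMDiffOn 𝓘(ℝ, ℝ × ℝ) 𝓘(ℝ, E) ∞ σ stdTriangle) :
    F.integralTriangle σ =
      ∫ x in (0 : ℝ)..1, ∫ y in (0 : ℝ)..1, C.density (fun z => σ (triangleMap z)) (x, y) := by
  have hH : ContMDiff 𝓘(ℝ, ℝ × ℝ) 𝓘(ℝ, E) ∞ fun z => σ (triangleMap z) :=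
    hσ.comp_contMDiff contDiff_triangleMap.contMDiff triangleMap_mem
  have hm : MeasurableSet (Ioo (0 : ℝ) 1 ×ˢ Ioo (0 : ℝ) 1) := measurableSet_Ioo.prod measurableSet_Ioo
  have h1 : F.integralTriangle σ = ∫ z in Ioo (0 : ℝ) 1 ×ˢ Ioo (0 : ℝ) 1,
      C.density (fun z => σ (triangleMap z)) z := by
    rw [DForm.integralTriangle, integral_stdTriangle]
    refine MeasureTheory.setIntegral_congr_fun hm fun z hz => ?_
    have hint : triangleMap z ∈ interior stdTriangle := triangleMap_image ▸ mem_image_of_mem _ hz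
    have hnhds : stdTriangle ∈ 𝓝 (triangleMap z) := mem_interior_iff_mem_nhds.1 hint
    simp only [mfderivWithin_of_mem_nhds hnhds]
    have hσd : MDifferentiableAt 𝓘(ℝ, ℝ × ℝ) 𝓘(ℝ, E) σ (triangleMap z) :=
      (hσ.contMDiffAt hnhds).mdifferentiableAt (by simp)
    have h2 : ∀ v : ℝ × ℝ, (mfderiv 𝓘(ℝ, ℝ × ℝ) 𝓘(ℝ, E) (fun z => σ (triangleMap z)) z v : E) =
        mfderiv 𝓘(ℝ, ℝ × ℝ) 𝓘(ℝ, E) σ (triangleMap z) (fderiv ℝ triangleMap z v) := fun v =>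
      mfderiv_comp_fderiv hσd (contDiff_triangleMap.differentiable (by simp) z) v
    refine (ContinuousAlternatingMap.apply_linearMap_two (E := E)
      (F (σ (triangleMap z)) : E [⋀^Fin 2]→L[ℝ] ℝ)
      (mfderiv 𝓘(ℝ, ℝ × ℝ) 𝓘(ℝ, E) σ (triangleMap z) : ℝ × ℝ →L[ℝ] E)
      (fderiv ℝ triangleMap z)).symm.trans ?_
    exact (DForm.apply_two_congr F rfl (h2 _) (h2 _)).symm
  rw [h1]
  have hc := C.continuous_density hH
  have h3 : MeasureTheory.IntegrableOn (C.density fun z => σ (triangleMap z))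
      (Ioo (0 : ℝ) 1 ×ˢ Ioo (0 : ℝ) 1) (MeasureTheory.volume.prod MeasureTheory.volume) := by
    refine MeasureTheory.IntegrableOn.mono_set
      (hc.continuousOn.integrableOn_compact (isCompact_Icc.prod isCompact_Icc) :
        MeasureTheory.IntegrableOn _ (Icc (0 : ℝ) 1 ×ˢ Icc (0 : ℝ) 1) _) ?_
    exact prod_mono Ioo_subset_Icc_self Ioo_subset_Icc_self
  have h4 := MeasureTheory.setIntegral_prod _ h3
  refine Eq.trans h4 ?_
  simp only [intervalIntegral.integral_of_le zero_le_one, MeasureTheory.integral_Ioc_eq_integral_Ioo]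

/-- The smooth reparametrisation of a path. -/
def stepPath (γ : unitInterval → M) (t : ℝ) : M := γ ⟨smoothStep t, smoothStep_mem t⟩

open Classical in
/-- The holonomy of a path, with respect to the base points of the fibres. -/
def holonomy (γ : unitInterval → M) : Circle :=
  -- Arbitrary paths may have no transport; the default 1 makes the value total, so that it extends
  -- additively to all chains.
  if h : ∃ z, C.IsTransport (stepPath γ) 0 1 z then h.choose else 1

variable {C} in
theorem IsTransport.holonomy_eq {γ : unitInterval → M} {z : Circle}
    (h : C.IsTransport (stepPath γ) 0 1 z) : C.holonomy γ = z := by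
  have h1 : ∃ z, C.IsTransport (stepPath γ) 0 1 z := ⟨z, h⟩
  rw [holonomy, dif_pos h1]
  exact h1.choose_spec.unique zero_le_one h

/-- The holonomy of a one-chain. -/
def chainHolonomy : ((unitInterval → M) →₀ ℤ) →+ Additive Circle :=
  Finsupp.liftAddHom fun γ => zmultiplesHom (Additive Circle) (Additive.ofMul (C.holonomy γ))

theorem chainHolonomy_single (γ : unitInterval → M) :
    C.chainHolonomy (Finsupp.single γ 1) = Additive.ofMul (C.holonomy γ) := by
  simp [chainHolonomy]

/-- Three sides of the square run along the edges of the triangle and the left side collapses to the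
vertex (0,0), with transport 1. The holonomy formula for the square thus becomes the one for the
boundary. -/
theorem chainHolonomy_triangleBoundary {σ : ℝ × ℝ → M}
    (hσ : ContMDiffOn 𝓘(ℝ, ℝ × ℝ) 𝓘(ℝ, E) ∞ σ stdTriangle) :
    C.chainHolonomy (triangleBoundary σ) =
      Additive.ofMul (Circle.exp (-F.integralTriangle σ)) := by
  have hH : ContMDiff 𝓘(ℝ, ℝ × ℝ) 𝓘(ℝ, E) ∞ fun z => σ (triangleMap z) :=
    hσ.comp_contMDiff contDiff_triangleMap.contMDiff triangleMap_mem
  obtain ⟨zB, zR, zL, zT, hB, hR, hL, hT, hz⟩ := C.holonomyFormula_unitSquare hH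
  have e1 : (fun t : ℝ => σ (triangleMap (t, 0))) =
      stepPath fun t : unitInterval => σ ((t : ℝ), 0) := by
    funext t; simp [triangleMap, stepPath]
  have e2 : (fun t : ℝ => σ (triangleMap (1, t))) =
      stepPath fun t : unitInterval => σ (1 - (t : ℝ), (t : ℝ)) := by
    funext t; simp [triangleMap, stepPath]
  have e3 : (fun t : ℝ => σ (triangleMap (t, 1))) =
      stepPath fun t : unitInterval => σ (0, (t : ℝ)) := by
    funext t; simp [triangleMap, stepPath]
  have hL1 : zL = 1 := hL.unique zero_le_one
    (isTransport_const zero_le_one (x := σ (0, 0)) fun t => by simp [triangleMap])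
  rw [e1] at hB
  rw [e2] at hR
  rw [e3] at hT
  rw [← C.integralTriangle_eq hσ, hL1, mul_one] at hz
  rw [triangleBoundary, map_add, map_sub, C.chainHolonomy_single, C.chainHolonomy_single,
    C.chainHolonomy_single, hB.holonomy_eq, hR.holonomy_eq, hT.holonomy_eq, ← ofMul_div,
    ← ofMul_mul]
  congr 1
  rw [div_mul_eq_mul_div, mul_comm, hz, mul_div_assoc, div_self', mul_one]

/-- The holonomy of chains is a homomorphism, trivial on the zero boundary of a cycle. So the
exponential of minus the total integral is 1, and the total integral lies in 2πℤ. -/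
theorem hasIntegralPeriods (C : ConnectionCharts π θ F) : ((2 * Real.pi)⁻¹ • F : DForm E M 2).HasIntegralPeriods := by
  intro k a σ hσ hcycle
  have h1 := congrArg C.chainHolonomy hcycle
  rw [map_sum, map_zero] at h1
  simp only [map_zsmul, C.chainHolonomy_triangleBoundary (hσ _)] at h1
  have h2 : Circle.exp (∑ i, (a i : ℝ) * (-F.integralTriangle (σ i))) = 1 := by
    have h3 : ∀ i, (a i : ℝ) * (-F.integralTriangle (σ i)) = a i • (-F.integralTriangle (σ i)) :=
      fun i => (zsmul_eq_mul _ _).symm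
    simp only [h3]
    have h4 := map_sum Circle.expHom (fun i => a i • (-F.integralTriangle (σ i))) Finset.univ
    simp only [map_zsmul] at h4
    exact congrArg Additive.toMul (h4.trans h1)
  obtain ⟨n, hn⟩ := Circle.exp_eq_one.1 h2
  refine ⟨-n, ?_⟩
  have h5 : ∀ i, ((2 * Real.pi)⁻¹ • F : DForm E M 2).integralTriangle (σ i) =
      (2 * Real.pi)⁻¹ * F.integralTriangle (σ i) := fun i =>
    MeasureTheory.integral_const_mul (2 * Real.pi)⁻¹ _
  have hpi : (2 * Real.pi) ≠ 0 := by positivity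
  simp only [h5]
  have h6 : ∑ i, (a i : ℝ) * ((2 * Real.pi)⁻¹ * F.integralTriangle (σ i)) =
      -((2 * Real.pi)⁻¹ * ∑ i, (a i : ℝ) * (-F.integralTriangle (σ i))) := by
    rw [Finset.mul_sum, ← Finset.sum_neg_distrib]
    exact Finset.sum_congr rfl fun i _ => by ring
  rw [h6, hn]
  push_cast
  field_simp

end ConnectionCharts

end Periods
end

noncomputable section

/-! ### The rescaling theorem for one bundle -/

section Rescaling

variable {E : Type*} [NormedAddCommGroup E] [NormedSpace ℝ E] [FiniteDimensional ℝ E]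
variable {M : Type*} [TopologicalSpace M] [ChartedSpace E M] [IsManifold 𝓘(ℝ, E) ∞ M]
variable {E' : Type*} [NormedAddCommGroup E'] [NormedSpace ℝ E']
variable {P : Type*} [TopologicalSpace P] [ChartedSpace E' P] [IsManifold 𝓘(ℝ, E') ∞ P]

/-- The rescaling of the connection form of a circle bundle by the length of the fibres. -/
theorem exists_principal_rescaling [IsManifold 𝓘(ℝ, E') 1 P] {π : P → M}
    (hπ : IsSmoothCircleBundle E E' π) {η : DForm E M 1} {F : DForm E M 2} {θ : DForm E' P 1}
    (hθ : θ.IsSmooth) (hθπ : IsTransverseToFibres (E := E) π θ)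
    (hdθ : θ.d = (DForm.pullback π η).wedge θ + DForm.pullback π F) :
    ∃ f : M → ℝ, ContMDiff 𝓘(ℝ, E) 𝓘(ℝ, ℝ) ∞ f ∧ DForm.differential E f = η ∧
      (∃ Y : (p : P) → TangentSpace 𝓘(ℝ, E') p, IsSmoothVectorField Y ∧
        (∀ p, mfderiv 𝓘(ℝ, E') 𝓘(ℝ, E) π p (Y p) = 0) ∧ ∀ p, θ.covector p (Y p) = 1) ∧
      (∀ Y : (p : P) → TangentSpace 𝓘(ℝ, E') p,
        (∀ p, mfderiv 𝓘(ℝ, E') 𝓘(ℝ, E) π p (Y p) = 0) → (∀ p, θ.covector p (Y p) = 1) →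
        ∃ Φ : Circle → P → P, IsPrincipalCircleAction E E' π Φ ∧
          GeneratesCircleAction Φ (fun p => Real.exp (f (π p)) • Y p) ∧
          IsPrincipalConnection Φ (fun p => Real.exp (f (π p)) • Y p)
            (DForm.fsmul (fun p => Real.exp (-f (π p))) θ)) ∧
      (DForm.fsmul (fun p => Real.exp (-f (π p))) θ).d =
        DForm.pullback π (DForm.fsmul (fun x => Real.exp (-f x)) F) ∧
      ((2 * Real.pi)⁻¹ • DForm.fsmul (fun x => Real.exp (-f x)) F : DForm E M 2).HasIntegralPeriods := by
  obtain ⟨f, hf, hfη, hch⟩ := exists_logPeriod hπ hθ hθπ hdθ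
  choose T ch hunit hT using hch
  have hch' := fun x₀ => exists_chart_rescaled hf (ch x₀) (hunit x₀) (hT x₀)
  choose ch₀ hunit₀ using hch'
  have hu : ContMDiff 𝓘(ℝ, E') 𝓘(ℝ, ℝ) ∞ (fun p => Real.exp (-f (π p))) :=
    (Real.contDiff_exp.comp contDiff_neg).contMDiff.comp (hf.comp hπ.1)
  have hcurv : (DForm.fsmul (fun p => Real.exp (-f (π p))) θ).d =
      DForm.pullback π (DForm.fsmul (fun x => Real.exp (-f x)) F) :=
    d_rescaled hπ.1 hf hθ (by rw [hfη]; exact hdθ)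
  have hsm : (DForm.fsmul (fun p => Real.exp (-f (π p))) θ).IsSmooth := DForm.isSmooth_fsmul hu hθ
  have htr : IsTransverseToFibres (E := E) π (DForm.fsmul (fun p => Real.exp (-f (π p))) θ) :=
    hθπ.fsmul fun p => (Real.exp_pos _).ne'
  let C : ConnectionCharts π (DForm.fsmul (fun p => Real.exp (-f (π p))) θ)
    (DForm.fsmul (fun x => Real.exp (-f x)) F) := ⟨ch₀, hunit₀, hπ.1, hsm, hcurv⟩
  refine ⟨f, hf, hfη, ?_, ?_, hcurv, C.hasIntegralPeriods⟩
  · obtain ⟨Y, hY, hθY⟩ := exists_vertical hπ.1 ch hunit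
    exact ⟨Y, isSmoothVectorField_vertical hπ.1 hθπ ch hunit hY hθY, hY, hθY⟩
  · intro Y hY hθY
    have hY₀ : ∀ p, mfderiv 𝓘(ℝ, E') 𝓘(ℝ, E) π p (Real.exp (f (π p)) • Y p) = 0 := fun p => by
      refine (map_smul (mfderiv 𝓘(ℝ, E') 𝓘(ℝ, E) π p) _ _).trans ?_
      rw [hY p, smul_zero]
    have hθY₀ : ∀ p, (DForm.fsmul (fun p => Real.exp (-f (π p))) θ).covector p
        (Real.exp (f (π p)) • Y p) = 1 := fun p => by
      rw [DForm.fsmul_covector]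
      have h1 : θ.covector p (Real.exp (f (π p)) • Y p) = Real.exp (f (π p)) * θ.covector p (Y p) :=
        map_smul (θ.covector p) _ _
      rw [h1, hθY p, mul_one, ← Real.exp_add, neg_add_cancel, Real.exp_zero]
    exact ⟨circleAction ch₀, isPrincipalCircleAction_circleAction ch₀ hπ.1 hunit₀,
      generatesCircleAction_circleAction ch₀ hπ.1 htr hunit₀ hY₀ hθY₀,
      isPrincipalConnection_circleAction ch₀ hπ.1 hunit₀ hsm hcurv hθY₀⟩

end Rescaling

/-! ### Primitives of the same form -/

section LocallyConstant

variable {E : Type*} [NormedAddCommGroup E] [NormedSpace ℝ E]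
variable {M : Type*} [TopologicalSpace M] [ChartedSpace E M] [IsManifold 𝓘(ℝ, E) ∞ M]

theorem isLocallyConstant_sub_of_differential_eq {f g : M → ℝ}
    (hf : ContMDiff 𝓘(ℝ, E) 𝓘(ℝ, ℝ) ∞ f) (hg : ContMDiff 𝓘(ℝ, E) 𝓘(ℝ, ℝ) ∞ g)
    (h : DForm.differential E f = DForm.differential E g) : IsLocallyConstant (f - g) := by
  rw [IsLocallyConstant.iff_eventually_eq]
  intro x
  set c := extChartAt 𝓘(ℝ, E) x with hc
  obtain ⟨ε, hε, hball⟩ := Metric.isOpen_iff.1 (isOpen_extChartAt_target x) (c x)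
    (mem_extChartAt_target x)
  have hd : ∀ {f : M → ℝ}, ContMDiff 𝓘(ℝ, E) 𝓘(ℝ, ℝ) ∞ f → ∀ y ∈ Metric.ball (c x) ε,
      HasFDerivAt (fun y => f (c.symm y)) ((DForm.differential E f).pull c.symm y) y := by
    intro f hf y hy
    have h1 := (contMDiffAt_extChartAt_symm (hball hy)).mdifferentiableAt (by simp)
    exact hasMFDerivAt_iff_hasFDerivAt.1 (HasMFDerivAt.comp (g := f) y
      (hf.mdifferentiableAt (by simp)).hasMFDerivAt h1.hasMFDerivAt)
  have hconst : ∀ y ∈ Metric.ball (c x) ε,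
      f (c.symm y) - g (c.symm y) = f (c.symm (c x)) - g (c.symm (c x)) := by
    intro y hy
    have hsub : ∀ y ∈ Metric.ball (c x) ε,
        HasFDerivAt (fun y => f (c.symm y) - g (c.symm y)) (0 : E →L[ℝ] ℝ) y := by
      intro y hy
      refine ((hd hf y hy).sub (hd hg y hy)).congr_fderiv ?_
      rw [h, sub_self]
    exact Metric.isOpen_ball.is_const_of_fderiv_eq_zero (convex_ball (c x) ε).isPreconnected
      (fun y hy => (hsub y hy).differentiableAt.differentiableWithinAt)
      (fun y hy => (hsub y hy).fderiv) hy (Metric.mem_ball_self hε)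
  filter_upwards [(continuousAt_extChartAt (I := 𝓘(ℝ, E)) x).preimage_mem_nhds
    (Metric.ball_mem_nhds (c x) hε), extChartAt_source_mem_nhds (I := 𝓘(ℝ, E)) x] with y hy hys
  have h1 := hconst (c y) hy
  rw [c.left_inv hys, c.left_inv (mem_extChartAt_source x)] at h1
  exact h1

end LocallyConstant

/-! ### Pull-back of the bundle along a covering -/

section PullBack

variable {E : Type*} [NormedAddCommGroup E] [NormedSpace ℝ E]
variable {E' : Type*} [NormedAddCommGroup E'] [NormedSpace ℝ E']
variable {M : Type*} [TopologicalSpace M] [ChartedSpace E M] [IsManifold 𝓘(ℝ, E) ∞ M]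
variable {P : Type*} [TopologicalSpace P] [ChartedSpace E' P] [IsManifold 𝓘(ℝ, E') ∞ P]
variable {N : Type*} [TopologicalSpace N] [ChartedSpace E N] [IsManifold 𝓘(ℝ, E) ∞ N]
variable {Q : Type*} [TopologicalSpace Q] [ChartedSpace E' Q] [IsManifold 𝓘(ℝ, E') ∞ Q]
variable {π : P → M} {q : N → M} {π' : Q → N} {q' : Q → P}

theorem IsLocalDiffeomorphAt.isInvertible_mfderiv {x : N}
    (h : IsLocalDiffeomorphAt 𝓘(ℝ, E) 𝓘(ℝ, E) ∞ q x) :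
    (mfderiv 𝓘(ℝ, E) 𝓘(ℝ, E) q x).IsInvertible :=
  ⟨h.mfderivToContinuousLinearEquiv (by simp), h.mfderivToContinuousLinearEquiv_coe (by simp)⟩

theorem IsLocalDiffeomorphAt.eq_zero_of_mfderiv {x : N}
    (h : IsLocalDiffeomorphAt 𝓘(ℝ, E) 𝓘(ℝ, E) ∞ q x) {v : E}
    (hv : (mfderiv 𝓘(ℝ, E) 𝓘(ℝ, E) q x v : E) = 0) : v = 0 := by
  refine (h.mfderivToContinuousLinearEquiv (by simp)).injective
    (Eq.trans ?_ (ContinuousLinearEquiv.map_zero _).symm)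
  refine Eq.trans ?_ hv
  exact congrArg (fun L : E →L[ℝ] E => L v) (h.mfderivToContinuousLinearEquiv_coe (by simp))

theorem IsLocalDiffeomorphAt.mfderiv_mpullback {r : Q}
    (h : IsLocalDiffeomorphAt 𝓘(ℝ, E') 𝓘(ℝ, E') ∞ q' r) (Y : (p : P) → TangentSpace 𝓘(ℝ, E') p) :
    mfderiv 𝓘(ℝ, E') 𝓘(ℝ, E') q' r (VectorField.mpullback 𝓘(ℝ, E') 𝓘(ℝ, E') q' Y r) = Y (q' r) :=
  (h.isInvertible_mfderiv.inverse_apply_eq.1 rfl).symm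

namespace IsPullbackAlongCovering

theorem mfderiv_comm (h : IsPullbackAlongCovering E E' π q π' q')
    (hπ : ContMDiff 𝓘(ℝ, E') 𝓘(ℝ, E) ∞ π) (hq : ContMDiff 𝓘(ℝ, E) 𝓘(ℝ, E) ∞ q) (r : Q) (v : E') :
    (mfderiv 𝓘(ℝ, E') 𝓘(ℝ, E) π (q' r) (mfderiv 𝓘(ℝ, E') 𝓘(ℝ, E') q' r v) : E) =
      mfderiv 𝓘(ℝ, E) 𝓘(ℝ, E) q (π' r) (mfderiv 𝓘(ℝ, E') 𝓘(ℝ, E) π' r v) := by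
  have h1 := mfderiv_comp (f := q') (g := π) r (hπ.mdifferentiableAt (by simp))
    (h.local_diffeo.contMDiff.mdifferentiableAt (by simp))
  have h2 := mfderiv_comp (f := π') (g := q) r (hq.mdifferentiableAt (by simp))
    (h.smooth_proj.mdifferentiableAt (by simp))
  have h3 : π ∘ q' = q ∘ π' := funext h.comm
  have e : ∀ g g' : Q → M, g = g' → (mfderiv 𝓘(ℝ, E') 𝓘(ℝ, E) g r v : E) =
      mfderiv 𝓘(ℝ, E') 𝓘(ℝ, E) g' r v := by rintro g _ rfl; rfl
  exact (DFunLike.congr_fun h1 v).symm.trans ((e _ _ h3).trans (DFunLike.congr_fun h2 v))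

/-- Differentiate π ∘ q' = q ∘ π' and use that dq is injective; vertical vectors of the two bundles
then correspond under dq'. -/
theorem mfderiv_proj_eq_zero_iff (h : IsPullbackAlongCovering E E' π q π' q')
    (hπ : ContMDiff 𝓘(ℝ, E') 𝓘(ℝ, E) ∞ π) (hq : IsLocalDiffeomorph 𝓘(ℝ, E) 𝓘(ℝ, E) ∞ q) (r : Q)
    (v : E') : (mfderiv 𝓘(ℝ, E') 𝓘(ℝ, E) π' r v : E) = 0 ↔
      (mfderiv 𝓘(ℝ, E') 𝓘(ℝ, E) π (q' r) (mfderiv 𝓘(ℝ, E') 𝓘(ℝ, E') q' r v) : E) = 0 := by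
  rw [h.mfderiv_comm hπ hq.contMDiff]
  constructor
  · intro h0
    rw [h0]
    exact ContinuousLinearMap.map_zero (mfderiv 𝓘(ℝ, E) 𝓘(ℝ, E) q (π' r) : E →L[ℝ] E)
  · exact (hq (π' r)).eq_zero_of_mfderiv

theorem isTransverseToFibres (h : IsPullbackAlongCovering E E' π q π' q')
    (hπ : ContMDiff 𝓘(ℝ, E') 𝓘(ℝ, E) ∞ π) (hq : IsLocalDiffeomorph 𝓘(ℝ, E) 𝓘(ℝ, E) ∞ q)
    {θ : DForm E' P 1} (hθπ : IsTransverseToFibres (E := E) π θ) :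
    IsTransverseToFibres (E := E) π' (DForm.pullback q' θ : DForm E' Q 1) := by
  intro r
  have hinv := (h.local_diffeo r).isInvertible_mfderiv
  refine ⟨Submodule.disjoint_def.2 ?_, Submodule.codisjoint_iff_exists_add_eq.2 ?_⟩
  · intro v hv1 hv2
    refine (h.local_diffeo r).eq_zero_of_mfderiv ?_
    refine (Submodule.mem_bot ℝ).1 ((hθπ (q' r)).disjoint.le_bot
      (x := mfderiv 𝓘(ℝ, E') 𝓘(ℝ, E') q' r v) ⟨LinearMap.mem_ker.2 (LinearMap.mem_ker.1 hv1), ?_⟩)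
    exact LinearMap.mem_ker.2 ((h.mfderiv_proj_eq_zero_iff hπ hq r v).1 (LinearMap.mem_ker.1 hv2))
  · intro v
    obtain ⟨a, b, ha, hb, hab⟩ := Submodule.codisjoint_iff_exists_add_eq.1 (hθπ (q' r)).codisjoint
      (mfderiv 𝓘(ℝ, E') 𝓘(ℝ, E') q' r v)
    have hinv_apply : ∀ a, mfderiv 𝓘(ℝ, E') 𝓘(ℝ, E') q' r
        ((mfderiv 𝓘(ℝ, E') 𝓘(ℝ, E') q' r).inverse a) = a := fun a =>
      (hinv.inverse_apply_eq.1 rfl).symm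
    refine ⟨(mfderiv 𝓘(ℝ, E') 𝓘(ℝ, E') q' r).inverse a,
      (mfderiv 𝓘(ℝ, E') 𝓘(ℝ, E') q' r).inverse b, LinearMap.mem_ker.2 ?_, LinearMap.mem_ker.2 ?_, ?_⟩
    · change θ.covector (q' r) (mfderiv 𝓘(ℝ, E') 𝓘(ℝ, E') q' r _) = 0
      rw [hinv_apply]; exact LinearMap.mem_ker.1 ha
    · refine (h.mfderiv_proj_eq_zero_iff hπ hq r _).2 ?_
      rw [hinv_apply]; exact LinearMap.mem_ker.1 hb
    · refine (map_add _ a b).symm.trans ?_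
      exact hinv.inverse_apply_eq.2 hab

theorem structure_equation (h : IsPullbackAlongCovering E E' π q π' q')
    (hπ : ContMDiff 𝓘(ℝ, E') 𝓘(ℝ, E) ∞ π) (hq : ContMDiff 𝓘(ℝ, E) 𝓘(ℝ, E) ∞ q)
    {η : DForm E M 1} {F : DForm E M 2} {θ : DForm E' P 1} (hθ : θ.IsSmooth)
    (hdθ : θ.d = (DForm.pullback π η).wedge θ + DForm.pullback π F) :
    (DForm.pullback q' θ : DForm E' Q 1).d =
      (DForm.pullback π' (DForm.pullback q η : DForm E N 1)).wedge (DForm.pullback q' θ) +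
        DForm.pullback π' (DForm.pullback q F : DForm E N 2) := by
  rw [DForm.d_pullback h.local_diffeo.contMDiff hθ, hdθ]
  funext r
  refine DForm.ext_two fun v w => ?_
  rw [DForm.pullback_apply_two]
  change ((DForm.pullback π η).wedge θ (q' r)) ![_, _] + (DForm.pullback π F (q' r)) ![_, _] =
    ((DForm.pullback π' (DForm.pullback q η : DForm E N 1)).wedge (DForm.pullback q' θ) r) ![v, w] +
      (DForm.pullback π' (DForm.pullback q F : DForm E N 2) r) ![v, w]
  rw [DForm.wedge_apply_two, DForm.wedge_apply_two, DForm.pullback_apply_two,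
    DForm.pullback_apply_two, DForm.pullback_apply_two]
  have hη : ∀ v, (DForm.pullback π η : DForm E' P 1).covector (q' r)
      (mfderiv 𝓘(ℝ, E') 𝓘(ℝ, E') q' r v) =
      (DForm.pullback π' (DForm.pullback q η : DForm E N 1)).covector r v := by
    intro v
    rw [DForm.pullback_covector, DForm.pullback_covector, DForm.pullback_covector]
    exact (DForm.covector_congr η (h.comm r) _).trans
      (congrArg (η.covector _ : E →L[ℝ] ℝ) (h.mfderiv_comm hπ hq r v))
  rw [hη, hη]
  congr 1
  exact DForm.apply_two_congr F (h.comm r) (h.mfderiv_comm hπ hq r v) (h.mfderiv_comm hπ hq r w)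

/-- Over a set where q is injective, a trivialisation of P is transported through q': the fibre
coordinate is that of q' r, and the inverse is given by the fibre product property. -/
theorem isSmoothCircleBundle (h : IsPullbackAlongCovering E E' π q π' q')
    (hπ : IsSmoothCircleBundle E E' π) (hq : IsLocalDiffeomorph 𝓘(ℝ, E) 𝓘(ℝ, E) ∞ q) :
    IsSmoothCircleBundle E E' π' := by
  refine ⟨h.smooth_proj, fun x => ?_⟩
  obtain ⟨e, hxe, he⟩ := hπ.2 (q x)
  obtain ⟨Θ, hxΘ, hΘ⟩ := hq x
  have hinj : InjOn q Θ.source := fun a ha b hb hab =>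
    Θ.toPartialEquiv.injOn ha hb (by rw [← hΘ ha, ← hΘ hb, hab])
  have htgt : ∀ x, q x ∈ e.baseSet → ∀ z, (q x, z) ∈ e.target := fun x hx z => e.mem_target.2 hx
  have hproj : ∀ x, q x ∈ e.baseSet → ∀ z, π (e.toOpenPartialHomeomorph.symm (q x, z)) = q x :=
    fun x hx z => e.proj_symm_apply (htgt x hx z)
  obtain ⟨r₀, -, -⟩ := h.fibre_product x _ (hproj x hxe 1)
  have hψ : ∀ a : N × Circle, ∃ r, q a.1 ∈ e.baseSet → π' r = a.1 ∧
      q' r = e.toOpenPartialHomeomorph.symm (q a.1, a.2) := by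
    intro a
    by_cases ha : q a.1 ∈ e.baseSet
    · obtain ⟨r, hr, -⟩ := h.fibre_product a.1 _ (hproj a.1 ha a.2)
      exact ⟨r, fun _ => hr⟩
    · exact ⟨r₀, fun h => absurd h ha⟩
  choose ψ hψ using hψ
  have huniq : ∀ r r', π' r = π' r' → q' r = q' r' → r = r' := fun r r' h1 h2 =>
    (h.fibre_product (π' r') (q' r') (h.comm r')).unique ⟨h1, h2⟩ ⟨rfl, rfl⟩
  have hU : IsOpen (Θ.source ∩ q ⁻¹' e.baseSet) :=
    Θ.open_source.inter (e.open_baseSet.preimage hq.contMDiff.continuous)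
  have hsrc : ∀ r, π' r ∈ Θ.source ∩ q ⁻¹' e.baseSet → q' r ∈ e.source := fun r hr => by
    rw [e.mem_source, h.comm]; exact hr.2
  have key := exists_isSmoothTrivialization h.smooth_proj hU
    (φ := fun r => (e (q' r)).2) (ψ := ψ) ?_ ?_ ?_ ?_ ?_
  · obtain ⟨e', he', -, hes⟩ := key
    exact ⟨e', he' ▸ ⟨hxΘ, hxe⟩, hes⟩
  · exact contMDiff_snd.comp_contMDiffOn (he.1.comp h.local_diffeo.contMDiff.contMDiffOn hsrc)
  · rintro ⟨x₁, z₁⟩ ⟨hx₁, -⟩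
    refine ContMDiffAt.contMDiffWithinAt ?_
    obtain ⟨hr1, hr2⟩ := hψ (x₁, z₁) hx₁.2
    set r₁ := ψ (x₁, z₁) with hr₁
    have hd := h.local_diffeo r₁
    have h1 : ContMDiffAt (𝓘(ℝ, E).prod (𝓡 1)) 𝓘(ℝ, E') ∞
        (fun a : N × Circle => e.toOpenPartialHomeomorph.symm (q a.1, a.2)) (x₁, z₁) := by
      refine ContMDiffAt.comp (g := e.toOpenPartialHomeomorph.symm)
        (f := fun a : N × Circle => (q a.1, a.2)) (x₁, z₁)
        (he.2.contMDiffAt (e.open_target.mem_nhds (htgt x₁ hx₁.2 z₁))) ?_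
      have h2 : ContMDiffAt (𝓘(ℝ, E).prod (𝓡 1)) 𝓘(ℝ, E) ∞ (fun a : N × Circle => q a.1) (x₁, z₁) :=
        ContMDiffAt.comp (g := q) (f := fun a : N × Circle => a.1) (x₁, z₁)
          hq.contMDiff.contMDiffAt contMDiffAt_fst
      exact h2.prodMk contMDiffAt_snd
    have h3 : ContMDiffAt 𝓘(ℝ, E') 𝓘(ℝ, E') ∞ hd.localInverse
        (e.toOpenPartialHomeomorph.symm (q x₁, z₁)) := hr2 ▸ hd.localInverse_contMDiffAt
    have h4 := ContMDiffAt.comp (g := hd.localInverse)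
      (f := fun a : N × Circle => e.toOpenPartialHomeomorph.symm (q a.1, a.2)) (x₁, z₁) h3 h1
    refine h4.congr_of_eventuallyEq ?_
    have hval : hd.localInverse (e.toOpenPartialHomeomorph.symm (q x₁, z₁)) = r₁ := by
      have := hd.localInverse_left_inv hd.localInverse_mem_target
      rwa [hr2] at this
    have h5 : ∀ᶠ a : N × Circle in 𝓝 (x₁, z₁),
        e.toOpenPartialHomeomorph.symm (q a.1, a.2) ∈ hd.localInverse.source :=
      h1.continuousAt.eventually (hd.localInverse.open_source.mem_nhds
        (by change e.toOpenPartialHomeomorph.symm (q x₁, z₁) ∈ _; rw [← hr2]; exact hd.localInverse_mem_source))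
    -- Smoothness of ψ comes from identifying it with a local inverse of q' after the inverse
    -- trivialisation. Both have the same image in P; their projections to N lie in the same sheet
    -- and agree under q, so they coincide.
    have h6 : ∀ᶠ a : N × Circle in 𝓝 (x₁, z₁),
        π' (hd.localInverse (e.toOpenPartialHomeomorph.symm (q a.1, a.2))) ∈ Θ.source := by
      refine (h.smooth_proj.continuous.continuousAt.comp h4.continuousAt).eventually
        (Θ.open_source.mem_nhds ?_)
      change π' (hd.localInverse (e.toOpenPartialHomeomorph.symm (q x₁, z₁))) ∈ _
      rw [hval, hr1]; exact hx₁.1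
    have h7 : ∀ᶠ a : N × Circle in 𝓝 (x₁, z₁), a.1 ∈ Θ.source ∩ q ⁻¹' e.baseSet :=
      (hU.preimage continuous_fst).mem_nhds hx₁
    filter_upwards [h5, h6, h7] with a ha5 ha6 ha7
    obtain ⟨ha1, ha2⟩ := hψ a ha7.2
    have hq' : q' (hd.localInverse (e.toOpenPartialHomeomorph.symm (q a.1, a.2))) =
        e.toOpenPartialHomeomorph.symm (q a.1, a.2) := hd.localInverse_right_inv ha5
    refine huniq _ _ ?_ (ha2.trans hq'.symm)
    rw [ha1]
    refine hinj ha7.1 ha6 ?_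
    change q a.1 = q (π' (hd.localInverse (e.toOpenPartialHomeomorph.symm (q a.1, a.2))))
    rw [← h.comm, hq', hproj a.1 ha7.2]
  · exact fun x hx z => (hψ (x, z) hx.2).1
  · intro x hx z
    rw [(hψ (x, z) hx.2).2, e.apply_symm_apply (htgt x hx.2 z)]
  · intro r hr
    have hr' := hψ (π' r, (e (q' r)).2) hr.2
    refine huniq _ _ hr'.1 (hr'.2.trans ?_)
    change e.toOpenPartialHomeomorph.symm (q (π' r), (e (q' r)).2) = q' r
    rw [← h.comm, ← e.coe_fst (hsrc r hr)]
    exact e.toOpenPartialHomeomorph.left_inv (hsrc r hr)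

end IsPullbackAlongCovering

end PullBack
end

theorem mainTheorem2
    {E : Type*} [NormedAddCommGroup E] [NormedSpace ℝ E] [FiniteDimensional ℝ E]
    {E' : Type*} [NormedAddCommGroup E'] [NormedSpace ℝ E'] [FiniteDimensional ℝ E']
    {M : Type*} [TopologicalSpace M] [ChartedSpace E M] [IsManifold 𝓘(ℝ, E) ∞ M]
    [T2Space M] [SecondCountableTopology M]
    {P : Type*} [TopologicalSpace P] [ChartedSpace E' P] [IsManifold 𝓘(ℝ, E') ∞ P]
    [T2Space P] [SecondCountableTopology P]
    -- the shear data on `M`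
    (X : (x : M) → TangentSpace 𝓘(ℝ, E) x) (hX : IsSmoothVectorField X)
    (η : DForm E M 1) (hη : η.IsSmooth) (hη_closed : η.d = 0)
    (hηX : ∀ x, η.covector x (X x) = 0)
    (F : DForm E M 2) (hF : F.IsSmooth) (hdF : F.d = η.wedge F)
    -- the circle bundle and its one-form
    (π : P → M) (hπ : IsSmoothCircleBundle E E' π)
    (θ : DForm E' P 1) (hθ : θ.IsSmooth) (hθπ : IsTransverseToFibres (E := E) π θ)
    (hdθ : θ.d = (DForm.pullback π η).wedge θ + DForm.pullback π F) :
    η.IsExact ∧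
    -- the vertical vector field `Y` with `θ(Y) = 1`
    ∃ Y : (p : P) → TangentSpace 𝓘(ℝ, E') p, IsSmoothVectorField Y ∧
      (∀ p, mfderiv 𝓘(ℝ, E') 𝓘(ℝ, E) π p (Y p) = 0) ∧ (∀ p, θ.covector p (Y p) = 1) ∧
      -- any cover `q : N → M` with `q^*η = df₀`, and the pull-back `Q → N` of `P`
      ∀ (N : Type*) [TopologicalSpace N] [ChartedSpace E N] [IsManifold 𝓘(ℝ, E) ∞ N]
        (Q : Type*) [TopologicalSpace Q] [ChartedSpace E' Q] [IsManifold 𝓘(ℝ, E') ∞ Q]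
        (q : N → M) (π' : Q → N) (q' : Q → P),
        IsSmoothCovering E q → IsPullbackAlongCovering E E' π q π' q' →
        ∀ f₀ : N → ℝ, ContMDiff 𝓘(ℝ, E) 𝓘(ℝ, ℝ) ∞ f₀ →
          DForm.differential E f₀ = DForm.pullback q η →
        ∃ f : N → ℝ, ContMDiff 𝓘(ℝ, E) 𝓘(ℝ, ℝ) ∞ f ∧
          DForm.differential E f = DForm.pullback q η ∧
          IsLocallyConstant (f - f₀) ∧
          -- the rescaled pair `(e^f Y, e^{-f} θ)` on `Q`, and the form `e^{-f} F` on `N`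
          (let Y₀ : (r : Q) → TangentSpace 𝓘(ℝ, E') r := fun r =>
            Real.exp (f (π' r)) • VectorField.mpullback 𝓘(ℝ, E') 𝓘(ℝ, E') q' Y r
          let θ₀ : DForm E' Q 1 :=
            DForm.fsmul (fun r => Real.exp (-f (π' r))) (DForm.pullback q' θ)
          let F₀ : DForm E N 2 :=
            DForm.fsmul (fun x => Real.exp (-f x)) (DForm.pullback q F)
          (∃ Φ : Circle → Q → Q, IsPrincipalCircleAction E E' π' Φ ∧
            GeneratesCircleAction Φ Y₀ ∧ IsPrincipalConnection Φ Y₀ θ₀) ∧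
          θ₀.d = DForm.pullback π' F₀ ∧
          ((2 * Real.pi)⁻¹ • F₀ : DForm E N 2).HasIntegralPeriods) := by
  obtain ⟨f, hf, hfη, ⟨Y, hYs, hY, hθY⟩, -⟩ := exists_principal_rescaling hπ hθ hθπ hdθ
  refine ⟨⟨f, hf, hfη⟩, Y, hYs, hY, hθY, ?_⟩
  intro N _ _ _ Q _ _ _ q π' q' hq hQ f₀ hf₀ hf₀η
  -- The function on the cover is built from the fibre lengths of the pulled back bundle itself; f₀
  -- enters only through the comparison of differentials.
  obtain ⟨g, hg, hgη, -, hprinc, hcurv, hper⟩ := exists_principal_rescaling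
    (hQ.isSmoothCircleBundle hπ hq.2)
    (DForm.isSmooth_pullback hQ.local_diffeo.contMDiff hθ : (DForm.pullback q' θ).IsSmooth)
    (hQ.isTransverseToFibres hπ.1 hq.2 hθπ)
    (hQ.structure_equation hπ.1 hq.2.contMDiff hθ hdθ)
  refine ⟨g, hg, hgη, isLocallyConstant_sub_of_differential_eq hg hf₀ (hgη.trans hf₀η.symm),
    hprinc (VectorField.mpullback 𝓘(ℝ, E') 𝓘(ℝ, E') q' Y) ?_ ?_, hcurv, hper⟩
  · intro r
    refine (hQ.mfderiv_proj_eq_zero_iff hπ.1 hq.2 r _).2 ?_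
    exact (congrArg _ ((hQ.local_diffeo r).mfderiv_mpullback Y)).trans (hY (q' r))
  · intro r
    exact (congrArg _ ((hQ.local_diffeo r).mfderiv_mpullback Y)).trans (hθY (q' r))
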